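/- Let $n\ge 2$, let $d\sigma$ be the normalized Lebesgue measure on the unit sphere $S^{n-1}\subset\mathbb R^n$, and let $0<\beta\le 1$, $0\le\alpha<n-\beta$, $\frac{n}{n+\beta}<p<1$, $\frac1q=\frac1p-\frac{\alpha+\beta}{n}$. Suppose that $$r>\max\Big\{\frac{n}{\beta+n-n/p},\ \frac{n}{n-\alpha-\beta}\Big\}$$ and that $\Omega:\mathbb R^n\times\mathbb R^n\to\mathbb C$ is a measurable function such that $\Omega(x,\lambda z)=\Omega(x,z)$ for all $x,z\in\mathbb R^n$, $\lambda>0$, and $\sup_{x}\big(\int_{S^{n-1}}|\Omega(x,z')|^r\,d\sigma(z')\big)^{1/r}<\infty$. Suppose moreover that $$\int_0^1\frac{\omega_r(\delta)}{\delta^{1+\beta}}\,d\delta<\infty,\qquad \omega_r(\delta)=\sup_{x\in\mathbb R^n,\ |\rho|<\delta}\Big(\int_{S^{n-1}}|\Omega(x,\rho z')-\Omega(x,z')|^r\,d\sigma(z')\Big)^{1/r},$$ where $\rho$ ranges over the rotations of $\mathbb R^n$ and $|\rho|=\sup_{z'\in S^{n-1}}|\rho z'-z'|$. (No cancellation of $\Omega$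 is assumed.) For a function $b:\mathbb R^n\to\mathbb C$ put $\|b\|_{\mathrm{Lip}_\beta}=\sup_{x\ne y}|b(x)-b(y)|/|x-y|^\beta$, and for a function $f$ put $$[b,T_{\Omega,\alpha}]f(x)=\int_{\mathbb R^n}\frac{\Omega(x,x-y)}{|x-y|^{n-\alpha}}\,(b(x)-b(y))f(y)\,dy .$$ The Hardy space $H^p=H^p(\mathbb R^n)$ consists of the tempered distributions $F=\sum_j\lambda_ja_j$ (convergence in the sense of distributions) with $\lambda_j\in\mathbb C$, $\sum_j|\lambda_j|^p<\infty$ and $(p,2)$-atoms $a_j$, with $\|F\|_{H^p}=\inf\big(\sum_j|\lambda_j|^p\big)^{1/p}$ over all such decompositions; a $(p,2)$-atom is a function $a\in L^2$ supported in a closed ball $B$ with $\|a\|_{L^2}\le|B|^{1/2-1/p}$ and $\int a(x)x^\gamma\,dx=0$ for all multi-indices with $|\gamma|\le\lfloor n(1/p-1)\rfloor$. Then there is a constant $C>0$ such that for every $b$ with $\|b\|_{\mathrm{Lip}_\beta}<\infty$ the commutator is bounded from $H^p$ into $L^q$ with norm at most $C\|b\|_{\mathrm{Lip}_\beta}$.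 That is: there is exactly one bounded linear operator $[b,T_{\Omega,\alpha}]:H^p\to L^q(\mathbb R^n)$ such that, whenever $F\in H^p$ is given by a function $f\in L^\ell(\mathbb R^n)$ with $\frac{r}{r-1}<\ell<\frac{n}{\alpha+\beta}$, the integral above converges absolutely and equals $[b,T_{\Omega,\alpha}]F(x)$ for almost every $x$; and this operator satisfies $$\|[b,T_{\Omega,\alpha}]F\|_{L^q}\le C\,\|b\|_{\mathrm{Lip}_\beta}\,\|F\|_{H^p}\qquad\text{for all }F\in H^p,$$ with $C$ independent of $F$ and $b$. -/

import Mathlib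

open MeasureTheory Metric Set
open scoped ENNReal NNReal SchwartzMap

noncomputable section

namespace VariableKernel

/-- Euclidean space `ℝⁿ`. -/
abbrev Rn (n : ℕ) : Type := EuclideanSpace ℝ (Fin n)

/-- The unit sphere `Sⁿ⁻¹`. -/
abbrev Sph (n : ℕ) : Type := sphere (0 : Rn n) 1

/-- Normalized Lebesgue (surface) measure on the unit sphere. -/
def sphereMeasure (n : ℕ) : Measure (Sph n) :=
  ((volume : Measure (Rn n)).toSphere univ)⁻¹ • (volume : Measure (Rn n)).toSphere

/-- `‖Ω‖ = sup_x (∫_{S^{n-1}} |Ω(x,z')|^r dσ(z'))^{1/r}`. -/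
def kernelNorm {n : ℕ} (r : ℝ) (Ω : Rn n → Rn n → ℂ) : ℝ≥0∞ :=
  ⨆ x : Rn n, (∫⁻ z : Sph n, ‖Ω x z‖ₑ ^ r ∂sphereMeasure n) ^ (1 / r)

/-- `Ω ∈ L^∞(ℝⁿ) × L^r(S^{n-1})`: a (jointly Borel) function on `ℝⁿ × ℝⁿ`, homogeneous of degree
zero in the second variable, with finite mixed norm. -/
structure IsKernel {n : ℕ} (r : ℝ) (Ω : Rn n → Rn n → ℂ) : Prop where
  measurable : Measurable (Function.uncurry Ω)
  homogeneous : ∀ (x z : Rn n) (t : ℝ), 0 < t → Ω x (t • z) = Ω x z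
  norm_lt_top : kernelNorm r Ω < ∞

/-- A rotation of `ℝⁿ`: a linear isometry of determinant one. -/
def IsRotation {n : ℕ} (ρ : Rn n ≃ₗᵢ[ℝ] Rn n) : Prop :=
  LinearMap.det (ρ.toLinearEquiv : Rn n →ₗ[ℝ] Rn n) = 1

/-- `|ρ| = sup_{z' ∈ S^{n-1}} |ρ z' - z'|`. -/
def rotationSize {n : ℕ} (ρ : Rn n ≃ₗᵢ[ℝ] Rn n) : ℝ≥0∞ :=
  ⨆ z : Sph n, ‖ρ z - (z : Rn n)‖ₑ

/-- The integral modulus of continuity of order `r` of `Ω` in its second variable. -/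
def modulus {n : ℕ} (r : ℝ) (Ω : Rn n → Rn n → ℂ) (δ : ℝ) : ℝ≥0∞ :=
  ⨆ (x : Rn n) (ρ : Rn n ≃ₗᵢ[ℝ] Rn n) (_ : IsRotation ρ)
    (_ : rotationSize ρ < ENNReal.ofReal δ),
      (∫⁻ z : Sph n, ‖Ω x (ρ z) - Ω x z‖ₑ ^ r ∂sphereMeasure n) ^ (1 / r)

/-- `∫₀¹ ω_r(δ) δ^{-1-β} dδ < ∞`. -/
def DiniCondition {n : ℕ} (r β : ℝ) (Ω : Rn n → Rn n → ℂ) : Prop :=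
  ∫⁻ δ in Ioo (0 : ℝ) 1, modulus r Ω δ / ENNReal.ofReal (δ ^ (1 + β)) < ∞

/-- The homogeneous Lipschitz (Hölder) seminorm `sup_{x ≠ y} |b(x) - b(y)| / |x - y|^β`. -/
def lipNorm {n : ℕ} (β : ℝ) (b : Rn n → ℂ) : ℝ≥0∞ :=
  ⨆ (x : Rn n) (y : Rn n) (_ : x ≠ y), ‖b x - b y‖ₑ / ENNReal.ofReal (‖x - y‖ ^ β)

/-- The integrand of the commutator `[b, T_{Ω,α}] f (x)`. -/
def commutatorIntegrand {n : ℕ} (Ω : Rn n → Rn n → ℂ) (α : ℝ) (b f : Rn n → ℂ) (x y : Rn n) : ℂ :=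
  Ω x (x - y) / ((‖x - y‖ ^ ((n : ℝ) - α) : ℝ) : ℂ) * (b x - b y) * f y

/-- The commutator `[b, T_{Ω,α}] f (x)` of a function `f`, as a Lebesgue integral. -/
def commutator {n : ℕ} (Ω : Rn n → Rn n → ℂ) (α : ℝ) (b f : Rn n → ℂ) (x : Rn n) : ℂ :=
  ∫ y, commutatorIntegrand Ω α b f x y

/-- `(p,s)`-atoms, with vanishing moments up to order `⌊n(1/p - 1)⌋`. -/
def IsAtom {n : ℕ} (p s : ℝ) (a : Rn n → ℂ) : Prop :=
  MemLp a (ENNReal.ofReal s) volume ∧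
  ∃ (x₀ : Rn n) (d : ℝ), 0 < d ∧
    Function.support a ⊆ closedBall x₀ d ∧
    eLpNorm a (ENNReal.ofReal s) volume ≤ volume (closedBall x₀ d) ^ (1 / s - 1 / p) ∧
    ∀ γ : Fin n → ℕ, ((∑ i, γ i : ℕ) : ℤ) ≤ ⌊(n : ℝ) * (1 / p - 1)⌋ →
      ∫ x, a x * ((∏ i, x i ^ γ i : ℝ) : ℂ) = 0

/-- `f = ∑ j, c j • a j` in the sense of distributions, where the `a j` are `(p,2)`-atoms and
`∑ j, |c j| ^ p < ∞`. -/
structure IsAtomicDecomposition {n : ℕ} (p : ℝ) (f : 𝓢'(Rn n, ℂ)) (c : ℕ → ℂ)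
    (a : ℕ → Rn n → ℂ) : Prop where
  isAtom : ∀ j, IsAtom p 2 (a j)
  cost_lt_top : ∑' j, ‖c j‖ₑ ^ p < ∞
  hasSum : ∀ φ : 𝓢(Rn n, ℂ), HasSum (fun j => c j * ∫ x, a j x * φ x) (f φ)

/-- The (atomic) `H^p` quasi-norm. -/
def hardyNorm {n : ℕ} (p : ℝ) (f : 𝓢'(Rn n, ℂ)) : ℝ≥0∞ :=
  ⨅ (c : ℕ → ℂ) (a : ℕ → Rn n → ℂ) (_ : IsAtomicDecomposition p f c a),
    (∑' j, ‖c j‖ₑ ^ p) ^ (1 / p)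

theorem isAtom_zero {n : ℕ} (p s : ℝ) : IsAtom p s (0 : Rn n → ℂ) := by
  refine ⟨MemLp.zero, 0, 1, one_pos, by simp, by simp, by simp⟩

/-- The (real-variable) Hardy space `H^p(ℝⁿ)`, `0 < p ≤ 1`: the tempered distributions that have an
atomic decomposition. -/
def Hardy (n : ℕ) (p : ℝ) (hp : 0 < p) : Submodule ℂ 𝓢'(Rn n, ℂ) where
  carrier := {f | ∃ c a, IsAtomicDecomposition p f c a}
  zero_mem' := ⟨0, 0, fun _ => isAtom_zero p 2, by simp [hp], fun φ => by simp⟩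
  add_mem' := by
    rintro f g ⟨c, a, h⟩ ⟨c', a', h'⟩
    let e := Equiv.natSumNatEquivNat
    refine ⟨Sum.elim c c' ∘ e.symm, Sum.elim a a' ∘ e.symm, ?_, ?_, ?_⟩
    · intro j
      rcases hj : e.symm j with k | k
      · simpa [hj] using h.isAtom k
      · simpa [hj] using h'.isAtom k
    · have : ∑' j, ‖(Sum.elim c c' ∘ e.symm) j‖ₑ ^ p = ∑' i, ‖Sum.elim c c' i‖ₑ ^ p :=
        e.symm.tsum_eq (fun i => ‖Sum.elim c c' i‖ₑ ^ p)
      rw [this, Summable.tsum_sum ENNReal.summable ENNReal.summable]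
      simpa using ⟨h.cost_lt_top, h'.cost_lt_top⟩
    · intro φ
      refine (e.symm.hasSum_iff
        (f := fun i => Sum.elim c c' i * ∫ x, Sum.elim a a' i x * φ x)).2 ?_
      exact HasSum.sum (h.hasSum φ) (h'.hasSum φ)
  smul_mem' := by
    rintro t f ⟨c, a, h⟩
    refine ⟨fun j => t * c j, a, h.isAtom, ?_, fun φ => ?_⟩
    · simp only [enorm_mul, ENNReal.mul_rpow_of_nonneg _ _ hp.le, ENNReal.tsum_mul_left]
      exact ENNReal.mul_lt_top (ENNReal.rpow_lt_top_of_nonneg hp.le enorm_ne_top) h.cost_lt_top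
    · simpa [mul_assoc] using (h.hasSum φ).mul_left t

/-- `S : H^p → L^q` is a bounded extension of the commutator: it is a bounded linear operator, and
whenever `F ∈ H^p` is (given by) a function `f ∈ L^ℓ` with `r' < ℓ < n / (α + β)`, the integral that
defines `[b, T_{Ω,α}] f (x)` converges absolutely for almost every `x` and is equal to `S F (x)`. -/
structure IsCommutatorExtension {n : ℕ} {p : ℝ} (hp : 0 < p) (q r α β : ℝ)
    (Ω : Rn n → Rn n → ℂ) (b : Rn n → ℂ)
    (S : Hardy n p hp →ₗ[ℂ] Lp ℂ (ENNReal.ofReal q) (volume : Measure (Rn n))) : Prop where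
  bounded : ∃ M : ℝ≥0, ∀ F : Hardy n p hp,
    eLpNorm (S F) (ENNReal.ofReal q) volume ≤ M * hardyNorm p (F : 𝓢'(Rn n, ℂ))
  agrees : ∀ (F : Hardy n p hp) (ℓ : ℝ) (f : Rn n → ℂ),
    r / (r - 1) < ℓ → ℓ < n / (α + β) → MemLp f (ENNReal.ofReal ℓ) volume →
    (∀ φ : 𝓢(Rn n, ℂ), (F : 𝓢'(Rn n, ℂ)) φ = ∫ x, f x * φ x) →
    (∀ᵐ x, Integrable (commutatorIntegrand Ω α b f x) volume) ∧
      S F =ᵐ[volume] commutator Ω α b f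

end VariableKernel

end

open VariableKernel

namespace VariableKernel

open Filter Topology

/-! ### Polar coordinates -/

/-! Write L for the Lipschitz seminorm of b, T for the commutator, and s = n - α - β. The factor
b(x) - b(y) lowers the singularity, so T is dominated by L times the positive operator `absOp` with
kernel |Ω(x,x-y)| |x-y|^{-s}. Since α + β > 0 the integral needs no principal value, which is why no
cancellation of Ω enters.

Atoms. For an atom a on B(x₀,d) one proves ‖Ta‖_q ≤ C L. Near the ball this is a size estimate for
the positive operator (`exists_local_bound`). Far from it the mean of a vanishes, so the kernel may
be replaced by its difference from a constant in y (`exists_far_bound`). The increment of b costs L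
d^β. The Dini condition gives ω_r(δ) ≤ Cδ^β (`exists_modulus_le`), so the increment of Ω contributes
(d/|x-x₀|)^β against |b(x) - b(x₀)| ≤ L|x-x₀|^β, which is d^β again. The resulting decay
|x-x₀|^{α-n+n/r} has a q-th power integrable at infinity exactly when n/r < β + n - n/p, the first
lower bound on r. Since n/p < n + β, the zeroth moment suffices.

The modulus speaks of rotations on the sphere, the far estimate of mean oscillation on a ball.
`exists_osc_le` bridges the two: rotations R_v R_c, products of reflections in lines, are
parametrized by v in a ball around c, and moving v sweeps out the whole ball, with a Lipschitz map
replacing the change of variables.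

Summation. Here q may be below 1, and the triangle inequality is replaced by ‖∑ u_j‖_q^p ≤ ∑
‖u_j‖_q^p, valid for p ≤ 1 and p ≤ q. Hence ∑ c_j T a_j converges a.e. with the right bound in L^q
for each atomic decomposition.

Consistency is the delicate point: the sum must not depend on the decomposition and must equal Tf
when F is a function f in L^ℓ. Atoms of small radius are unbounded in L^ℓ, so T cannot be applied
directly to a series that converges only as distributions. Mollify at scale ε. Testing against
translates of the mollifier φ_ε gives φ_ε * f = ∑ c_j φ_ε * a_j at every point; for fixed ε the
terms φ_ε * a_j are bounded in a suitable L^ℓ, and T passes through the sum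
(`Exponents.ae_hasSum_commutator`). Moreover φ_ε * a_j is a multiple of an atom, uniformly in ε
(`exists_isAtomOn_mollify`), so ‖T(φ_ε * a_j)‖_q is bounded uniformly, and dominated convergence of
the series in j lets ε → 0 (`Exponents.ae_hasSum_of_isAtomicDecomposition`). The case f = 0 gives
independence of the decomposition, hence linearity. Uniqueness holds because finite sums of atoms
are dense in H^p and are functions to which the integral formula applies. -/

theorem nontrivial_Rn {n : ℕ} (hn : 1 ≤ n) : Nontrivial (Rn n) := by
  have : Nonempty (Fin n) := ⟨⟨0, hn⟩⟩
  infer_instance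

theorem lintegral_polar {n : ℕ} (hn : 1 ≤ n) {k : ℝ → ℝ≥0∞} (hk : Measurable k)
    {h : Rn n → ℝ≥0∞} (hh : Measurable h) (hom : ∀ (z : Rn n) (t : ℝ), 0 < t → h (t • z) = h z) :
    ∫⁻ z, k ‖z‖ * h z =
      (∫⁻ z : Sph n, h z ∂(volume : Measure (Rn n)).toSphere) *
        ∫⁻ t in Ioi (0 : ℝ), k t * ENNReal.ofReal (t ^ (n - 1)) := by
  have := nontrivial_Rn hn
  have mp := (volume : Measure (Rn n)).measurePreserving_homeomorphUnitSphereProd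
  have hsing : ({0}ᶜ : Set (Rn n)) =ᵐ[volume] univ := by simp
  calc ∫⁻ z, k ‖z‖ * h z
      = ∫⁻ z in ({0}ᶜ : Set (Rn n)), k ‖z‖ * h z := by
        rw [Measure.restrict_congr_set hsing, Measure.restrict_univ]
    _ = ∫⁻ z : ({0}ᶜ : Set (Rn n)), k ‖(z : Rn n)‖ * h z ∂((volume : Measure (Rn n)).comap (↑)) :=
        (lintegral_subtype_comap (measurableSet_singleton _).compl _).symm
    _ = ∫⁻ z : ({0}ᶜ : Set (Rn n)),
          (fun w : Sph n × Ioi (0 : ℝ) => h w.1 * k w.2)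
            (homeomorphUnitSphereProd (Rn n) z) ∂((volume : Measure (Rn n)).comap (↑)) := by
        refine lintegral_congr fun z => ?_
        have hz : 0 < ‖(z : Rn n)‖ := norm_pos_iff.2 z.2
        simp only [homeomorphUnitSphereProd_apply_fst_coe, homeomorphUnitSphereProd_apply_snd_coe]
        rw [hom _ _ (inv_pos.2 hz), mul_comm]
    _ = ∫⁻ w : Sph n × Ioi (0 : ℝ), h w.1 * k w.2 ∂
          ((volume : Measure (Rn n)).toSphere.prod (Measure.volumeIoiPow (n - 1))) := by
        have := mp.lintegral_comp_emb (Homeomorph.measurableEmbedding _)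
          (fun w : Sph n × Ioi (0 : ℝ) => h w.1 * k w.2)
        rw [this, finrank_euclideanSpace_fin]
    _ = _ := by
        rw [lintegral_prod_mul (f := fun z : Sph n => h z) (g := fun t : Ioi (0 : ℝ) => k t)
          (by fun_prop) (by fun_prop)]
        congr 1
        rw [Measure.volumeIoiPow, lintegral_withDensity_eq_lintegral_mul _ (by fun_prop)
          (by fun_prop)]
        rw [← lintegral_subtype_comap measurableSet_Ioi]
        refine lintegral_congr fun t => ?_
        simp [mul_comm]

theorem toSphere_univ_ne_zero {n : ℕ} (hn : 1 ≤ n) :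
    (volume : Measure (Rn n)).toSphere univ ≠ 0 := by
  have := nontrivial_Rn hn
  exact fun h => Measure.toSphere_ne_zero (volume : Measure (Rn n)) (Measure.measure_univ_eq_zero.1 h)

theorem isProbabilityMeasure_sphereMeasure {n : ℕ} (hn : 1 ≤ n) :
    IsProbabilityMeasure (sphereMeasure n) := by
  refine ⟨?_⟩
  rw [sphereMeasure, Measure.smul_apply, smul_eq_mul]
  exact ENNReal.inv_mul_cancel (toSphere_univ_ne_zero hn) (measure_ne_top _ _)

/-- The total mass of the unnormalized surface measure. -/
noncomputable def sphereMass (n : ℕ) : ℝ≥0∞ := (volume : Measure (Rn n)).toSphere univ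

theorem sphereMass_ne_top (n : ℕ) : sphereMass n ≠ ∞ := measure_ne_top _ _

theorem lintegral_toSphere {n : ℕ} (hn : 1 ≤ n) (h : Sph n → ℝ≥0∞) :
    ∫⁻ z, h z ∂(volume : Measure (Rn n)).toSphere
      = sphereMass n * ∫⁻ z, h z ∂sphereMeasure n := by
  rw [sphereMeasure, lintegral_smul_measure, smul_eq_mul, ← mul_assoc, sphereMass,
    ENNReal.mul_inv_cancel (toSphere_univ_ne_zero hn) (measure_ne_top _ _), one_mul]

theorem setLIntegral_norm_rpow_mul_ball {n : ℕ} (hn : 1 ≤ n) {s ρ : ℝ} (hs : s < n) (hρ : 0 < ρ)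
    {h : Rn n → ℝ≥0∞} (hh : Measurable h) (hom : ∀ (z : Rn n) (t : ℝ), 0 < t → h (t • z) = h z) :
    ∫⁻ z in ball (0 : Rn n) ρ, ‖z‖ₑ ^ (-s) * h z =
      ENNReal.ofReal (ρ ^ (n - s) / (n - s)) * sphereMass n *
        ∫⁻ z : Sph n, h z ∂sphereMeasure n := by
  have key := lintegral_polar hn (k := (Iio ρ).indicator fun t => ENNReal.ofReal t ^ (-s))
    (Measurable.indicator (by fun_prop) measurableSet_Iio) hh hom
  rw [lintegral_toSphere hn] at key
  rw [← lintegral_indicator measurableSet_ball]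
  refine Eq.trans ?_ (key.trans ?_)
  · refine lintegral_congr fun z => ?_
    by_cases hz : ‖z‖ < ρ
    · rw [indicator_of_mem (by simpa using hz), indicator_of_mem (by simpa using hz),
        ofReal_norm]
    · rw [indicator_of_notMem (by simpa using hz), indicator_of_notMem (by simpa using hz)]
      simp
  · rw [mul_assoc (ENNReal.ofReal _), mul_comm (ENNReal.ofReal _)]
    congr 1
    have h1 : ∀ t ∈ Ioi (0 : ℝ), (Iio ρ).indicator (fun t => ENNReal.ofReal t ^ (-s)) t *
        ENNReal.ofReal (t ^ (n - 1)) =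
        (Iio ρ).indicator (fun t => ENNReal.ofReal (t ^ ((n : ℝ) - s - 1))) t := by
      intro t ht
      have ht' : (0 : ℝ) < t := ht
      by_cases htr : t < ρ
      · rw [indicator_of_mem (by simpa using htr), indicator_of_mem (by simpa using htr),
          ENNReal.ofReal_rpow_of_pos ht', ← ENNReal.ofReal_mul (by positivity),
          ← Real.rpow_natCast, ← Real.rpow_add ht']
        congr 2
        rw [Nat.cast_sub hn]
        push_cast; ring
      · rw [indicator_of_notMem (by simpa using htr), indicator_of_notMem (by simpa using htr),
          zero_mul]
    rw [setLIntegral_congr_fun measurableSet_Ioi h1, lintegral_indicator measurableSet_Iio,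
      Measure.restrict_restrict measurableSet_Iio]
    have h2 : Iio ρ ∩ Ioi (0 : ℝ) = Ioo 0 ρ := by ext; simp [and_comm]
    rw [h2, Measure.restrict_congr_set Ioo_ae_eq_Ioc, ← ofReal_integral_eq_lintegral_ofReal,
      ← intervalIntegral.integral_of_le hρ.le, integral_rpow (Or.inl (by linarith))]
    · congr 1
      rw [sub_add_cancel, Real.zero_rpow (by linarith)]
      simp
    · exact (intervalIntegral.intervalIntegrable_rpow' (by linarith)).1
    · filter_upwards [ae_restrict_mem measurableSet_Ioc] with y hy
      exact Real.rpow_nonneg hy.1.le _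

theorem setLIntegral_norm_rpow_mul_compl_ball {n : ℕ} (hn : 1 ≤ n) {s ρ : ℝ} (hs : n < s)
    (hρ : 0 < ρ)
    {h : Rn n → ℝ≥0∞} (hh : Measurable h) (hom : ∀ (z : Rn n) (t : ℝ), 0 < t → h (t • z) = h z) :
    ∫⁻ z in (closedBall (0 : Rn n) ρ)ᶜ, ‖z‖ₑ ^ (-s) * h z =
      ENNReal.ofReal (ρ ^ (n - s) / (s - n)) * sphereMass n *
        ∫⁻ z : Sph n, h z ∂sphereMeasure n := by
  have key := lintegral_polar hn (k := (Ioi ρ).indicator fun t => ENNReal.ofReal t ^ (-s))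
    (Measurable.indicator (by fun_prop) measurableSet_Ioi) hh hom
  rw [lintegral_toSphere hn] at key
  rw [← lintegral_indicator measurableSet_closedBall.compl]
  refine Eq.trans ?_ (key.trans ?_)
  · refine lintegral_congr fun z => ?_
    by_cases hz : ρ < ‖z‖
    · rw [indicator_of_mem (by simpa using hz), indicator_of_mem (by simpa using hz),
        ofReal_norm]
    · rw [indicator_of_notMem (by simpa using hz), indicator_of_notMem (by simpa using hz)]
      simp
  · rw [mul_assoc (ENNReal.ofReal _), mul_comm (ENNReal.ofReal _)]
    congr 1
    have h1 : ∀ t ∈ Ioi (0 : ℝ), (Ioi ρ).indicator (fun t => ENNReal.ofReal t ^ (-s)) t *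
        ENNReal.ofReal (t ^ (n - 1)) =
        (Ioi ρ).indicator (fun t => ENNReal.ofReal (t ^ ((n : ℝ) - s - 1))) t := by
      intro t ht
      have ht' : (0 : ℝ) < t := ht
      by_cases htr : ρ < t
      · rw [indicator_of_mem (by simpa using htr), indicator_of_mem (by simpa using htr),
          ENNReal.ofReal_rpow_of_pos ht', ← ENNReal.ofReal_mul (by positivity),
          ← Real.rpow_natCast, ← Real.rpow_add ht']
        congr 2
        rw [Nat.cast_sub hn]
        push_cast; ring
      · rw [indicator_of_notMem (by simpa using htr), indicator_of_notMem (by simpa using htr),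
          zero_mul]
    rw [setLIntegral_congr_fun measurableSet_Ioi h1, lintegral_indicator measurableSet_Ioi,
      Measure.restrict_restrict measurableSet_Ioi]
    have h2 : Ioi ρ ∩ Ioi (0 : ℝ) = Ioi ρ := by
      ext t; simp only [mem_inter_iff, mem_Ioi]; exact ⟨fun h => h.1, fun h => ⟨h, hρ.trans h⟩⟩
    rw [h2, ← ofReal_integral_eq_lintegral_ofReal, integral_Ioi_rpow_of_lt (by linarith) hρ]
    · congr 1
      rw [sub_add_cancel, ← neg_sub (n : ℝ) s, div_neg, neg_div]
    · exact integrableOn_Ioi_rpow_of_lt (by linarith) hρ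
    · filter_upwards [ae_restrict_mem measurableSet_Ioi] with y hy
      exact Real.rpow_nonneg (hρ.le.trans (le_of_lt hy)) _

/-! ### Power weights and kernels on balls and their complements -/

theorem IsKernel.measurable_right {n : ℕ} {r : ℝ} {Ω : Rn n → Rn n → ℂ} (hΩ : IsKernel r Ω)
    (x : Rn n) : Measurable (Ω x) :=
  hΩ.measurable.comp (measurable_const.prodMk measurable_id)

/-- The sphere has total mass one, so its L^t norms increase with t and no constant appears. -/
theorem lintegral_sphere_le_kernelNorm_of_le {n : ℕ} (hn : 1 ≤ n) {r t : ℝ} (ht : 0 < t)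
    (htr : t ≤ r) {Ω : Rn n → Rn n → ℂ} (hΩ : IsKernel r Ω) (x : Rn n) :
    ∫⁻ z : Sph n, ‖Ω x z‖ₑ ^ t ∂sphereMeasure n ≤ kernelNorm r Ω ^ t := by
  have := isProbabilityMeasure_sphereMeasure hn
  have hr : 0 < r := ht.trans_le htr
  have hm : Measurable (fun z : Sph n => Ω x z) :=
    (hΩ.measurable_right x).comp measurable_subtype_coe
  have h1 := eLpNorm_le_eLpNorm_of_exponent_le (μ := sphereMeasure n)
    (ENNReal.ofReal_le_ofReal htr) hm.aestronglyMeasurable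
  rw [eLpNorm_eq_lintegral_rpow_enorm_toReal (by simpa using ht) (by simp),
    eLpNorm_eq_lintegral_rpow_enorm_toReal (by simpa using hr) (by simp),
    ENNReal.toReal_ofReal ht.le, ENNReal.toReal_ofReal hr.le] at h1
  have h2 := h1.trans (le_iSup
    (fun x : Rn n => (∫⁻ z : Sph n, ‖Ω x z‖ₑ ^ r ∂sphereMeasure n) ^ (1 / r)) x)
  have := ENNReal.rpow_le_rpow h2 ht.le
  rwa [← ENNReal.rpow_mul, one_div_mul_cancel ht.ne', ENNReal.rpow_one] at this

theorem exists_norm_rpow_mul_ball_le {n : ℕ} (hn : 1 ≤ n) {s : ℝ} (hs : s < n) :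
    ∃ C : ℝ≥0∞, C ≠ ∞ ∧ ∀ (ρ : ℝ), 0 < ρ → ∀ (h : Rn n → ℝ≥0∞), Measurable h →
      (∀ (z : Rn n) (t : ℝ), 0 < t → h (t • z) = h z) →
      ∫⁻ z in ball (0 : Rn n) ρ, ‖z‖ₑ ^ (-s) * h z
        ≤ C * ENNReal.ofReal ρ ^ (n - s) * ∫⁻ z : Sph n, h z ∂sphereMeasure n := by
  refine ⟨ENNReal.ofReal (1 / (n - s)) * sphereMass n,
    ENNReal.mul_ne_top ENNReal.ofReal_ne_top (sphereMass_ne_top n), fun ρ hρ h hh hom => ?_⟩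
  rw [setLIntegral_norm_rpow_mul_ball hn hs hρ hh hom, div_eq_mul_one_div,
    ENNReal.ofReal_mul (by positivity), ENNReal.ofReal_rpow_of_pos hρ]
  exact le_of_eq (by ring)

theorem exists_norm_rpow_mul_compl_ball_le {n : ℕ} (hn : 1 ≤ n) {s : ℝ} (hs : n < s) :
    ∃ C : ℝ≥0∞, C ≠ ∞ ∧ ∀ (ρ : ℝ), 0 < ρ → ∀ (h : Rn n → ℝ≥0∞), Measurable h →
      (∀ (z : Rn n) (t : ℝ), 0 < t → h (t • z) = h z) →
      ∫⁻ z in (closedBall (0 : Rn n) ρ)ᶜ, ‖z‖ₑ ^ (-s) * h z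
        ≤ C * ENNReal.ofReal ρ ^ (n - s) * ∫⁻ z : Sph n, h z ∂sphereMeasure n := by
  refine ⟨ENNReal.ofReal (1 / (s - n)) * sphereMass n,
    ENNReal.mul_ne_top ENNReal.ofReal_ne_top (sphereMass_ne_top n), fun ρ hρ h hh hom => ?_⟩
  rw [setLIntegral_norm_rpow_mul_compl_ball hn hs hρ hh hom, div_eq_mul_one_div,
    ENNReal.ofReal_mul (by positivity), ENNReal.ofReal_rpow_of_pos hρ]
  exact le_of_eq (by ring)

theorem exists_norm_rpow_ball_le {n : ℕ} (hn : 1 ≤ n) {s : ℝ} (hs : s < n) :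
    ∃ C : ℝ≥0∞, C ≠ ∞ ∧ ∀ (ρ : ℝ), 0 < ρ →
      ∫⁻ z in ball (0 : Rn n) ρ, ‖z‖ₑ ^ (-s) ≤ C * ENNReal.ofReal ρ ^ (n - s) := by
  obtain ⟨C, hC, h⟩ := exists_norm_rpow_mul_ball_le hn hs
  have := isProbabilityMeasure_sphereMeasure hn
  refine ⟨C, hC, fun ρ hρ => ?_⟩
  simpa using h ρ hρ (fun _ => 1) measurable_const (fun _ _ _ => rfl)

theorem exists_norm_rpow_compl_ball_le {n : ℕ} (hn : 1 ≤ n) {s : ℝ} (hs : n < s) :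
    ∃ C : ℝ≥0∞, C ≠ ∞ ∧ ∀ (ρ : ℝ), 0 < ρ →
      ∫⁻ z in (closedBall (0 : Rn n) ρ)ᶜ, ‖z‖ₑ ^ (-s) ≤ C * ENNReal.ofReal ρ ^ (n - s) := by
  obtain ⟨C, hC, h⟩ := exists_norm_rpow_mul_compl_ball_le hn hs
  have := isProbabilityMeasure_sphereMeasure hn
  refine ⟨C, hC, fun ρ hρ => ?_⟩
  simpa using h ρ hρ (fun _ => 1) measurable_const (fun _ _ _ => rfl)

theorem exists_norm_rpow_mul_kernel_ball_le {n : ℕ} (hn : 1 ≤ n) {s r t : ℝ} (hs : s < n)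
    (ht : 0 < t) (htr : t ≤ r) {Ω : Rn n → Rn n → ℂ} (hΩ : IsKernel r Ω) :
    ∃ C : ℝ≥0∞, C ≠ ∞ ∧ ∀ (ρ : ℝ), 0 < ρ → ∀ x : Rn n,
      ∫⁻ z in ball (0 : Rn n) ρ, ‖z‖ₑ ^ (-s) * ‖Ω x z‖ₑ ^ t ≤ C * ENNReal.ofReal ρ ^ (n - s) := by
  obtain ⟨C, hC, h⟩ := exists_norm_rpow_mul_ball_le hn hs
  refine ⟨C * kernelNorm r Ω ^ t, ENNReal.mul_ne_top hC
    (ENNReal.rpow_ne_top_of_nonneg ht.le hΩ.norm_lt_top.ne), fun ρ hρ x => ?_⟩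
  have hm := hΩ.measurable_right x
  refine (h ρ hρ (fun z => ‖Ω x z‖ₑ ^ t) (by fun_prop)
    (fun z t ht => by rw [hΩ.homogeneous x z t ht])).trans ?_
  rw [mul_right_comm]
  gcongr
  exact lintegral_sphere_le_kernelNorm_of_le hn ht htr hΩ x

theorem exists_norm_rpow_mul_kernel_compl_ball_le {n : ℕ} (hn : 1 ≤ n) {s r t : ℝ} (hs : n < s)
    (ht : 0 < t) (htr : t ≤ r) {Ω : Rn n → Rn n → ℂ} (hΩ : IsKernel r Ω) :
    ∃ C : ℝ≥0∞, C ≠ ∞ ∧ ∀ (ρ : ℝ), 0 < ρ → ∀ x : Rn n,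
      ∫⁻ z in (closedBall (0 : Rn n) ρ)ᶜ, ‖z‖ₑ ^ (-s) * ‖Ω x z‖ₑ ^ t
        ≤ C * ENNReal.ofReal ρ ^ (n - s) := by
  obtain ⟨C, hC, h⟩ := exists_norm_rpow_mul_compl_ball_le hn hs
  refine ⟨C * kernelNorm r Ω ^ t, ENNReal.mul_ne_top hC
    (ENNReal.rpow_ne_top_of_nonneg ht.le hΩ.norm_lt_top.ne), fun ρ hρ x => ?_⟩
  have hm := hΩ.measurable_right x
  refine (h ρ hρ (fun z => ‖Ω x z‖ₑ ^ t) (by fun_prop)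
    (fun z t ht => by rw [hΩ.homogeneous x z t ht])).trans ?_
  rw [mul_right_comm]
  gcongr
  exact lintegral_sphere_le_kernelNorm_of_le hn ht htr hΩ x

/-! ### The local estimate for the positive operator -/

theorem ae_ne_point {n : ℕ} (hn : 1 ≤ n) (x : Rn n) : ∀ᵐ y : Rn n, y ≠ x := by
  have := nontrivial_Rn hn
  exact compl_mem_ae_iff.2 (measure_singleton x)

theorem aemeasurable_kernel_prod {n : ℕ} {r : ℝ} {Ω : Rn n → Rn n → ℂ} (hΩ : IsKernel r Ω)
    (s : ℝ) {F : Rn n → ℝ≥0∞} {μ ν : Measure (Rn n)} [SFinite μ] [SFinite ν]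
    (hF : AEMeasurable F ν) :
    AEMeasurable (fun w : Rn n × Rn n => ‖Ω w.1 (w.1 - w.2)‖ₑ * ‖w.1 - w.2‖ₑ ^ (-s) * F w.2)
      (μ.prod ν) := by
  have h1 : Measurable fun w : Rn n × Rn n => Ω w.1 (w.1 - w.2) :=
    hΩ.measurable.comp (measurable_fst.prodMk (measurable_fst.sub measurable_snd))
  have h2 : Measurable fun w : Rn n × Rn n => ‖Ω w.1 (w.1 - w.2)‖ₑ * ‖w.1 - w.2‖ₑ ^ (-s) :=
    h1.enorm.mul (by fun_prop)
  exact h2.aemeasurable.mul hF.comp_snd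

theorem aemeasurable_kernel {n : ℕ} {r : ℝ} {Ω : Rn n → Rn n → ℂ} (hΩ : IsKernel r Ω)
    (s : ℝ) {F : Rn n → ℝ≥0∞} {ν : Measure (Rn n)}
    (hF : AEMeasurable F ν) (x : Rn n) :
    AEMeasurable (fun y => ‖Ω x (x - y)‖ₑ * ‖x - y‖ₑ ^ (-s) * F y) ν := by
  have h1 : Measurable fun y : Rn n => Ω x (x - y) :=
    (hΩ.measurable_right x).comp (measurable_const.sub measurable_id)
  have h2 : Measurable fun y : Rn n => ‖Ω x (x - y)‖ₑ * ‖x - y‖ₑ ^ (-s) :=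
    h1.enorm.mul (by fun_prop)
  exact h2.aemeasurable.mul hF

/-- Hölder's inequality for the kernel, with the singularity split between the two factors. -/
theorem lintegral_kernel_le_holder {n : ℕ} (hn : 1 ≤ n) {r t s u v : ℝ}
    (hrt : r.HolderConjugate t) (huv : u + v = s) {Ω : Rn n → Rn n → ℂ} (hΩ : IsKernel r Ω)
    {F : Rn n → ℝ≥0∞} {B : Set (Rn n)} (hF : AEMeasurable F (volume.restrict B)) (x : Rn n) :
    ∫⁻ y in B, ‖Ω x (x - y)‖ₑ * ‖x - y‖ₑ ^ (-s) * F y ≤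
      (∫⁻ y in B, ‖x - y‖ₑ ^ (-(u * r)) * ‖Ω x (x - y)‖ₑ ^ r) ^ (1 / r) *
      (∫⁻ y in B, ‖x - y‖ₑ ^ (-(v * t)) * F y ^ t) ^ (1 / t) := by
  have h1 : Measurable fun y : Rn n => Ω x (x - y) :=
    (hΩ.measurable_right x).comp (measurable_const.sub measurable_id)
  have e1 : ∫⁻ y in B, ‖Ω x (x - y)‖ₑ * ‖x - y‖ₑ ^ (-s) * F y =
      ∫⁻ y in B, ((fun y => ‖x - y‖ₑ ^ (-u) * ‖Ω x (x - y)‖ₑ) *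
        (fun y => ‖x - y‖ₑ ^ (-v) * F y)) y := by
    refine lintegral_congr_ae (ae_restrict_of_ae ?_)
    filter_upwards [ae_ne_point hn x] with y hy
    have : ‖x - y‖ₑ ^ (-s) = ‖x - y‖ₑ ^ (-u) * ‖x - y‖ₑ ^ (-v) := by
      rw [← ENNReal.rpow_add _ _ (by simpa [sub_eq_zero] using hy.symm) (by simp)]
      congr 1; linarith
    simp only [Pi.mul_apply, this]
    ring
  have m1 : AEMeasurable (fun y => ‖x - y‖ₑ ^ (-u) * ‖Ω x (x - y)‖ₑ) (volume.restrict B) :=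
    (Measurable.mul (by fun_prop) h1.enorm).aemeasurable
  have m2 : AEMeasurable (fun y => ‖x - y‖ₑ ^ (-v) * F y) (volume.restrict B) :=
    AEMeasurable.mul (by fun_prop) hF
  rw [e1]
  refine (ENNReal.lintegral_mul_le_Lp_mul_Lq _ hrt m1 m2).trans (le_of_eq ?_)
  have hr := hrt.pos
  have ht := hrt.symm.pos
  congr 3
  · ext y
    rw [ENNReal.mul_rpow_of_nonneg _ _ hr.le, ← ENNReal.rpow_mul, neg_mul]
  · ext y
    rw [ENNReal.mul_rpow_of_nonneg _ _ ht.le, ← ENNReal.rpow_mul, neg_mul]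

theorem lintegral_comp_sub_left_ball_le {n : ℕ} {c x : Rn n} {ρ : ℝ} (hx : x ∈ ball c ρ)
    (g : Rn n → ℝ≥0∞) :
    ∫⁻ y in ball c ρ, g (x - y) ≤ ∫⁻ z in ball (0 : Rn n) (2 * ρ), g z := by
  rw [← lintegral_indicator measurableSet_ball, ← lintegral_indicator measurableSet_ball,
    ← lintegral_sub_left_eq_self ((ball (0 : Rn n) (2 * ρ)).indicator g) x]
  refine lintegral_mono fun y => ?_
  by_cases hy : y ∈ ball c ρ
  · rw [indicator_of_mem hy, indicator_of_mem]
    rw [mem_ball_zero_iff, ← dist_eq_norm]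
    rw [mem_ball] at hx hy
    linarith [dist_triangle_right x y c]
  · rw [indicator_of_notMem hy]; exact zero_le

theorem lintegral_comp_sub_right_ball_le {n : ℕ} {c y : Rn n} {ρ : ℝ} (hy : y ∈ ball c ρ)
    (g : Rn n → ℝ≥0∞) :
    ∫⁻ x in ball c ρ, g (x - y) ≤ ∫⁻ z in ball (0 : Rn n) (2 * ρ), g z := by
  rw [← lintegral_indicator measurableSet_ball, ← lintegral_indicator measurableSet_ball,
    ← lintegral_sub_right_eq_self ((ball (0 : Rn n) (2 * ρ)).indicator g) y]
  refine lintegral_mono fun x => ?_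
  by_cases hx : x ∈ ball c ρ
  · rw [indicator_of_mem hx, indicator_of_mem]
    rw [mem_ball_zero_iff, ← dist_eq_norm]
    rw [mem_ball] at hx hy
    linarith [dist_triangle_right x y c]
  · rw [indicator_of_notMem hx]; exact zero_le

/-- Jensen's inequality for the power Q/t and the measure F dμ, obtained from Hölder so that F may
have any total mass. -/
theorem rpow_lintegral_mul_le {X : Type*} [MeasurableSpace X] {μ : Measure X} {k F : X → ℝ≥0∞}
    (hk : AEMeasurable k μ) (hF : AEMeasurable F μ) {t Q : ℝ} (ht : 0 < t) (htQ : t ≤ Q) :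
    (∫⁻ y, k y ^ t * F y ∂μ) ^ (Q / t) ≤
      (∫⁻ y, k y ^ Q * F y ∂μ) * (∫⁻ y, F y ∂μ) ^ (Q / t - 1) := by
  have hQ : 0 < Q := ht.trans_le htQ
  have h0 : 0 ≤ 1 - t / Q := by rw [sub_nonneg, div_le_one hQ]; exact htQ
  have h := ENNReal.lintegral_mul_norm_pow_le (μ := μ) (f := fun y => k y ^ Q * F y) (g := F)
    (by fun_prop) hF (p := t / Q) (q := 1 - t / Q) (by positivity) h0 (by ring)
  have e : ∀ y, (k y ^ Q * F y) ^ (t / Q) * F y ^ (1 - t / Q) = k y ^ t * F y := by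
    intro y
    rw [ENNReal.mul_rpow_of_nonneg _ _ (by positivity), ← ENNReal.rpow_mul, mul_assoc,
      ← ENNReal.rpow_add_of_nonneg _ _ (by positivity) h0]
    have : Q * (t / Q) = t := by field_simp
    simp [this]
  simp only [e] at h
  refine (ENNReal.rpow_le_rpow h (by positivity : 0 ≤ Q / t)).trans (le_of_eq ?_)
  rw [ENNReal.mul_rpow_of_nonneg _ _ (by positivity), ← ENNReal.rpow_mul, ← ENNReal.rpow_mul]
  congr 1
  · rw [show t / Q * (Q / t) = 1 by field_simp, ENNReal.rpow_one]
  · congr 1; field_simp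

theorem lintegral_rpow_le_of_le {X : Type*} [MeasurableSpace X] {μ : Measure X} {g : X → ℝ≥0∞}
    (hg : AEMeasurable g μ) {q Q : ℝ} (hq : 0 < q) (hqQ : q ≤ Q) :
    (∫⁻ x, g x ^ q ∂μ) ^ (1 / q) ≤ (∫⁻ x, g x ^ Q ∂μ) ^ (1 / Q) * μ univ ^ (1 / q - 1 / Q) := by
  have hQ : 0 < Q := hq.trans_le hqQ
  have h := ENNReal.lintegral_mul_norm_pow_le (μ := μ) (f := fun y => g y ^ Q) (g := fun _ => 1)
    (by fun_prop) aemeasurable_const (p := q / Q) (q := 1 - q / Q) (by positivity)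
    (by rw [sub_nonneg, div_le_one hQ]; exact hqQ) (by ring)
  have e : ∀ y, (g y ^ Q) ^ (q / Q) = g y ^ q := by
    intro y
    rw [← ENNReal.rpow_mul]; congr 1; field_simp
  simp only [e, ENNReal.one_rpow, mul_one, lintegral_const, one_mul] at h
  refine (ENNReal.rpow_le_rpow h (by positivity : 0 ≤ 1 / q)).trans (le_of_eq ?_)
  rw [ENNReal.mul_rpow_of_nonneg _ _ (by positivity), ← ENNReal.rpow_mul, ← ENNReal.rpow_mul]
  congr 1
  · congr 1; field_simp
  · congr 1; field_simp

/-- The kernel Ω(x,·) is controlled only for x fixed, so Hölder in y removes it first, with a bound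
uniform in x. It takes along a part |x-y|^{-u} of the singularity with ur < n. The remaining part
|x-y|^{-v} has vQ < n: Jensen against F^t dy raises the power from t to Q, and Fubini then
integrates in x. The final passage from Q down to q is Hölder on the ball. The power of ρ is forced
by scaling. -/
theorem exists_local_bound {n : ℕ} (hn : 1 ≤ n) {r t s q Q : ℝ} (hrt : r.HolderConjugate t)
    (hq : 0 < q) (hqQ : q ≤ Q) (htQ : t ≤ Q) (hs : s < n / r + n / Q)
    {Ω : Rn n → Rn n → ℂ} (hΩ : IsKernel r Ω) :
    ∃ C : ℝ≥0∞, C ≠ ∞ ∧ ∀ (c : Rn n) (ρ : ℝ), 0 < ρ → ∀ F : Rn n → ℝ≥0∞,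
      AEMeasurable F (volume.restrict (ball c ρ)) →
      (∫⁻ x in ball c ρ, (∫⁻ y in ball c ρ, ‖Ω x (x - y)‖ₑ * ‖x - y‖ₑ ^ (-s) * F y) ^ q) ^ (1 / q)
        ≤ C * ENNReal.ofReal ρ ^ (n / r - s + n / q) *
          (∫⁻ y in ball c ρ, F y ^ t) ^ (1 / t) := by
  have hr := hrt.pos
  have ht := hrt.symm.pos
  have hQ : 0 < Q := hq.trans_le hqQ
  -- The slack n/r + n/Q - s > 0 is shared equally between the two exponents.
  obtain ⟨u, v, huv, hu, hv⟩ : ∃ u v : ℝ, u + v = s ∧ u * r < n ∧ v * Q < n := by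
    refine ⟨n / r - (n / r + n / Q - s) / 2, n / Q - (n / r + n / Q - s) / 2, by ring, ?_, ?_⟩
    · rw [← lt_div_iff₀ hr]; linarith
    · rw [← lt_div_iff₀ hQ]; linarith
  obtain ⟨C₁, hC₁, H₁⟩ := exists_norm_rpow_mul_kernel_ball_le hn hu hr le_rfl hΩ
  obtain ⟨C₂, hC₂, H₂⟩ := exists_norm_rpow_ball_le hn hv
  set V : ℝ≥0∞ := volume (ball (0 : Rn n) 1) with hV
  have hVtop : V ≠ ∞ := measure_ball_lt_top.ne
  have h2 : (2 : ℝ≥0∞) ≠ 0 := two_ne_zero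
  refine ⟨(C₁ * 2 ^ (n - u * r)) ^ (1 / r) * (C₂ * 2 ^ (n - v * Q)) ^ (1 / Q) *
    V ^ (1 / q - 1 / Q), ?_, fun c ρ hρ F hF => ?_⟩
  · have hqQ' : 0 ≤ 1 / q - 1 / Q := sub_nonneg.2 (one_div_le_one_div_of_le hq hqQ)
    refine ENNReal.mul_ne_top (ENNReal.mul_ne_top ?_ ?_) ?_
    · refine ENNReal.rpow_ne_top_of_nonneg (by positivity) (ENNReal.mul_ne_top hC₁ ?_)
      exact ENNReal.rpow_ne_top_of_nonneg (by linarith) (by simp)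
    · refine ENNReal.rpow_ne_top_of_nonneg (by positivity) (ENNReal.mul_ne_top hC₂ ?_)
      exact ENNReal.rpow_ne_top_of_nonneg (by linarith) (by simp)
    · exact ENNReal.rpow_ne_top_of_nonneg hqQ' hVtop
  set P : ℝ≥0∞ := ENNReal.ofReal ρ with hP
  have hP0 : P ≠ 0 := by simpa [hP] using hρ
  have hPt : P ≠ ∞ := ENNReal.ofReal_ne_top
  have h2P : ENNReal.ofReal (2 * ρ) = 2 * P := by rw [ENNReal.ofReal_mul (by norm_num)]; simp [hP]
  set B := ball c ρ with hB
  set I : ℝ≥0∞ := ∫⁻ y in B, F y ^ t with hI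
  obtain ⟨X, hX⟩ : ∃ X : ℝ≥0∞, X = (C₁ * (2 * P) ^ (n - u * r)) ^ (1 / r) := ⟨_, rfl⟩
  obtain ⟨Y, hY⟩ : ∃ Y : ℝ≥0∞, Y = C₂ * (2 * P) ^ (n - v * Q) := ⟨_, rfl⟩
  set g : Rn n → ℝ≥0∞ := fun x => ∫⁻ y in B, ‖Ω x (x - y)‖ₑ * ‖x - y‖ₑ ^ (-s) * F y with hg
  have gm : AEMeasurable g (volume.restrict B) :=
    (aemeasurable_kernel_prod hΩ s hF).lintegral_prod_right'
  have pointwise : ∀ x ∈ B, g x ^ Q ≤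
      X ^ Q * ((∫⁻ y in B, ‖x - y‖ₑ ^ (-(v * Q)) * F y ^ t) * I ^ (Q / t - 1)) := by
    intro x hx
    have a1 : g x ≤ X * (∫⁻ y in B, ‖x - y‖ₑ ^ (-(v * t)) * F y ^ t) ^ (1 / t) := by
      refine (lintegral_kernel_le_holder hn hrt huv hΩ hF x).trans ?_
      rw [hX]
      gcongr
      refine (lintegral_comp_sub_left_ball_le hx
        (fun z => ‖z‖ₑ ^ (-(u * r)) * ‖Ω x z‖ₑ ^ r)).trans ?_
      rw [← h2P]
      exact H₁ (2 * ρ) (by positivity) x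
    refine (ENNReal.rpow_le_rpow a1 hQ.le).trans ?_
    rw [ENNReal.mul_rpow_of_nonneg _ _ hQ.le, ← ENNReal.rpow_mul, show 1 / t * Q = Q / t by ring]
    gcongr
    have := rpow_lintegral_mul_le (μ := volume.restrict B) (k := fun y => ‖x - y‖ₑ ^ (-v))
      (F := fun y => F y ^ t) (by fun_prop) (by fun_prop) ht htQ
    simpa only [← ENNReal.rpow_mul, neg_mul] using this
  have km : AEMeasurable (fun w : Rn n × Rn n => ‖w.1 - w.2‖ₑ ^ (-(v * Q)) * F w.2 ^ t)
      ((volume.restrict B).prod (volume.restrict B)) := by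
    have : AEMeasurable (fun w : Rn n × Rn n => F w.2)
      ((volume.restrict B).prod (volume.restrict B)) := hF.comp_snd
    fun_prop
  have fub : ∫⁻ x in B, ∫⁻ y in B, ‖x - y‖ₑ ^ (-(v * Q)) * F y ^ t ≤ Y * I := by
    rw [lintegral_lintegral_swap km]
    rw [hI, ← lintegral_const_mul'' Y (by fun_prop)]
    refine lintegral_mono_ae ?_
    filter_upwards [ae_restrict_mem measurableSet_ball] with y hy
    rw [lintegral_mul_const _ (by fun_prop)]
    gcongr
    refine (lintegral_comp_sub_right_ball_le hy (fun z => ‖z‖ₑ ^ (-(v * Q)))).trans ?_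
    rw [hY, ← h2P]
    exact H₂ (2 * ρ) (by positivity)
  have main : ∫⁻ x in B, g x ^ Q ≤ X ^ Q * (Y * I ^ (Q / t)) := by
    calc ∫⁻ x in B, g x ^ Q
        ≤ ∫⁻ x in B, X ^ Q * ((∫⁻ y in B, ‖x - y‖ₑ ^ (-(v * Q)) * F y ^ t) * I ^ (Q / t - 1)) :=
          setLIntegral_mono' measurableSet_ball pointwise
      _ = X ^ Q * ((∫⁻ x in B, ∫⁻ y in B, ‖x - y‖ₑ ^ (-(v * Q)) * F y ^ t) * I ^ (Q / t - 1)) := by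
          rw [lintegral_const_mul'' _ (km.lintegral_prod_right'.mul_const _),
            lintegral_mul_const'' _ km.lintegral_prod_right']
      _ ≤ X ^ Q * ((Y * I) * I ^ (Q / t - 1)) := by gcongr
      _ = X ^ Q * (Y * I ^ (Q / t)) := by
          rw [mul_assoc Y]
          congr 2
          nth_rewrite 1 [← ENNReal.rpow_one I]
          rw [← ENNReal.rpow_add_of_nonneg _ _ zero_le_one
            (by rw [sub_nonneg, one_le_div ht]; exact htQ)]
          congr 1; ring
  have volB : (volume.restrict B) univ = P ^ (n : ℝ) * V := by
    rw [Measure.restrict_apply_univ, hB, Measure.addHaar_ball_of_pos _ _ hρ,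
      finrank_euclideanSpace_fin, ENNReal.ofReal_pow hρ.le, ENNReal.rpow_natCast]
  calc (∫⁻ x in B, g x ^ q) ^ (1 / q)
      ≤ (∫⁻ x in B, g x ^ Q) ^ (1 / Q) * (volume.restrict B) univ ^ (1 / q - 1 / Q) :=
        lintegral_rpow_le_of_le gm hq hqQ
    _ ≤ (X ^ Q * (Y * I ^ (Q / t))) ^ (1 / Q) * (P ^ (n : ℝ) * V) ^ (1 / q - 1 / Q) := by
        rw [volB]; gcongr
    _ = X * Y ^ (1 / Q) * I ^ (1 / t) * (P ^ (n : ℝ) * V) ^ (1 / q - 1 / Q) := by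
        rw [ENNReal.mul_rpow_of_nonneg _ _ (by positivity),
          ENNReal.mul_rpow_of_nonneg _ _ (by positivity), ← ENNReal.rpow_mul, ← ENNReal.rpow_mul,
          mul_one_div_cancel hQ.ne', ENNReal.rpow_one, show Q / t * (1 / Q) = 1 / t by field_simp]
        ring
    _ = _ := by
        have e1 : X = (C₁ * 2 ^ (n - u * r)) ^ (1 / r) * P ^ (n / r - u) := by
          rw [hX, ENNReal.mul_rpow_of_ne_zero h2 hP0, ← mul_assoc,
            ENNReal.mul_rpow_of_nonneg _ _ (by positivity), ← ENNReal.rpow_mul]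
          congr 2; field_simp
        have e2 : Y ^ (1 / Q) = (C₂ * 2 ^ (n - v * Q)) ^ (1 / Q) * P ^ (n / Q - v) := by
          rw [hY, ENNReal.mul_rpow_of_ne_zero h2 hP0, ← mul_assoc,
            ENNReal.mul_rpow_of_nonneg _ _ (by positivity), ← ENNReal.rpow_mul]
          congr 2; field_simp
        have e3 : (P ^ (n : ℝ) * V) ^ (1 / q - 1 / Q)
            = P ^ (n / q - n / Q : ℝ) * V ^ (1 / q - 1 / Q) := by
          rw [ENNReal.mul_rpow_of_nonneg _ _ (sub_nonneg.2 (one_div_le_one_div_of_le hq hqQ)),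
            ← ENNReal.rpow_mul]
          congr 2; ring
        have e4 : P ^ (n / r - s + n / q : ℝ)
            = P ^ (n / r - u) * P ^ (n / Q - v) * P ^ (n / q - n / Q : ℝ) := by
          rw [← ENNReal.rpow_add _ _ hP0 hPt, ← ENNReal.rpow_add _ _ hP0 hPt]
          congr 1; rw [← huv]; ring
        rw [e1, e2, e3, e4]
        ring

/-- The positive operator `f ↦ ∫ |Ω(x, x - y)| |x - y|^{-s} |f(y)| dy`. -/
noncomputable def absOp {n : ℕ} (Ω : Rn n → Rn n → ℂ) (s : ℝ) (f : Rn n → ℂ) (x : Rn n) : ℝ≥0∞ :=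
  ∫⁻ y, ‖Ω x (x - y)‖ₑ * ‖x - y‖ₑ ^ (-s) * ‖f y‖ₑ

theorem rpow_add_le_two_rpow {q : ℝ} (hq : 0 ≤ q) (a b : ℝ≥0∞) :
    (a + b) ^ q ≤ 2 ^ q * (a ^ q + b ^ q) := by
  wlog h : a ≤ b generalizing a b
  · rw [add_comm a, add_comm (a ^ q)]; exact this b a (le_of_not_ge h)
  calc (a + b) ^ q ≤ (2 * b) ^ q := by
        refine ENNReal.rpow_le_rpow ?_ hq
        rw [two_mul]; gcongr
    _ = 2 ^ q * b ^ q := ENNReal.mul_rpow_of_nonneg _ _ hq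
    _ ≤ _ := by gcongr; exact le_add_self

theorem aemeasurable_absOp {n : ℕ} {r : ℝ} {Ω : Rn n → Rn n → ℂ} (hΩ : IsKernel r Ω) (s : ℝ)
    {f : Rn n → ℂ} (hf : AEStronglyMeasurable f volume) :
    AEMeasurable (absOp Ω s f) volume :=
  (aemeasurable_kernel_prod hΩ s hf.enorm).lintegral_prod_right'

/-- The mass of f in the double ball is handled by the local bound and Hölder from ℓ to t. The rest
is handled by Hölder with ℓ', where s ℓ' > n makes the kernel integrable at infinity and t ≤ ℓ, that
is ℓ' ≤ r, makes Ω(x,·) available in L^{ℓ'} of the sphere. -/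
theorem exists_absOp_local_bound {n : ℕ} (hn : 1 ≤ n) {r t s q Q ℓ ℓ' : ℝ}
    (hrt : r.HolderConjugate t)
    (hq : 0 < q) (hqQ : q ≤ Q) (htQ : t ≤ Q) (hs : s < n / r + n / Q)
    (hℓ : ℓ'.HolderConjugate ℓ) (htℓ : t ≤ ℓ) (hsℓ : n < s * ℓ')
    {Ω : Rn n → Rn n → ℂ} (hΩ : IsKernel r Ω) {R : ℝ} (hR : 0 < R) :
    ∃ C : ℝ≥0∞, C ≠ ∞ ∧ ∀ f : Rn n → ℂ, AEStronglyMeasurable f volume →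
      (∫⁻ x in ball 0 R, absOp Ω s f x ^ q) ^ (1 / q) ≤ C * (∫⁻ y, ‖f y‖ₑ ^ ℓ) ^ (1 / ℓ) := by
  have ht := hrt.symm.pos
  have hℓ0 := hℓ.symm.pos
  have hℓ'0 := hℓ.pos
  have hℓ'r : ℓ' ≤ r := by
    have h1 := hℓ.inv_add_inv_eq_one
    have h2 := hrt.inv_add_inv_eq_one
    have h3 : ℓ⁻¹ ≤ t⁻¹ := inv_anti₀ ht htℓ
    exact (inv_le_inv₀ hrt.pos hℓ'0).1 (by linarith)
  obtain ⟨C₁, hC₁, H₁⟩ := exists_local_bound hn hrt hq hqQ htQ hs hΩ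
  obtain ⟨C₂, hC₂, H₂⟩ := exists_norm_rpow_mul_kernel_compl_ball_le hn hsℓ hℓ'0 hℓ'r hΩ
  set P : ℝ≥0∞ := ENNReal.ofReal R with hP
  have hP0 : P ≠ 0 := by simpa [hP] using hR
  have hPt : P ≠ ∞ := ENNReal.ofReal_ne_top
  set D₁ : ℝ≥0∞ := C₁ * ENNReal.ofReal (2 * R) ^ (n / r - s + n / q) *
    volume (ball (0 : Rn n) (2 * R)) ^ (1 / t - 1 / ℓ) with hD₁
  set D₂ : ℝ≥0∞ := (C₂ * P ^ (n - s * ℓ')) ^ (1 / ℓ') * volume (ball (0 : Rn n) R) ^ (1 / q)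
    with hD₂
  have hD₁t : D₁ ≠ ∞ := by
    refine ENNReal.mul_ne_top (ENNReal.mul_ne_top hC₁ ?_) ?_
    · exact ENNReal.rpow_ne_top_of_ne_zero (by simpa using hR) ENNReal.ofReal_ne_top
    · exact ENNReal.rpow_ne_top_of_nonneg (sub_nonneg.2 (one_div_le_one_div_of_le ht htℓ))
        measure_ball_lt_top.ne
  have hD₂t : D₂ ≠ ∞ := by
    refine ENNReal.mul_ne_top (ENNReal.rpow_ne_top_of_nonneg (by positivity)
      (ENNReal.mul_ne_top hC₂ (ENNReal.rpow_ne_top_of_ne_zero hP0 hPt))) ?_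
    exact ENNReal.rpow_ne_top_of_nonneg (by positivity) measure_ball_lt_top.ne
  have h2top : ∀ e : ℝ, 0 ≤ e → (2 : ℝ≥0∞) ^ e ≠ ∞ := fun e he =>
    ENNReal.rpow_ne_top_of_nonneg he (by simp)
  refine ⟨2 * (2 ^ (1 / q) * (D₁ + D₂)), ENNReal.mul_ne_top (by simp)
    (ENNReal.mul_ne_top (h2top _ (by positivity)) (ENNReal.add_ne_top.2 ⟨hD₁t, hD₂t⟩)),
    fun f hf => ?_⟩
  set N : ℝ≥0∞ := (∫⁻ y, ‖f y‖ₑ ^ ℓ) ^ (1 / ℓ) with hN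
  -- Doubling the radius keeps |x - y| > R for x in the ball of radius R and y outside B.
  set B := ball (0 : Rn n) (2 * R) with hB
  have hsub : ball (0 : Rn n) R ⊆ B := ball_subset_ball (by linarith)
  set g₁ : Rn n → ℝ≥0∞ := fun x => ∫⁻ y in B, ‖Ω x (x - y)‖ₑ * ‖x - y‖ₑ ^ (-s) * ‖f y‖ₑ with hg₁
  set g₂ : Rn n → ℝ≥0∞ := fun x => ∫⁻ y in Bᶜ, ‖Ω x (x - y)‖ₑ * ‖x - y‖ₑ ^ (-s) * ‖f y‖ₑ with hg₂
  have split : ∀ x, absOp Ω s f x = g₁ x + g₂ x := fun x =>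
    (lintegral_add_compl _ measurableSet_ball).symm
  have b₁ : (∫⁻ x in ball 0 R, g₁ x ^ q) ^ (1 / q) ≤ D₁ * N := by
    calc (∫⁻ x in ball 0 R, g₁ x ^ q) ^ (1 / q) ≤ (∫⁻ x in B, g₁ x ^ q) ^ (1 / q) := by
          gcongr
      _ ≤ C₁ * ENNReal.ofReal (2 * R) ^ (n / r - s + n / q) *
          (∫⁻ y in B, ‖f y‖ₑ ^ t) ^ (1 / t) :=
          H₁ 0 (2 * R) (by positivity) _ hf.enorm.restrict
      _ ≤ C₁ * ENNReal.ofReal (2 * R) ^ (n / r - s + n / q) *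
          (N * volume B ^ (1 / t - 1 / ℓ)) := by
          gcongr
          refine (lintegral_rpow_le_of_le hf.enorm.restrict ht htℓ).trans ?_
          rw [Measure.restrict_apply_univ]
          gcongr
          exact ENNReal.rpow_le_rpow (setLIntegral_le_lintegral _ _) (by positivity)
      _ = D₁ * N := by rw [hD₁]; ring
  have p₂ : ∀ x ∈ ball (0 : Rn n) R, g₂ x ≤ (C₂ * P ^ (n - s * ℓ')) ^ (1 / ℓ') * N := by
    intro x hx
    have m1 : AEMeasurable (fun y => ‖Ω x (x - y)‖ₑ * ‖x - y‖ₑ ^ (-s)) (volume.restrict Bᶜ) := by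
      simpa using aemeasurable_kernel hΩ s (F := fun _ => 1)
        (ν := volume.restrict Bᶜ) aemeasurable_const x
    refine (ENNReal.lintegral_mul_le_Lp_mul_Lq _ hℓ m1 hf.enorm.restrict).trans ?_
    gcongr
    · refine le_trans ?_ (H₂ R hR x)
      rw [← lintegral_indicator measurableSet_ball.compl,
        ← lintegral_indicator measurableSet_closedBall.compl,
        ← lintegral_sub_left_eq_self ((closedBall (0 : Rn n) R)ᶜ.indicator _) x]
      refine lintegral_mono fun y => ?_
      by_cases hy : y ∈ Bᶜ
      · rw [indicator_of_mem hy, indicator_of_mem]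
        · rw [ENNReal.mul_rpow_of_nonneg _ _ hℓ'0.le, ← ENNReal.rpow_mul, neg_mul, mul_comm]
        · simp only [hB, mem_compl_iff, mem_ball, mem_closedBall, not_lt, not_le,
            dist_zero_right] at hy hx ⊢
          have := norm_sub_norm_le y x
          rw [norm_sub_rev] at this
          linarith
      · rw [indicator_of_notMem hy]; exact zero_le
    · exact ENNReal.rpow_le_rpow (setLIntegral_le_lintegral _ _) (by positivity)
  have b₂ : (∫⁻ x in ball 0 R, g₂ x ^ q) ^ (1 / q) ≤ D₂ * N := by
    calc (∫⁻ x in ball 0 R, g₂ x ^ q) ^ (1 / q)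
        ≤ (∫⁻ x in ball (0 : Rn n) R, ((C₂ * P ^ (n - s * ℓ')) ^ (1 / ℓ') * N) ^ q) ^ (1 / q) := by
          refine ENNReal.rpow_le_rpow (setLIntegral_mono' measurableSet_ball fun x hx => ?_)
            (by positivity)
          exact ENNReal.rpow_le_rpow (p₂ x hx) hq.le
      _ = D₂ * N := by
          rw [setLIntegral_const, ENNReal.mul_rpow_of_nonneg _ _ (by positivity),
            ← ENNReal.rpow_mul, mul_one_div_cancel hq.ne', ENNReal.rpow_one, hD₂]
          ring
  have gm : AEMeasurable g₁ (volume.restrict (ball 0 R)) :=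
    (aemeasurable_kernel_prod hΩ s (μ := volume.restrict (ball 0 R))
      hf.enorm.restrict).lintegral_prod_right'
  calc (∫⁻ x in ball 0 R, absOp Ω s f x ^ q) ^ (1 / q)
      ≤ (∫⁻ x in ball 0 R, 2 ^ q * (g₁ x ^ q + g₂ x ^ q)) ^ (1 / q) := by
        refine ENNReal.rpow_le_rpow (lintegral_mono fun x => ?_) (by positivity)
        rw [split]; exact rpow_add_le_two_rpow hq.le _ _
    _ = 2 * ((∫⁻ x in ball 0 R, g₁ x ^ q) + ∫⁻ x in ball 0 R, g₂ x ^ q) ^ (1 / q) := by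
        rw [lintegral_const_mul' _ _ (h2top q hq.le), lintegral_add_left' (gm.pow_const q),
          ENNReal.mul_rpow_of_nonneg _ _ (by positivity), ← ENNReal.rpow_mul,
          mul_one_div_cancel hq.ne', ENNReal.rpow_one]
    _ ≤ 2 * (2 ^ (1 / q) * ((∫⁻ x in ball 0 R, g₁ x ^ q) ^ (1 / q) +
          (∫⁻ x in ball 0 R, g₂ x ^ q) ^ (1 / q))) := by
        gcongr
        exact rpow_add_le_two_rpow (by positivity) _ _
    _ ≤ 2 * (2 ^ (1 / q) * (D₁ * N + D₂ * N)) := by gcongr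
    _ = _ := by ring

/-! ### Mean oscillation of degree-zero homogeneous functions -/

/-- Compare both ‖c‖ â and a with c: the first replacement costs only the difference of the norms. A
zero vector gets zero direction, so no hypothesis is needed. -/
theorem norm_mul_norm_normalize_sub_le {E : Type*} [NormedAddCommGroup E] [NormedSpace ℝ E]
    (a c : E) : ‖c‖ * ‖‖a‖⁻¹ • a - ‖c‖⁻¹ • c‖ ≤ 2 * ‖a - c‖ := by
  rcases eq_or_ne c 0 with rfl | hc
  · simp
  have hc' : ‖c‖ ≠ 0 := norm_ne_zero_iff.2 hc
  have h1 : ‖c‖ * ‖‖a‖⁻¹ • a - ‖c‖⁻¹ • c‖ = ‖(‖c‖ - ‖a‖) • (‖a‖⁻¹ • a) + (a - c)‖ := by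
    rw [← norm_norm c, ← norm_smul, norm_norm]
    congr 1
    rcases eq_or_ne a 0 with rfl | ha
    · simp [smul_smul, hc']
    · have ha' : ‖a‖ ≠ 0 := norm_ne_zero_iff.2 ha
      rw [smul_sub, sub_smul, smul_smul ‖c‖ ‖c‖⁻¹, smul_smul ‖a‖ ‖a‖⁻¹, mul_inv_cancel₀ hc',
        mul_inv_cancel₀ ha', one_smul, one_smul]
      abel
  have h2 : ‖‖a‖⁻¹ • a‖ ≤ 1 := by
    rw [norm_smul, norm_inv, norm_norm]
    exact inv_mul_le_one_of_le₀ le_rfl (norm_nonneg _)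
  have h3 : |‖c‖ - ‖a‖| ≤ ‖a - c‖ := by rw [norm_sub_rev]; exact abs_norm_sub_norm_le c a
  calc ‖c‖ * ‖‖a‖⁻¹ • a - ‖c‖⁻¹ • c‖ = _ := h1
    _ ≤ |‖c‖ - ‖a‖| * ‖‖a‖⁻¹ • a‖ + ‖a - c‖ := by
        refine (norm_add_le _ _).trans ?_
        rw [norm_smul, Real.norm_eq_abs]
    _ ≤ ‖a - c‖ * 1 + ‖a - c‖ := by gcongr
    _ = 2 * ‖a - c‖ := by ring

/-- The reflection about the line spanned by `v`. -/
noncomputable def lineReflection {n : ℕ} (v : Rn n) : Rn n ≃ₗᵢ[ℝ] Rn n := (ℝ ∙ v).reflection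

theorem lineReflection_apply {n : ℕ} (v u : Rn n) :
    lineReflection v u =
      (2 * inner ℝ (‖v‖⁻¹ • v) u) • (‖v‖⁻¹ • v) - u := by
  rw [lineReflection, Submodule.reflection_singleton_apply, inner_smul_left]
  simp only [smul_smul, RCLike.ofReal_real_eq_id, id, conj_trivial]
  rw [← Nat.cast_smul_eq_nsmul ℝ, smul_smul]
  congr 2
  rw [div_eq_mul_inv, sq, mul_inv]
  push_cast
  ring

theorem lineReflection_sub_le {n : ℕ} {v c : Rn n} (u : Rn n) :
    ‖lineReflection v u - lineReflection c u‖ ≤ 4 * ‖‖v‖⁻¹ • v - ‖c‖⁻¹ • c‖ * ‖u‖ := by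
  have h2 : ∀ a : Rn n, ‖‖a‖⁻¹ • a‖ ≤ 1 := fun a => by
    rw [norm_smul, norm_inv, norm_norm]
    exact inv_mul_le_one_of_le₀ le_rfl (norm_nonneg _)
  rw [lineReflection_apply, lineReflection_apply]
  set v' := ‖v‖⁻¹ • v
  set c' := ‖c‖⁻¹ • c
  have e : (2 * inner ℝ v' u) • v' - u - ((2 * inner ℝ c' u) • c' - u) =
      (2 * inner ℝ (v' - c') u) • v' + (2 * inner ℝ c' u) • (v' - c') := by
    rw [inner_sub_left, mul_sub, sub_smul, smul_sub]; abel
  rw [e]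
  have hv := h2 v
  have hc := h2 c
  calc _ ≤ ‖(2 * inner ℝ (v' - c') u) • v'‖ + ‖(2 * inner ℝ c' u) • (v' - c')‖ := norm_add_le _ _
    _ = 2 * |inner ℝ (v' - c') u| * ‖v'‖ + 2 * |inner ℝ c' u| * ‖v' - c'‖ := by
        simp [norm_smul]
    _ ≤ 2 * (‖v' - c'‖ * ‖u‖) * 1 + 2 * (1 * ‖u‖) * ‖v' - c'‖ := by
        gcongr
        · exact abs_real_inner_le_norm _ _
        · exact (abs_real_inner_le_norm _ _).trans (by gcongr)
    _ = _ := by ring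

/-- Reflection in a line has determinant (-1)^(n-1), so the product of two is a proper rotation and
is seen by the modulus of continuity. -/
theorem isRotation_lineReflection_trans {n : ℕ} {v c : Rn n} (hv : v ≠ 0) (hc : c ≠ 0) :
    IsRotation ((lineReflection c).trans (lineReflection v)) := by
  have hdet : ∀ u : Rn n, u ≠ 0 →
      LinearMap.det ((lineReflection u).toLinearEquiv : Rn n →ₗ[ℝ] Rn n) = (-1) ^ (n - 1) := by
    intro u hu
    have h := Submodule.det_reflection (ℝ ∙ u)
    have h2 : Module.finrank ℝ (ℝ ∙ u)ᗮ = n - 1 := by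
      have := Submodule.finrank_add_finrank_orthogonal (ℝ ∙ u)
      rw [finrank_span_singleton hu, finrank_euclideanSpace_fin] at this
      omega
    rw [h2] at h
    exact h
  have hcomp : (((lineReflection c).trans (lineReflection v)).toLinearEquiv : Rn n →ₗ[ℝ] Rn n)
      = ((lineReflection v).toLinearEquiv : Rn n →ₗ[ℝ] Rn n) ∘ₗ
        ((lineReflection c).toLinearEquiv : Rn n →ₗ[ℝ] Rn n) := rfl
  rw [IsRotation, hcomp, LinearMap.det_comp, hdet v hv, hdet c hc, ← mul_pow]
  simp

/-- Since R_c is an involution, z = R_c R_c z, and the displacement of z is (R_v - R_c) applied to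
the unit vector R_c z. -/
theorem rotationSize_lineReflection_trans_le {n : ℕ} (v c : Rn n) :
    rotationSize ((lineReflection c).trans (lineReflection v)) ≤
      ENNReal.ofReal (4 * ‖‖v‖⁻¹ • v - ‖c‖⁻¹ • c‖) := by
  refine iSup_le fun z => ?_
  have hz : (z : Rn n) = lineReflection c (lineReflection c z) :=
    (Submodule.reflection_reflection _ _).symm
  have h1 : ‖lineReflection c (z : Rn n)‖ = 1 := by
    rw [LinearIsometryEquiv.norm_map]; simp
  rw [LinearIsometryEquiv.trans_apply]
  nth_rewrite 2 [hz]
  rw [← ofReal_norm]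
  refine ENNReal.ofReal_le_ofReal ((lineReflection_sub_le _).trans ?_)
  rw [h1, mul_one]

/-- Lebesgue measure is a multiple of the n-dimensional Hausdorff measure, which scales by K^n under
a K-Lipschitz map. -/
theorem volume_image_le_of_lipschitzWith {n : ℕ} {K : ℝ≥0} {Φ : Rn n → Rn n}
    (hΦ : LipschitzWith K Φ) (A : Set (Rn n)) :
    volume (Φ '' A) ≤ (K : ℝ≥0∞) ^ n * volume A := by
  have h := Measure.isAddLeftInvariant_eq_smul (volume : Measure (Rn n))
    (μH[Module.finrank ℝ (Rn n)])
  have h2 := hΦ.hausdorffMeasure_image_le (d := Module.finrank ℝ (Rn n)) (by positivity) A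
  have e : (K : ℝ≥0∞) ^ n = (K : ℝ≥0∞) ^ Module.finrank ℝ (Rn n) := by
    rw [finrank_euclideanSpace_fin]
  rw [ENNReal.rpow_natCast] at h2
  rw [e, h, Measure.smul_apply, Measure.smul_apply, mul_smul_comm]
  gcongr

/-- A one-sided change of variables: it suffices that the map is Lipschitz and covers E, so neither
injectivity nor a Jacobian is required. -/
theorem setLIntegral_le_of_subset_image {n : ℕ} {K : ℝ≥0} {Φ : Rn n → Rn n}
    (hΦ : LipschitzWith K Φ) {E V : Set (Rn n)}
    (hEV : E ⊆ Φ '' V) {g : Rn n → ℝ≥0∞} (hg : Measurable g) :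
    ∫⁻ z in E, g z ≤ (K : ℝ≥0∞) ^ n * ∫⁻ v in V, g (Φ v) := by
  have hΦm : Measurable Φ := hΦ.continuous.measurable
  have key : volume.restrict E ≤ (K : ℝ≥0∞) ^ n • (volume.restrict V).map Φ := by
    refine Measure.le_iff.2 fun A hA => ?_
    rw [Measure.restrict_apply hA, Measure.smul_apply, Measure.map_apply hΦm hA,
      Measure.restrict_apply (hΦm hA), smul_eq_mul]
    refine le_trans (measure_mono ?_) (volume_image_le_of_lipschitzWith hΦ _)
    rintro z ⟨hzA, hzE⟩
    obtain ⟨v, hv, rfl⟩ := hEV hzE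
    exact ⟨v, ⟨hzA, hv⟩, rfl⟩
  refine (lintegral_mono' key le_rfl).trans (le_of_eq ?_)
  rw [lintegral_smul_measure, smul_eq_mul, lintegral_map hg hΦm]

/-- The reflection of the direction of `w` about the line spanned by `v`, scaled to the norm
of `v`. -/
noncomputable def reflectDir {n : ℕ} (w v : Rn n) : Rn n :=
  (2 * inner ℝ (‖w‖⁻¹ • w) v) • (‖v‖⁻¹ • v) - ‖v‖ • (‖w‖⁻¹ • w)

/-- The defining formula is suited to the Lipschitz estimate; this form shows that a function
homogeneous of degree zero sees only the reflection of w. -/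
theorem reflectDir_eq {n : ℕ} (w v : Rn n) :
    reflectDir w v = (‖v‖ * ‖w‖⁻¹) • lineReflection v w := by
  rcases eq_or_ne v 0 with rfl | hv
  · simp [reflectDir]
  have hv' : ‖v‖ ≠ 0 := norm_ne_zero_iff.2 hv
  rw [lineReflection_apply, reflectDir, smul_sub, smul_smul ‖v‖ ‖w‖⁻¹ w]
  congr 1
  rw [smul_smul (‖v‖ * ‖w‖⁻¹)]
  congr 1
  rw [inner_smul_left, inner_smul_left, real_inner_comm]
  simp only [conj_trivial]
  field_simp

/-- The map is built from a linear functional of v, the direction of v and the norm of v. Varying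
them one at a time costs 2, 4 and 1 respectively; the 4 uses that the change of direction is
weighted by ‖v'‖. -/
theorem lipschitzWith_reflectDir {n : ℕ} (w : Rn n) : LipschitzWith 7 (reflectDir w) := by
  refine LipschitzWith.of_dist_le_mul fun v v' => ?_
  rw [dist_eq_norm, dist_eq_norm]
  have h2 : ∀ a : Rn n, ‖‖a‖⁻¹ • a‖ ≤ 1 := fun a => by
    rw [norm_smul, norm_inv, norm_norm]
    exact inv_mul_le_one_of_le₀ le_rfl (norm_nonneg _)
  have hw := h2 w
  have hv := h2 v
  have hn := norm_mul_norm_normalize_sub_le v v'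
  simp only [reflectDir]
  set w' := ‖w‖⁻¹ • w
  set a := ‖v‖⁻¹ • v
  set a' := ‖v'‖⁻¹ • v'
  have e : (2 * inner ℝ w' v) • a - ‖v‖ • w' - ((2 * inner ℝ w' v') • a' - ‖v'‖ • w') =
      (2 * inner ℝ w' (v - v')) • a + (2 * inner ℝ w' v') • (a - a') + (‖v'‖ - ‖v‖) • w' := by
    rw [inner_sub_right, mul_sub, sub_smul, smul_sub, sub_smul]; abel
  rw [e]
  calc _ ≤ ‖(2 * inner ℝ w' (v - v')) • a‖ + ‖(2 * inner ℝ w' v') • (a - a')‖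
          + ‖(‖v'‖ - ‖v‖) • w'‖ := norm_add₃_le
    _ = 2 * |inner ℝ w' (v - v')| * ‖a‖ + 2 * |inner ℝ w' v'| * ‖a - a'‖
          + |‖v'‖ - ‖v‖| * ‖w'‖ := by simp [norm_smul]
    _ ≤ 2 * (1 * ‖v - v'‖) * 1 + 2 * (1 * ‖v'‖) * ‖a - a'‖ + ‖v - v'‖ * 1 := by
        gcongr
        · exact (abs_real_inner_le_norm _ _).trans (by gcongr)
        · exact (abs_real_inner_le_norm _ _).trans (by gcongr)
        · rw [norm_sub_rev]; exact abs_norm_sub_norm_le v' v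
    _ ≤ ((7 : ℝ≥0) : ℝ) * ‖v - v'‖ := by push_cast; linarith

/-- Reflection in the bisector of two unit vectors exchanges them, so v is the bisector of the
directions of w and z, scaled to the length of z. -/
theorem exists_reflectDir_eq {n : ℕ} {c w z : Rn n} {d : ℝ} (hd : 0 < d) (hc : 100 * d ≤ ‖c‖)
    (hw : w ∈ closedBall c d) (hz : z ∈ closedBall c d) :
    ∃ v ∈ closedBall c (5 * d), reflectDir w v = z := by
  rw [mem_closedBall, dist_eq_norm] at hw hz
  have hcpos : 0 < ‖c‖ := by linarith
  have hw0 : w ≠ 0 := by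
    rintro rfl; rw [zero_sub, norm_neg] at hw; linarith
  have hz0 : z ≠ 0 := by
    rintro rfl; rw [zero_sub, norm_neg] at hz; linarith
  have hun : ∀ a : Rn n, a ≠ 0 → ‖‖a‖⁻¹ • a‖ = 1 := fun a ha => by
    rw [norm_smul, norm_inv, norm_norm, inv_mul_cancel₀ (norm_ne_zero_iff.2 ha)]
  have hcne : c ≠ 0 := norm_pos_iff.1 hcpos
  have kw := norm_mul_norm_normalize_sub_le w c
  have kz := norm_mul_norm_normalize_sub_le z c
  have hw1 := hun w hw0
  have hz1 := hun z hz0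
  have hc1 := hun c hcne
  set w' := ‖w‖⁻¹ • w with hw'
  set z' := ‖z‖⁻¹ • z with hz'
  set c' := ‖c‖⁻¹ • c with hc'
  set m := w' + z' with hm
  have hcc : c = ‖c‖ • c' := by
    rw [hc', smul_smul, mul_inv_cancel₀ hcpos.ne', one_smul]
  have hmc : ‖c‖ * ‖m - (2 : ℝ) • c'‖ ≤ 4 * d := by
    have : m - (2 : ℝ) • c' = (w' - c') + (z' - c') := by rw [hm, two_smul]; abel
    rw [this]
    calc ‖c‖ * ‖(w' - c') + (z' - c')‖ ≤ ‖c‖ * (‖w' - c'‖ + ‖z' - c'‖) := by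
          gcongr; exact norm_add_le _ _
      _ ≤ 4 * d := by rw [mul_add]; linarith
  have h2c : ‖(2 : ℝ) • c'‖ = 2 := by rw [norm_smul, hc1]; simp
  have hm0 : m ≠ 0 := by
    intro h
    rw [h, zero_sub, norm_neg, h2c] at hmc
    linarith
  have hmn : ‖m‖ ≠ 0 := norm_ne_zero_iff.2 hm0
  have hz0' : ‖z‖ ≠ 0 := norm_ne_zero_iff.2 hz0
  set m' := ‖m‖⁻¹ • m with hm'
  have hm1 : ‖m'‖ = 1 := hun m hm0
  have hmc' : ‖c‖ * ‖m' - c'‖ ≤ 4 * d := by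
    have := norm_mul_norm_normalize_sub_le m ((2 : ℝ) • c')
    rw [h2c, smul_smul, inv_mul_cancel₀ two_ne_zero, one_smul, ← hm'] at this
    nlinarith
  refine ⟨‖z‖ • m', ?_, ?_⟩
  -- The radius 5d is d from the difference of lengths plus 4d from the difference of directions.
  · rw [mem_closedBall, dist_eq_norm]
    have : ‖z‖ • m' - c = (‖z‖ - ‖c‖) • m' + ‖c‖ • (m' - c') := by
      nth_rewrite 1 [hcc]; rw [sub_smul, smul_sub]; abel
    rw [this]
    refine (norm_add_le _ _).trans ?_
    rw [norm_smul (‖z‖ - ‖c‖) m', norm_smul ‖c‖ (m' - c'), hm1, norm_norm, mul_one,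
      Real.norm_eq_abs]
    linarith [abs_norm_sub_norm_le z c]
  · have hnorm : ‖‖z‖ • m'‖ = ‖z‖ := by rw [norm_smul, hm1, norm_norm, mul_one]
    have hspan : (ℝ ∙ (‖z‖ • m')) = ℝ ∙ m := by
      rw [hm', smul_smul]
      exact Submodule.span_singleton_smul_eq (IsUnit.mk0 _ (mul_ne_zero hz0' (inv_ne_zero hmn))) m
    have r1 : lineReflection (‖z‖ • m') (w' + z') = w' + z' := by
      refine Submodule.reflection_mem_subspace_eq_self ?_
      rw [hspan]
      exact Submodule.mem_span_singleton_self m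
    have r2 : lineReflection (‖z‖ • m') (w' - z') = -(w' - z') := by
      refine Submodule.reflection_mem_subspace_orthogonalComplement_eq_neg ?_
      rw [hspan, Submodule.mem_orthogonal_singleton_iff_inner_right, hm]
      exact (real_inner_add_sub_eq_zero_iff w' z').2 (by rw [hw1, hz1])
    have r3 : lineReflection (‖z‖ • m') w' = z' := by
      have e1 : w' = (2⁻¹ : ℝ) • ((w' + z') + (w' - z')) := by module
      rw [e1, map_smul, map_add, r1, r2]
      module
    rw [reflectDir_eq, hnorm, mul_smul, ← map_smul, ← hw', r3, hz', smul_smul,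
      mul_inv_cancel₀ hz0', one_smul]

theorem measurable_reflectDir_prod {n : ℕ} (ρ : Rn n ≃ₗᵢ[ℝ] Rn n) :
    Measurable fun w : Rn n × Rn n => reflectDir (ρ w.1) w.2 := by
  have h : Measurable fun w : Rn n × Rn n => ρ w.1 := ρ.continuous.measurable.comp measurable_fst
  unfold reflectDir
  fun_prop

/-- The double integral of |G(z) - G(z')|^r over E × E is estimated, and z₀ is then chosen by
averaging. For fixed z, every z' in E is the image of some v in V under `reflectDir` applied to R_c
z, so the z' integral is at most 7^n times an integral over V. After Fubini v is fixed, and by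
homogeneity the value of G at that image is G(R_v R_c z), where R_v R_c is a single small rotation
to which the hypothesis on M applies. The volume of E introduced by the double integral cancels in
the average. -/
theorem exists_osc_le {n : ℕ} (hn : 1 ≤ n) (r : ℝ) :
    ∃ C : ℝ≥0∞, C ≠ ∞ ∧ ∀ G : Rn n → ℂ, Measurable G →
      (∀ (z : Rn n) (t : ℝ), 0 < t → G (t • z) = G z) →
      ∀ (c : Rn n) (d : ℝ), 0 < d → 100 * d ≤ ‖c‖ → ∀ M : ℝ≥0∞,
      (∀ ρ : Rn n ≃ₗᵢ[ℝ] Rn n, IsRotation ρ → rotationSize ρ < ENNReal.ofReal (50 * d / ‖c‖) →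
        ∫⁻ z : Sph n, ‖G (ρ z) - G z‖ₑ ^ r ∂sphereMeasure n ≤ M) →
      ∃ z₀ ∈ closedBall c d,
        ∫⁻ z in closedBall c d, ‖G z - G z₀‖ₑ ^ r ≤ C * ENNReal.ofReal ‖c‖ ^ (n : ℝ) * M := by
  obtain ⟨C₁, hC₁, H₁⟩ := exists_norm_rpow_mul_ball_le hn (s := 0) (by exact_mod_cast hn)
  refine ⟨7 ^ n * (5 ^ n * (C₁ * 2 ^ (n : ℝ))), ?_, ?_⟩
  · refine ENNReal.mul_ne_top (by simp) (ENNReal.mul_ne_top (by simp) (ENNReal.mul_ne_top hC₁ ?_))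
    exact ENNReal.rpow_ne_top_of_nonneg (by positivity) (by simp)
  intro G hG hom c d hd hc M hM
  have hcpos : 0 < ‖c‖ := by linarith
  have hcne : c ≠ 0 := norm_pos_iff.1 hcpos
  set E := closedBall c d with hE
  set V := closedBall c (5 * d) with hV
  set P := ENNReal.ofReal ‖c‖ with hP
  have hP0 : P ≠ 0 := by simpa [hP] using hcne
  have hvolV : volume V = 5 ^ n * volume E := by
    rw [hV, hE, Measure.addHaar_closedBall _ _ (by positivity),
      Measure.addHaar_closedBall _ _ hd.le, finrank_euclideanSpace_fin, mul_pow,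
      ENNReal.ofReal_mul (by positivity), mul_assoc, ENNReal.ofReal_pow (by norm_num)]
    simp
  have hvE0 : volume E ≠ 0 := (measure_closedBall_pos _ _ hd).ne'
  have hvEt : volume E ≠ ∞ := measure_closedBall_lt_top.ne
  -- R_c is an isometry fixing the centre c.
  have memE : ∀ z ∈ E, lineReflection c z ∈ E := by
    intro z hz
    have h1 : lineReflection c c = c :=
      Submodule.reflection_mem_subspace_eq_self (Submodule.mem_span_singleton_self c)
    rw [hE, mem_closedBall] at hz ⊢
    nth_rewrite 2 [← h1]
    rwa [LinearIsometryEquiv.dist_map]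
  have ne0 : ∀ a ∈ V, a ≠ 0 := by
    rintro a ha rfl
    rw [hV, mem_closedBall, dist_comm, dist_zero_right] at ha
    linarith
  have subEV : E ⊆ V := closedBall_subset_closedBall (by linarith)
  have mJ : Measurable fun w : Rn n × Rn n => ‖G w.1 - G w.2‖ₑ ^ r := by fun_prop
  have mΦ : Measurable fun w : Rn n × Rn n =>
      ‖G w.1 - G (reflectDir (lineReflection c w.1) w.2)‖ₑ ^ r := by
    have := hG.comp (measurable_reflectDir_prod (lineReflection c))
    exact (((hG.comp measurable_fst).sub this).enorm).pow_const r
  have rot : ∀ v ∈ V, ∫⁻ z in E, ‖G z - G (reflectDir (lineReflection c z) v)‖ₑ ^ r ≤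
      C₁ * 2 ^ (n : ℝ) * P ^ (n : ℝ) * M := by
    intro v hv
    set ρ := (lineReflection c).trans (lineReflection v) with hρ
    -- Directions of v and c differ by at most 2 · 5d/‖c‖, hence the rotation has size at most
    -- 40d/‖c‖; 50 makes the inequality strict.
    have hsize : rotationSize ρ < ENNReal.ofReal (50 * d / ‖c‖) := by
      refine (rotationSize_lineReflection_trans_le v c).trans_lt ?_
      rw [ENNReal.ofReal_lt_ofReal_iff (by positivity), lt_div_iff₀ hcpos]
      have h1 := norm_mul_norm_normalize_sub_le v c
      rw [hV, mem_closedBall, dist_eq_norm] at hv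
      nlinarith
    have hMρ := hM ρ (isRotation_lineReflection_trans (ne0 v hv) hcne) hsize
    have mρ : Measurable fun z => ‖G (ρ z) - G z‖ₑ ^ r :=
      (((hG.comp ρ.continuous.measurable).sub hG).enorm).pow_const r
    have homρ : ∀ (z : Rn n) (t : ℝ), 0 < t → ‖G (ρ (t • z)) - G (t • z)‖ₑ ^ r =
        ‖G (ρ z) - G z‖ₑ ^ r := by
      intro z t ht
      rw [map_smul, hom _ _ ht, hom _ _ ht]
    have h3 := H₁ (2 * ‖c‖) (by positivity) (fun z => ‖G (ρ z) - G z‖ₑ ^ r) mρ homρ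
    simp only [neg_zero, ENNReal.rpow_zero, one_mul, sub_zero] at h3
    calc ∫⁻ z in E, ‖G z - G (reflectDir (lineReflection c z) v)‖ₑ ^ r
        = ∫⁻ z in E, ‖G (ρ z) - G z‖ₑ ^ r := by
          refine setLIntegral_congr_fun measurableSet_closedBall fun z hz => ?_
          have hw : lineReflection c z ≠ 0 := ne0 _ (subEV (memE z hz))
          have hv0 := ne0 v hv
          rw [reflectDir_eq, hom _ _ (by positivity), enorm_sub_rev]
          rfl
      _ ≤ ∫⁻ z in ball 0 (2 * ‖c‖), ‖G (ρ z) - G z‖ₑ ^ r := by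
          refine lintegral_mono_set fun z hz => ?_
          rw [hE, mem_closedBall, dist_eq_norm] at hz
          rw [mem_ball_zero_iff]
          linarith [norm_le_norm_add_norm_sub' z c]
      _ ≤ C₁ * ENNReal.ofReal (2 * ‖c‖) ^ (n : ℝ) * M := h3.trans (by gcongr)
      _ = C₁ * 2 ^ (n : ℝ) * P ^ (n : ℝ) * M := by
          rw [ENNReal.ofReal_mul (by norm_num), ENNReal.mul_rpow_of_nonneg _ _ (by positivity)]
          simp [mul_assoc, hP]
  have dbl : ∫⁻ z' in E, ∫⁻ z in E, ‖G z - G z'‖ₑ ^ r ≤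
      7 ^ n * (5 ^ n * volume E * (C₁ * 2 ^ (n : ℝ) * P ^ (n : ℝ) * M)) := by
    calc ∫⁻ z' in E, ∫⁻ z in E, ‖G z - G z'‖ₑ ^ r
        = ∫⁻ z in E, ∫⁻ z' in E, ‖G z - G z'‖ₑ ^ r :=
          lintegral_lintegral_swap
            (f := fun z' z => ‖G z - G z'‖ₑ ^ r) (mJ.comp measurable_swap).aemeasurable
      _ ≤ ∫⁻ z in E, 7 ^ n * ∫⁻ v in V, ‖G z - G (reflectDir (lineReflection c z) v)‖ₑ ^ r := by
          refine setLIntegral_mono' measurableSet_closedBall fun z hz => ?_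
          have := setLIntegral_le_of_subset_image (lipschitzWith_reflectDir (lineReflection c z))
            (E := E) (V := V) (fun z' hz' => exists_reflectDir_eq hd hc (memE z hz) hz')
            (g := fun z' => ‖G z - G z'‖ₑ ^ r) (by fun_prop)
          simpa using this
      _ = 7 ^ n * ∫⁻ v in V, ∫⁻ z in E, ‖G z - G (reflectDir (lineReflection c z) v)‖ₑ ^ r := by
          rw [lintegral_const_mul' _ _ (by simp), lintegral_lintegral_swap mΦ.aemeasurable]
      _ ≤ 7 ^ n * ∫⁻ v in V, (C₁ * 2 ^ (n : ℝ) * P ^ (n : ℝ) * M) := by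
          gcongr 7 ^ n * ?_
          exact setLIntegral_mono' measurableSet_closedBall rot
      _ = _ := by rw [setLIntegral_const, hvolV]; ring
  -- Some point of E has an inner integral no larger than the average over E.
  obtain ⟨z₀, hz₀, h⟩ := exists_le_setLAverage (μ := volume) (s := E)
    (f := fun z' => ∫⁻ z in E, ‖G z - G z'‖ₑ ^ r) hvE0 hvEt
    (Measurable.lintegral_prod_right' (f := fun w : Rn n × Rn n => ‖G w.2 - G w.1‖ₑ ^ r)
      (by fun_prop)).aemeasurable
  refine ⟨z₀, hz₀, h.trans ?_⟩
  rw [setLAverage_eq]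
  refine ENNReal.div_le_of_le_mul (dbl.trans (le_of_eq ?_))
  ring

/-! ### The modulus of continuity and the Lipschitz seminorm -/

theorem modulus_mono {n : ℕ} (r : ℝ) (Ω : Rn n → Rn n → ℂ) : Monotone (modulus r Ω) := by
  intro δ δ' h
  refine iSup_mono fun x => iSup_mono fun ρ => iSup_mono fun hρ => ?_
  exact iSup_mono' fun hs => ⟨hs.trans_le (ENNReal.ofReal_le_ofReal h), le_rfl⟩

theorem lintegral_rotation_le_modulus {n : ℕ} {r : ℝ} (hr : 0 < r) (Ω : Rn n → Rn n → ℂ)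
    (x : Rn n) {ρ : Rn n ≃ₗᵢ[ℝ] Rn n} (hρ : IsRotation ρ) {δ : ℝ}
    (hδ : rotationSize ρ < ENNReal.ofReal δ) :
    ∫⁻ z : Sph n, ‖Ω x (ρ z) - Ω x z‖ₑ ^ r ∂sphereMeasure n ≤ modulus r Ω δ ^ r := by
  have h : (∫⁻ z : Sph n, ‖Ω x (ρ z) - Ω x z‖ₑ ^ r ∂sphereMeasure n) ^ (1 / r)
      ≤ modulus r Ω δ :=
    le_iSup_of_le x (le_iSup_of_le ρ (le_iSup_of_le hρ (le_iSup_of_le hδ le_rfl)))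
  have := ENNReal.rpow_le_rpow h hr.le
  rwa [← ENNReal.rpow_mul, one_div_mul_cancel hr.ne', ENNReal.rpow_one] at this

/-- By monotonicity, the part of the Dini integral over (δ, 2δ) is at least a multiple of ω_r(δ)
δ^{-β}. The restriction δ ≤ 1/2 keeps this interval inside (0, 1). -/
theorem exists_modulus_le {n : ℕ} {r β : ℝ} (hβ : 0 < β) {Ω : Rn n → Rn n → ℂ}
    (h : DiniCondition r β Ω) :
    ∃ C : ℝ≥0∞, C ≠ ∞ ∧ ∀ δ : ℝ, 0 < δ → δ ≤ 1 / 2 →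
      modulus r Ω δ ≤ C * ENNReal.ofReal δ ^ β := by
  set D := ∫⁻ δ in Ioo (0 : ℝ) 1, modulus r Ω δ / ENNReal.ofReal (δ ^ (1 + β)) with hD
  refine ⟨D * 2 ^ (1 + β), ENNReal.mul_ne_top h.ne
    (ENNReal.rpow_ne_top_of_nonneg (by positivity) (by simp)), fun δ hδ hδ2 => ?_⟩
  have h1 : modulus r Ω δ / ENNReal.ofReal ((2 * δ) ^ (1 + β)) * ENNReal.ofReal δ ≤ D := by
    calc modulus r Ω δ / ENNReal.ofReal ((2 * δ) ^ (1 + β)) * ENNReal.ofReal δ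
        = ∫⁻ _ in Ioo δ (2 * δ), modulus r Ω δ / ENNReal.ofReal ((2 * δ) ^ (1 + β)) := by
          rw [setLIntegral_const, Real.volume_Ioo]
          congr 2; ring
      _ ≤ ∫⁻ t in Ioo δ (2 * δ), modulus r Ω t / ENNReal.ofReal (t ^ (1 + β)) := by
          refine setLIntegral_mono' measurableSet_Ioo fun t ht => ?_
          refine ENNReal.div_le_div (modulus_mono r Ω ht.1.le) (ENNReal.ofReal_le_ofReal ?_)
          exact Real.rpow_le_rpow (hδ.trans ht.1).le ht.2.le (by positivity)
      _ ≤ D := lintegral_mono_set (Ioo_subset_Ioo hδ.le (by linarith))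
  set P := ENNReal.ofReal δ with hP
  have hP0 : P ≠ 0 := by simpa [hP] using hδ
  have hPt : P ≠ ∞ := ENNReal.ofReal_ne_top
  have e : ENNReal.ofReal ((2 * δ) ^ (1 + β)) = 2 ^ (1 + β) * (P * P ^ β) := by
    rw [← ENNReal.ofReal_rpow_of_pos (by positivity), ENNReal.ofReal_mul (by norm_num),
      ENNReal.mul_rpow_of_nonneg _ _ (by positivity), ← hP,
      ENNReal.rpow_add_of_nonneg (x := P) 1 β zero_le_one hβ.le, ENNReal.rpow_one]
    simp
  have e0 : ENNReal.ofReal ((2 * δ) ^ (1 + β)) ≠ 0 := by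
    simp only [ne_eq, ENNReal.ofReal_eq_zero, not_le]; positivity
  have h2 : modulus r Ω δ * P ≤ D * 2 ^ (1 + β) * P ^ β * P := by
    calc modulus r Ω δ * P
        = (modulus r Ω δ / ENNReal.ofReal ((2 * δ) ^ (1 + β)) * P) *
            ENNReal.ofReal ((2 * δ) ^ (1 + β)) := by
          rw [mul_right_comm, ENNReal.div_mul_cancel e0 ENNReal.ofReal_ne_top]
      _ ≤ D * ENNReal.ofReal ((2 * δ) ^ (1 + β)) := by gcongr
      _ = _ := by rw [e]; ring
  exact (ENNReal.mul_le_mul_iff_left hP0 hPt).1 h2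

theorem enorm_ofReal_norm_rpow {n : ℕ} {u : Rn n} (hu : u ≠ 0) (e : ℝ) :
    ‖(((‖u‖ ^ e : ℝ)) : ℂ)‖ₑ = ‖u‖ₑ ^ e := by
  have h : 0 < ‖u‖ := norm_pos_iff.2 hu
  rw [← ofReal_norm, Complex.norm_real, Real.norm_of_nonneg (by positivity),
    ← ENNReal.ofReal_rpow_of_pos h, ofReal_norm]

theorem enorm_sub_le_lipNorm {n : ℕ} {β : ℝ} (b : Rn n → ℂ) (x y : Rn n) :
    ‖b x - b y‖ₑ ≤ lipNorm β b * ‖x - y‖ₑ ^ β := by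
  rcases eq_or_ne x y with rfl | hxy
  · simp
  have hpos : 0 < ‖x - y‖ := norm_pos_iff.2 (sub_ne_zero.2 hxy)
  have h : ‖b x - b y‖ₑ / ENNReal.ofReal (‖x - y‖ ^ β) ≤ lipNorm β b :=
    le_iSup_of_le x (le_iSup_of_le y (le_iSup_of_le hxy le_rfl))
  rw [← ENNReal.ofReal_rpow_of_pos hpos, ofReal_norm] at h
  rw [ENNReal.div_le_iff_le_mul] at h
  · exact h
  · left; simp only [ne_eq, ENNReal.rpow_eq_zero_iff, not_or]
    simp [sub_eq_zero, hxy]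
  · left; exact ENNReal.rpow_ne_top_of_ne_zero (by simpa [sub_eq_zero] using hxy) (by simp)

theorem norm_sub_le_lipNorm {n : ℕ} {β : ℝ} (hβ : 0 < β) {b : Rn n → ℂ} (hb : lipNorm β b < ∞)
    (x y : Rn n) : ‖b x - b y‖ ≤ (lipNorm β b).toReal * ‖x - y‖ ^ β := by
  have h := enorm_sub_le_lipNorm (β := β) b x y
  have h2 := ENNReal.toReal_mono (ENNReal.mul_ne_top hb.ne
    (ENNReal.rpow_ne_top_of_nonneg hβ.le (by simp))) h
  simpa [ENNReal.toReal_mul, ← ENNReal.toReal_rpow] using h2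

theorem continuous_of_lipNorm {n : ℕ} {β : ℝ} (hβ : 0 < β) {b : Rn n → ℂ}
    (hb : lipNorm β b < ∞) : Continuous b := by
  refine continuous_iff_continuousAt.2 fun x => ?_
  refine tendsto_iff_norm_sub_tendsto_zero.2 ?_
  have h : Tendsto (fun y => (lipNorm β b).toReal * ‖y - x‖ ^ β) (𝓝 x) (𝓝 0) := by
    have h1 : Tendsto (fun y : Rn n => ‖y - x‖) (𝓝 x) (𝓝 0) :=
      tendsto_iff_norm_sub_tendsto_zero.1 tendsto_id
    simpa [Real.zero_rpow hβ.ne'] using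
      (h1.rpow_const (p := β) (Or.inr hβ.le)).const_mul (lipNorm β b).toReal
  exact squeeze_zero (fun y => norm_nonneg _) (fun y => norm_sub_le_lipNorm hβ hb y x) h

/-- The Lipschitz factor absorbs |x-y|^β. On the diagonal the left side vanishes because b(x) - b(y)
does, whatever the conventions for the singular powers. -/
theorem enorm_commutatorIntegrand_le {n : ℕ} {Ω : Rn n → Rn n → ℂ} {α β s : ℝ}
    (hs : s = n - α - β) (b f : Rn n → ℂ) (x y : Rn n) :
    ‖commutatorIntegrand Ω α b f x y‖ₑ ≤
      lipNorm β b * (‖Ω x (x - y)‖ₑ * ‖x - y‖ₑ ^ (-s) * ‖f y‖ₑ) := by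
  rcases eq_or_ne x y with rfl | hxy
  · simp [commutatorIntegrand]
  have hne : x - y ≠ 0 := sub_ne_zero.2 hxy
  have e1 : ‖x - y‖ₑ ^ (-s) = (‖x - y‖ₑ ^ ((n : ℝ) - α))⁻¹ * ‖x - y‖ₑ ^ β := by
    rw [← ENNReal.rpow_neg, ← ENNReal.rpow_add _ _ (by simpa using hne) (by simp)]
    congr 1; rw [hs]; ring
  have h0 : (((‖x - y‖ ^ ((n : ℝ) - α) : ℝ)) : ℂ) ≠ 0 := by
    have : 0 < ‖x - y‖ := norm_pos_iff.2 hne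
    exact_mod_cast (Real.rpow_pos_of_pos this _).ne'
  rw [commutatorIntegrand, enorm_mul, enorm_mul, div_eq_mul_inv, enorm_mul, enorm_inv h0,
    enorm_ofReal_norm_rpow hne, e1]
  calc _ ≤ ‖Ω x (x - y)‖ₑ * (‖x - y‖ₑ ^ ((n : ℝ) - α))⁻¹ * (lipNorm β b * ‖x - y‖ₑ ^ β) *
        ‖f y‖ₑ := by gcongr; exact enorm_sub_le_lipNorm b x y
    _ = _ := by ring

theorem enorm_commutator_le {n : ℕ} {Ω : Rn n → Rn n → ℂ} {α β s : ℝ}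
    (hs : s = n - α - β) {b : Rn n → ℂ} (hb : lipNorm β b < ∞) (f : Rn n → ℂ) (x : Rn n) :
    ‖commutator Ω α b f x‖ₑ ≤ lipNorm β b * absOp Ω s f x := by
  refine (enorm_integral_le_lintegral_enorm _).trans ?_
  rw [absOp, ← lintegral_const_mul' _ _ hb.ne]
  exact lintegral_mono fun y => enorm_commutatorIntegrand_le hs b f x y

/-! ### The pointwise estimate far from the support -/

/-- Mean value inequality; the exponent may be negative, so τ has to stay away from 0. -/
theorem exists_rpow_sub_rpow_le (e : ℝ) : ∃ K : ℝ, 0 ≤ K ∧ ∀ τ ∈ Icc (1 / 2 : ℝ) 2,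
    |τ ^ e - 1| ≤ K * |τ - 1| := by
  have hc : ContinuousOn (fun τ : ℝ => e * τ ^ (e - 1)) (Icc (1 / 2 : ℝ) 2) := by
    intro τ hτ
    have : (0 : ℝ) < τ := by linarith [hτ.1]
    exact ((Real.continuousAt_rpow_const τ (e - 1) (Or.inl this.ne')).const_mul
      e).continuousWithinAt
  obtain ⟨K, hK⟩ := isCompact_Icc.exists_bound_of_continuousOn hc
  have hK0 : 0 ≤ K := (norm_nonneg _).trans (hK 1 (by norm_num))
  refine ⟨K, hK0, fun τ hτ => ?_⟩
  have := (convex_Icc (1 / 2 : ℝ) 2).norm_image_sub_le_of_norm_hasDerivWithin_le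
    (f := fun τ : ℝ => τ ^ e) (f' := fun τ => e * τ ^ (e - 1)) (C := K) (x := 1) (y := τ)
    (fun t ht => ?_) hK (by norm_num) hτ
  · simpa using this
  · have : (0 : ℝ) < t := by linarith [ht.1]
    exact (Real.hasDerivAt_rpow_const (Or.inl this.ne')).hasDerivWithinAt

/-- In the application R = |x-x₀|, τ = |x-y|, g = Ω(x,x-y), g₀ = Ω(x,z₀), B₁ = b(x) - b(x₀) and B₂ =
b(x₀) - b(y). The difference telescopes into increments of b, of the power and of Ω. The increment
of the power is of relative size d/R, and (d/R) R^β ≤ d^β because β ≤ 1, so it is no worse than the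
increment of b. -/
theorem exists_norm_kernel_sub_le (e : ℝ) : ∃ K : ℝ, 0 ≤ K ∧
    ∀ (β L d R τ : ℝ) (g g₀ B₁ B₂ : ℂ), 0 < β → β ≤ 1 → 0 ≤ L → 0 < d → 2 * d ≤ R →
      |τ - R| ≤ d → ‖B₁‖ ≤ L * R ^ β → ‖B₂‖ ≤ L * d ^ β →
      ‖g * ((τ ^ e : ℝ) : ℂ) * (B₁ + B₂) - g₀ * ((R ^ e : ℝ) : ℂ) * B₁‖ ≤
        L * (K * R ^ e * (d ^ β * ‖g‖ + R ^ β * ‖g - g₀‖)) := by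
  obtain ⟨K, hK0, hK⟩ := exists_rpow_sub_rpow_le e
  refine ⟨1 + 2 * K, by positivity, ?_⟩
  intro β L d R τ g g₀ B₁ B₂ hβ hβ1 hL hd hdR hτ hB₁ hB₂
  have hR : 0 < R := by linarith
  have hτ' := abs_le.1 hτ
  have hτpos : 0 < τ := by linarith
  set θ := τ / R with hθ
  have hθR : τ = θ * R := by rw [hθ]; field_simp
  have hθ1 : |θ - 1| ≤ d / R := by
    rw [hθ, div_sub_one hR.ne', abs_div, abs_of_pos hR]; gcongr
  have hdR2 : d / R ≤ 1 / 2 := by rw [div_le_iff₀ hR]; linarith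
  have hθI : θ ∈ Icc (1 / 2 : ℝ) 2 := by
    have := abs_le.1 (hθ1.trans hdR2)
    constructor <;> linarith [this.1, this.2]
  have hθpos : 0 < θ := by linarith [hθI.1]
  have h1 := hK θ hθI
  have hRe : 0 < R ^ e := by positivity
  have hτe : τ ^ e = θ ^ e * R ^ e := by rw [hθR, Real.mul_rpow hθpos.le hR.le]
  have hdiff : |τ ^ e - R ^ e| ≤ K * (d / R) * R ^ e := by
    have : τ ^ e - R ^ e = (θ ^ e - 1) * R ^ e := by rw [hτe]; ring
    rw [this, abs_mul, abs_of_pos hRe]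
    gcongr
    exact h1.trans (by gcongr)
  have hτe_le : τ ^ e ≤ (1 + K) * R ^ e := by
    have h2 : K * (d / R) ≤ K := by nlinarith
    have h3 := (abs_le.1 hdiff).2
    nlinarith
  have hdRβ : d / R * R ^ β ≤ d ^ β := by
    have h4 : d / R ≤ (d / R) ^ β := by
      conv_lhs => rw [← Real.rpow_one (d / R)]
      exact Real.rpow_le_rpow_of_exponent_ge (by positivity) (by linarith) hβ1
    calc d / R * R ^ β ≤ (d / R) ^ β * R ^ β := by gcongr
      _ = d ^ β := by rw [Real.div_rpow hd.le hR.le]; field_simp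
  have hsplit : g * ((τ ^ e : ℝ) : ℂ) * (B₁ + B₂) - g₀ * ((R ^ e : ℝ) : ℂ) * B₁ =
      g * ((τ ^ e : ℝ) : ℂ) * B₂ + g * ((τ ^ e - R ^ e : ℝ) : ℂ) * B₁ +
        (g - g₀) * ((R ^ e : ℝ) : ℂ) * B₁ := by push_cast; ring
  rw [hsplit]
  have hτe0 : 0 ≤ τ ^ e := by positivity
  calc _ ≤ ‖g * ((τ ^ e : ℝ) : ℂ) * B₂‖ + ‖g * ((τ ^ e - R ^ e : ℝ) : ℂ) * B₁‖ +
        ‖(g - g₀) * ((R ^ e : ℝ) : ℂ) * B₁‖ := norm_add₃_le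
    _ = ‖g‖ * τ ^ e * ‖B₂‖ + ‖g‖ * |τ ^ e - R ^ e| * ‖B₁‖ + ‖g - g₀‖ * R ^ e * ‖B₁‖ := by
        simp only [norm_mul, Complex.norm_real, Real.norm_eq_abs, abs_of_nonneg hτe0,
          abs_of_pos hRe]
    _ ≤ ‖g‖ * ((1 + K) * R ^ e) * (L * d ^ β) + ‖g‖ * (K * (d / R) * R ^ e) * (L * R ^ β) +
        ‖g - g₀‖ * R ^ e * (L * R ^ β) := by gcongr
    _ = L * R ^ e * (‖g‖ * ((1 + K) * d ^ β + K * (d / R * R ^ β)) + R ^ β * ‖g - g₀‖) := by ring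
    _ ≤ L * R ^ e * (‖g‖ * ((1 + K) * d ^ β + K * d ^ β) + (1 + 2 * K) * (R ^ β * ‖g - g₀‖)) := by
        have h5 : 0 ≤ R ^ β * ‖g - g₀‖ := by positivity
        exact mul_le_mul_of_nonneg_left (add_le_add (by gcongr) (by nlinarith)) (by positivity)
    _ = _ := by ring

theorem setLIntegral_closedBall_comp_sub {n : ℕ} (x x₀ : Rn n) (d : ℝ) (g : Rn n → ℝ≥0∞) :
    ∫⁻ y in closedBall x₀ d, g (x - y) = ∫⁻ z in closedBall (x - x₀) d, g z := by
  rw [← lintegral_indicator measurableSet_closedBall, ← lintegral_indicator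
    measurableSet_closedBall, ← lintegral_sub_left_eq_self ((closedBall (x - x₀) d).indicator g) x]
  refine lintegral_congr fun y => ?_
  have : x - y ∈ closedBall (x - x₀) d ↔ y ∈ closedBall x₀ d := by
    rw [mem_closedBall, mem_closedBall, dist_sub_left]
  by_cases hy : y ∈ closedBall x₀ d
  · rw [indicator_of_mem hy, indicator_of_mem (this.2 hy)]
  · rw [indicator_of_notMem hy, indicator_of_notMem (fun h => hy (this.1 h))]

/-- The vanishing mean permits subtracting from the kernel a value independent of y. Hölder with r
and t separates the atom from Ω, leaving the L^r size and the L^r oscillation of Ω(x,·) on the ball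
of centre x - x₀ and radius d. Both are taken with the crude volume |x-x₀|^n, which produces the
loss n/r in the decay; the oscillation gains (d/|x-x₀|)^β. -/
theorem exists_far_bound {n : ℕ} (hn : 1 ≤ n) {r t α β : ℝ} (hrt : r.HolderConjugate t)
    (hβ : 0 < β) (hβ1 : β ≤ 1) {Ω : Rn n → Rn n → ℂ} (hΩ : IsKernel r Ω)
    (hDini : DiniCondition r β Ω) :
    ∃ C : ℝ≥0∞, C ≠ ∞ ∧ ∀ b : Rn n → ℂ, lipNorm β b < ∞ → ∀ (x₀ : Rn n) (d : ℝ) (a : Rn n → ℂ),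
      0 < d → Integrable a → Function.support a ⊆ closedBall x₀ d → ∫ y, a y = 0 →
      ∀ x, 100 * d < ‖x - x₀‖ →
      ‖commutator Ω α b a x‖ₑ ≤ C * lipNorm β b * ENNReal.ofReal d ^ β *
        ‖x - x₀‖ₑ ^ (α - n + n / r) * (∫⁻ y, ‖a y‖ₑ ^ t) ^ (1 / t) := by
  have hr := hrt.pos
  obtain ⟨K, hK0, hK⟩ := exists_norm_kernel_sub_le (α - n)
  obtain ⟨C₁, hC₁, H₁⟩ := exists_norm_rpow_mul_kernel_ball_le hn (s := 0)
    (by exact_mod_cast hn) hr le_rfl hΩ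
  obtain ⟨C₂, hC₂, H₂⟩ := exists_osc_le hn r
  obtain ⟨C₃, hC₃, H₃⟩ := exists_modulus_le hβ hDini
  have h50 : (50 : ℝ≥0∞) ^ β ≠ ∞ := ENNReal.rpow_ne_top_of_nonneg hβ.le (by simp)
  refine ⟨ENNReal.ofReal K * ((C₁ * 2 ^ (n : ℝ)) ^ (1 / r) + C₂ ^ (1 / r) * (C₃ * 50 ^ β)),
    ?_, ?_⟩
  · refine ENNReal.mul_ne_top ENNReal.ofReal_ne_top (ENNReal.add_ne_top.2 ⟨?_, ?_⟩)
    · refine ENNReal.rpow_ne_top_of_nonneg (by positivity) (ENNReal.mul_ne_top hC₁ ?_)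
      exact ENNReal.rpow_ne_top_of_nonneg (by positivity) (by simp)
    · exact ENNReal.mul_ne_top (ENNReal.rpow_ne_top_of_nonneg (by positivity) hC₂)
        (ENNReal.mul_ne_top hC₃ h50)
  intro b hb x₀ d a hd ha hsupp hfint x hx
  set L := (lipNorm β b).toReal with hL
  have hL0 : 0 ≤ L := ENNReal.toReal_nonneg
  have hLof : ENNReal.ofReal L = lipNorm β b := ENNReal.ofReal_toReal hb.ne
  set c := x - x₀ with hc
  set R := ‖c‖ with hR
  have hRpos : 0 < R := by linarith
  set P := ENNReal.ofReal R with hP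
  set D := ENNReal.ofReal d with hD
  have hP0 : P ≠ 0 := by simpa [hP] using hRpos
  have hPt : P ≠ ∞ := ENNReal.ofReal_ne_top
  have hDt : D ≠ ∞ := ENNReal.ofReal_ne_top
  have hPe : ‖c‖ₑ = P := (ofReal_norm c).symm
  have mG := hΩ.measurable_right x
  have hδ : 0 < 50 * d / R := by positivity
  -- The threshold 100d is chosen so that the argument 50d/R of the modulus stays in the range of
  -- the power bound.
  have hδ2 : 50 * d / R ≤ 1 / 2 := by rw [div_le_iff₀ hRpos]; linarith
  obtain ⟨z₀, -, hz₀⟩ := H₂ (Ω x) mG (hΩ.homogeneous x) c d hd hx.le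
    (modulus r Ω (50 * d / R) ^ r)
    (fun ρ hρ hs => lintegral_rotation_le_modulus hr Ω x hρ hs)
  set B := closedBall x₀ d with hB
  set N := (∫⁻ y, ‖a y‖ₑ ^ t) ^ (1 / t) with hN
  -- The angular part is frozen at the point z₀ of small mean oscillation, the radial part and b at
  -- the centre x₀.
  set κ : ℂ := Ω x z₀ * ((R ^ (α - n) : ℝ) : ℂ) * (b x - b x₀) with hκ
  have pointwise : ∀ y ∈ B, ‖commutatorIntegrand Ω α b a x y - κ * a y‖ₑ ≤
      lipNorm β b * (ENNReal.ofReal K * P ^ (α - n) *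
        (D ^ β * (‖Ω x (x - y)‖ₑ * ‖a y‖ₑ) + P ^ β * (‖Ω x (x - y) - Ω x z₀‖ₑ * ‖a y‖ₑ))) := by
    intro y hy
    rw [hB, mem_closedBall, dist_eq_norm] at hy
    have hτ : |‖x - y‖ - R| ≤ d := by
      refine (abs_norm_sub_norm_le (x - y) c).trans ?_
      rw [hc, sub_sub_sub_cancel_left, norm_sub_rev]
      exact hy
    have hB₂ : ‖b x₀ - b y‖ ≤ L * d ^ β := by
      refine (norm_sub_le_lipNorm hβ hb x₀ y).trans ?_
      gcongr
      rwa [norm_sub_rev]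
    have h1 := hK β L d R ‖x - y‖ (Ω x (x - y)) (Ω x z₀) (b x - b x₀) (b x₀ - b y) hβ hβ1 hL0 hd
      (by linarith) hτ (norm_sub_le_lipNorm hβ hb x x₀) hB₂
    rw [sub_add_sub_cancel, ← hκ] at h1
    have e1 : commutatorIntegrand Ω α b a x y - κ * a y =
        (Ω x (x - y) * ((‖x - y‖ ^ (α - n) : ℝ) : ℂ) * (b x - b y) - κ) * a y := by
      rw [commutatorIntegrand, sub_mul, div_eq_mul_inv]
      congr 4
      rw [← neg_sub (n : ℝ) α, Real.rpow_neg (norm_nonneg _)]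
      push_cast
      rfl
    rw [e1, enorm_mul]
    have h2 := ENNReal.ofReal_le_ofReal h1
    rw [ofReal_norm, ENNReal.ofReal_mul hL0, ENNReal.ofReal_mul (by positivity),
      ENNReal.ofReal_mul hK0, ENNReal.ofReal_add (by positivity) (by positivity),
      ENNReal.ofReal_mul (by positivity), ENNReal.ofReal_mul (by positivity), ofReal_norm,
      ofReal_norm, ← ENNReal.ofReal_rpow_of_pos hRpos, ← ENNReal.ofReal_rpow_of_pos hd,
      ← ENNReal.ofReal_rpow_of_pos hRpos, hLof] at h2
    refine (mul_le_mul_left h2 _).trans (le_of_eq ?_)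
    ring
  have ham : AEMeasurable (fun y => ‖a y‖ₑ) volume := ha.1.enorm
  have mG1 : Measurable fun y : Rn n => Ω x (x - y) :=
    mG.comp (measurable_const.sub measurable_id)
  have hold : ∀ g : Rn n → ℝ≥0∞, Measurable g →
      ∫⁻ y in B, g y * ‖a y‖ₑ ≤ (∫⁻ y in B, g y ^ r) ^ (1 / r) * N := by
    intro g hg
    refine (ENNReal.lintegral_mul_le_Lp_mul_Lq _ hrt hg.aemeasurable ham.restrict).trans ?_
    have ht := hrt.symm.pos
    gcongr
    exact ENNReal.rpow_le_rpow (setLIntegral_le_lintegral _ _) (by positivity)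
  have I₁ : ∫⁻ y in B, ‖Ω x (x - y)‖ₑ * ‖a y‖ₑ ≤
      (C₁ * 2 ^ (n : ℝ)) ^ (1 / r) * P ^ (n / r : ℝ) * N := by
    refine (hold _ mG1.enorm).trans ?_
    gcongr
    rw [hB, setLIntegral_closedBall_comp_sub x x₀ d (fun z => ‖Ω x z‖ₑ ^ r)]
    have h3 := H₁ (2 * R) (by positivity) x
    simp only [neg_zero, ENNReal.rpow_zero, one_mul, sub_zero] at h3
    calc (∫⁻ z in closedBall (x - x₀) d, ‖Ω x z‖ₑ ^ r) ^ (1 / r)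
        ≤ (∫⁻ z in ball 0 (2 * R), ‖Ω x z‖ₑ ^ r) ^ (1 / r) := by
          refine ENNReal.rpow_le_rpow (lintegral_mono_set fun z hz => ?_) (by positivity)
          rw [mem_closedBall, dist_eq_norm] at hz
          rw [mem_ball_zero_iff]
          linarith [norm_le_norm_add_norm_sub' z c]
      _ ≤ (C₁ * ENNReal.ofReal (2 * R) ^ (n : ℝ)) ^ (1 / r) :=
          ENNReal.rpow_le_rpow h3 (by positivity)
      _ = (C₁ * 2 ^ (n : ℝ)) ^ (1 / r) * P ^ (n / r : ℝ) := by
          rw [ENNReal.ofReal_mul (by norm_num),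
            ENNReal.mul_rpow_of_nonneg (ENNReal.ofReal 2) (ENNReal.ofReal R) (by positivity),
            ← mul_assoc, ENNReal.mul_rpow_of_nonneg _ _ (by positivity), ← hP, ← ENNReal.rpow_mul,
            mul_one_div]
          simp
  have I₂ : ∫⁻ y in B, ‖Ω x (x - y) - Ω x z₀‖ₑ * ‖a y‖ₑ ≤
      C₂ ^ (1 / r) * P ^ (n / r : ℝ) * (C₃ * 50 ^ β * D ^ β * P ^ (-β)) * N := by
    refine (hold (fun y => ‖Ω x (x - y) - Ω x z₀‖ₑ) (mG1.sub measurable_const).enorm).trans ?_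
    gcongr
    rw [hB, setLIntegral_closedBall_comp_sub x x₀ d (fun z => ‖Ω x z - Ω x z₀‖ₑ ^ r)]
    have h4 : ENNReal.ofReal (50 * d / R) ^ β = 50 ^ β * D ^ β * P ^ (-β) := by
      rw [ENNReal.ofReal_div_of_pos hRpos, ENNReal.ofReal_mul (by norm_num),
        ENNReal.div_rpow_of_nonneg _ _ hβ.le, ENNReal.mul_rpow_of_nonneg _ _ hβ.le,
        ENNReal.rpow_neg, div_eq_mul_inv]
      simp [hD, hP]
    calc (∫⁻ z in closedBall (x - x₀) d, ‖Ω x z - Ω x z₀‖ₑ ^ r) ^ (1 / r)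
        ≤ (C₂ * P ^ (n : ℝ) * modulus r Ω (50 * d / R) ^ r) ^ (1 / r) :=
          ENNReal.rpow_le_rpow hz₀ (by positivity)
      _ = C₂ ^ (1 / r) * P ^ (n / r : ℝ) * modulus r Ω (50 * d / R) := by
          rw [ENNReal.mul_rpow_of_nonneg _ _ (by positivity),
            ENNReal.mul_rpow_of_nonneg _ _ (by positivity), ← ENNReal.rpow_mul,
            ← ENNReal.rpow_mul, mul_one_div_cancel hr.ne', ENNReal.rpow_one, mul_one_div]
      _ ≤ C₂ ^ (1 / r) * P ^ (n / r : ℝ) * (C₃ * 50 ^ β * D ^ β * P ^ (-β)) := by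
          gcongr
          refine (H₃ _ hδ hδ2).trans (le_of_eq ?_)
          rw [h4]; ring
  have key : ‖commutator Ω α b a x‖ₑ ≤
      ∫⁻ y in B, ‖commutatorIntegrand Ω α b a x y - κ * a y‖ₑ := by
    -- Without integrability the integral is zero by convention, so the bound holds at every far x
    -- and not just almost everywhere.
    by_cases hI : Integrable (commutatorIntegrand Ω α b a x)
    · have e2 : commutator Ω α b a x = ∫ y, (commutatorIntegrand Ω α b a x y - κ * a y) := by
        rw [integral_sub hI (ha.const_mul κ), integral_const_mul, hfint, mul_zero, sub_zero]
        rfl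
      rw [e2]
      refine (enorm_integral_le_lintegral_enorm _).trans (le_of_eq ?_)
      rw [← lintegral_indicator measurableSet_closedBall]
      refine lintegral_congr fun y => ?_
      by_cases hy : y ∈ closedBall x₀ d
      · rw [indicator_of_mem hy]
      · have : a y = 0 := by
          by_contra h
          exact hy (hsupp h)
        rw [indicator_of_notMem hy, commutatorIntegrand, this]
        simp
    · rw [commutator, integral_undef hI]; simp
  have m₁ : AEMeasurable (fun y => D ^ β * (‖Ω x (x - y)‖ₑ * ‖a y‖ₑ)) (volume.restrict B) :=
    ((mG1.enorm.aemeasurable.mul ham).const_mul _).restrict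
  calc ‖commutator Ω α b a x‖ₑ ≤ _ := key
    _ ≤ ∫⁻ y in B, lipNorm β b * (ENNReal.ofReal K * P ^ (α - n) *
        (D ^ β * (‖Ω x (x - y)‖ₑ * ‖a y‖ₑ) + P ^ β * (‖Ω x (x - y) - Ω x z₀‖ₑ * ‖a y‖ₑ))) :=
        setLIntegral_mono' measurableSet_closedBall pointwise
    _ = lipNorm β b * (ENNReal.ofReal K * P ^ (α - n) *
        (D ^ β * (∫⁻ y in B, ‖Ω x (x - y)‖ₑ * ‖a y‖ₑ) +
          P ^ β * ∫⁻ y in B, ‖Ω x (x - y) - Ω x z₀‖ₑ * ‖a y‖ₑ)) := by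
        rw [lintegral_const_mul' _ _ hb.ne, lintegral_const_mul' _ _ (ENNReal.mul_ne_top
          ENNReal.ofReal_ne_top (ENNReal.rpow_ne_top_of_ne_zero hP0 hPt)),
          lintegral_add_left' m₁, lintegral_const_mul' _ _
          (ENNReal.rpow_ne_top_of_nonneg hβ.le hDt), lintegral_const_mul' _ _
          (ENNReal.rpow_ne_top_of_nonneg hβ.le hPt)]
    _ ≤ lipNorm β b * (ENNReal.ofReal K * P ^ (α - n) *
        (D ^ β * ((C₁ * 2 ^ (n : ℝ)) ^ (1 / r) * P ^ (n / r : ℝ) * N) +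
          P ^ β * (C₂ ^ (1 / r) * P ^ (n / r : ℝ) * (C₃ * 50 ^ β * D ^ β * P ^ (-β)) * N))) := by
        gcongr
    _ = lipNorm β b * (ENNReal.ofReal K * P ^ (α - n) *
        (D ^ β * ((C₁ * 2 ^ (n : ℝ)) ^ (1 / r) * P ^ (n / r : ℝ) * N) +
          (P ^ β * P ^ (-β)) * (C₂ ^ (1 / r) * P ^ (n / r : ℝ) * (C₃ * 50 ^ β * D ^ β) * N))) := by
        ring
    _ = _ := by
        rw [← ENNReal.rpow_add _ _ hP0 hPt, add_neg_cancel, ENNReal.rpow_zero, hPe,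
          ENNReal.rpow_add (α - n) _ hP0 hPt]
        ring

/-! ### The estimate on atoms -/

/-- The relations between the exponents: `t` is conjugate to `r`, `s = n - α - β` is the order of
the singularity of the kernel of the commutator, and `Q` is an auxiliary exponent. -/
structure Exponents (n : ℕ) (α β p q r t Q s : ℝ) : Prop where
  one_le_n : 1 ≤ n
  conj : r.HolderConjugate t
  β_pos : 0 < β
  β_le : β ≤ 1
  p_pos : 0 < p
  p_lt : p < 1
  q_pos : 0 < q
  p_le_q : p ≤ q
  q_le : q ≤ Q
  t_le : t ≤ Q
  t_lt_two : t < 2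
  s_eq : s = n - α - β
  s_lt : s < n / r + n / Q
  rel : n / q = n / p - α - β
  decay : n < (n - α - n / r) * q
  smooth : n / p < n + 1

/-- `a` is `A` times a `(p,2)`-atom (with vanishing mean) on the ball of centre `x₀` and
radius `d`. -/
structure IsAtomOn {n : ℕ} (p : ℝ) (A : ℝ≥0∞) (x₀ : Rn n) (d : ℝ) (a : Rn n → ℂ) : Prop where
  radius_pos : 0 < d
  memLp : MemLp a 2 volume
  support_subset : Function.support a ⊆ closedBall x₀ d
  norm_le : eLpNorm a 2 volume ≤ A * ENNReal.ofReal d ^ ((n : ℝ) / 2 - n / p)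
  integral_eq_zero : ∫ x, a x = 0

theorem eLpNorm_ofReal {X E : Type*} [MeasurableSpace X] {μ : Measure X} [NormedAddCommGroup E]
    (f : X → E) {t : ℝ} (ht : 0 < t) :
    eLpNorm f (ENNReal.ofReal t) μ = (∫⁻ x, ‖f x‖ₑ ^ t ∂μ) ^ (1 / t) := by
  rw [eLpNorm_eq_lintegral_rpow_enorm_toReal (by simpa using ht) (by simp),
    ENNReal.toReal_ofReal ht.le]

theorem eLpNorm_two {X E : Type*} [MeasurableSpace X] {μ : Measure X} [NormedAddCommGroup E]
    (f : X → E) : eLpNorm f 2 μ = (∫⁻ x, ‖f x‖ₑ ^ (2 : ℝ) ∂μ) ^ (1 / 2 : ℝ) := by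
  rw [eLpNorm_eq_lintegral_rpow_enorm_toReal (by simp) (by simp)]
  simp

theorem volume_closedBall_rpow {n : ℕ} (x₀ : Rn n) {d : ℝ} (hd : 0 < d) (e : ℝ) :
    volume (closedBall x₀ d) ^ e =
      volume (closedBall (0 : Rn n) 1) ^ e * ENNReal.ofReal d ^ (n * e) := by
  rw [Measure.addHaar_closedBall' _ _ hd.le, finrank_euclideanSpace_fin,
    ENNReal.mul_rpow_of_ne_top (by simp) measure_closedBall_lt_top.ne, mul_comm,
    ENNReal.ofReal_pow hd.le, ← ENNReal.rpow_natCast, ← ENNReal.rpow_mul]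

theorem lintegral_rpow_le_of_support_subset {n : ℕ} {a : Rn n → ℂ}
    (ha : AEStronglyMeasurable a volume) {x₀ : Rn n} {d : ℝ}
    (hsupp : Function.support a ⊆ closedBall x₀ d) {t u : ℝ} (ht : 0 < t) (htu : t ≤ u) :
    (∫⁻ y, ‖a y‖ₑ ^ t) ^ (1 / t) ≤
      (∫⁻ y, ‖a y‖ₑ ^ u) ^ (1 / u) * volume (closedBall x₀ d) ^ (1 / t - 1 / u) := by
  have h := lintegral_rpow_le_of_le (μ := volume.restrict (closedBall x₀ d)) ha.enorm.restrict
    ht htu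
  have e : ∀ v : ℝ, 0 < v → ∫⁻ y in closedBall x₀ d, ‖a y‖ₑ ^ v = ∫⁻ y, ‖a y‖ₑ ^ v := by
    intro v hv
    refine setLIntegral_eq_of_support_subset ?_
    intro y hy
    refine hsupp fun h0 => hy ?_
    simp [h0, hv]
  rwa [e t ht, e u (ht.trans_le htu), Measure.restrict_apply_univ] at h

/-- Of the moment conditions only γ = 0 is kept. The volume of the unit ball is moved into the
factor A, leaving a pure power of the radius. -/
theorem IsAtom.exists_isAtomOn {n : ℕ} {p : ℝ} (hp0 : 0 < p) (hp1 : p < 1) {a : Rn n → ℂ}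
    (ha : IsAtom p 2 a) :
    ∃ (x₀ : Rn n) (d : ℝ),
      IsAtomOn p (volume (closedBall (0 : Rn n) 1) ^ (1 / 2 - 1 / p)) x₀ d a := by
  obtain ⟨hm, x₀, d, hd, hsupp, hnorm, hmom⟩ := ha
  have e2 : ENNReal.ofReal 2 = 2 := by simp
  rw [e2] at hm hnorm
  refine ⟨x₀, d, hd, hm, hsupp, ?_, ?_⟩
  · rw [volume_closedBall_rpow x₀ hd] at hnorm
    refine hnorm.trans (le_of_eq ?_)
    congr 2; ring
  · have h1 : 1 < 1 / p := by rw [lt_div_iff₀ hp0]; linarith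
    have := hmom 0 (by
      simp only [Pi.zero_apply, Finset.sum_const_zero, Nat.cast_zero]
      exact Int.floor_nonneg.2 (mul_nonneg (Nat.cast_nonneg _) (by linarith)))
    simpa using this

theorem IsAtomOn.lintegral_rpow_le {n : ℕ} {p : ℝ} {A : ℝ≥0∞} {x₀ : Rn n} {d : ℝ} {a : Rn n → ℂ}
    (ha : IsAtomOn p A x₀ d a) {t : ℝ} (ht : 0 < t) (ht2 : t ≤ 2) :
    (∫⁻ y, ‖a y‖ₑ ^ t) ^ (1 / t) ≤
      volume (closedBall (0 : Rn n) 1) ^ (1 / t - 1 / 2) * A *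
        ENNReal.ofReal d ^ (n / t - n / p : ℝ) := by
  have hD0 : ENNReal.ofReal d ≠ 0 := by simpa using ha.radius_pos
  refine (lintegral_rpow_le_of_support_subset ha.memLp.1 ha.support_subset ht ht2).trans ?_
  rw [volume_closedBall_rpow x₀ ha.radius_pos, ← eLpNorm_two]
  calc _ ≤ A * ENNReal.ofReal d ^ ((n : ℝ) / 2 - n / p) * (volume (closedBall (0 : Rn n) 1) ^
        (1 / t - 1 / 2) * ENNReal.ofReal d ^ (n * (1 / t - 1 / 2))) := by
        gcongr; exact ha.norm_le
    _ = volume (closedBall (0 : Rn n) 1) ^ (1 / t - 1 / 2) * A *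
        (ENNReal.ofReal d ^ ((n : ℝ) / 2 - n / p) * ENNReal.ofReal d ^ (n * (1 / t - 1 / 2))) := by
        ring
    _ = _ := by
        rw [← ENNReal.rpow_add _ _ hD0 ENNReal.ofReal_ne_top]
        congr 2; ring

theorem IsAtomOn.integrable {n : ℕ} {p : ℝ} {A : ℝ≥0∞} {x₀ : Rn n} {d : ℝ} {a : Rn n → ℂ}
    (ha : IsAtomOn p A x₀ d a) : Integrable a := by
  refine memLp_one_iff_integrable.1 ⟨ha.memLp.1, ?_⟩
  have h := lintegral_rpow_le_of_support_subset ha.memLp.1 ha.support_subset one_pos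
    (one_le_two : (1 : ℝ) ≤ 2)
  rw [← ENNReal.ofReal_one, eLpNorm_ofReal _ one_pos]
  refine h.trans_lt (ENNReal.mul_lt_top ?_ ?_)
  · rw [← eLpNorm_two]; exact ha.memLp.2
  · exact ENNReal.rpow_lt_top_of_nonneg (by norm_num) measure_closedBall_lt_top.ne

theorem lintegral_norm_sub_rpow_compl {n : ℕ} (x₀ : Rn n) (ρ e : ℝ) :
    ∫⁻ x in (closedBall x₀ ρ)ᶜ, ‖x - x₀‖ₑ ^ e = ∫⁻ z in (closedBall (0 : Rn n) ρ)ᶜ, ‖z‖ₑ ^ e := by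
  rw [← lintegral_indicator measurableSet_closedBall.compl, ← lintegral_indicator
    measurableSet_closedBall.compl, ← lintegral_sub_right_eq_self ((closedBall (0 : Rn n) ρ)ᶜ.indicator _) x₀]
  refine lintegral_congr fun y => ?_
  simp [indicator, dist_eq_norm]

/-- Space is cut at the sphere of radius 100d about x₀: inside, the local bound for the positive
operator; outside, the far bound and integration of a power. In both regions the L^t norm of the
atom is used, and all powers of d cancel by the relation between p and q, so the constant does not
see the ball. -/
theorem Exponents.exists_atom_bound {n : ℕ} {α β p q r t Q s : ℝ}
    (h : Exponents n α β p q r t Q s) {Ω : Rn n → Rn n → ℂ} (hΩ : IsKernel r Ω)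
    (hDini : DiniCondition r β Ω) :
    ∃ C : ℝ≥0∞, C ≠ ∞ ∧ ∀ b : Rn n → ℂ, lipNorm β b < ∞ →
      ∀ (A : ℝ≥0∞) (x₀ : Rn n) (d : ℝ) (a : Rn n → ℂ), IsAtomOn p A x₀ d a →
      eLpNorm (commutator Ω α b a) (ENNReal.ofReal q) volume ≤ C * lipNorm β b * A := by
  have hq := h.q_pos
  have ht := h.conj.symm.pos
  obtain ⟨C₁, hC₁, H₁⟩ := exists_local_bound h.one_le_n h.conj hq h.q_le h.t_le h.s_lt hΩ
  obtain ⟨C₂, hC₂, H₂⟩ := exists_far_bound (α := α) h.one_le_n h.conj h.β_pos h.β_le hΩ hDini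
  obtain ⟨C₃, hC₃, H₃⟩ := exists_norm_rpow_compl_ball_le h.one_le_n h.decay
  set W : ℝ≥0∞ := volume (closedBall (0 : Rn n) 1) ^ (1 / t - 1 / 2) with hW
  have hWt : W ≠ ∞ := ENNReal.rpow_ne_top_of_nonneg
    (sub_nonneg.2 (one_div_le_one_div_of_le ht h.t_lt_two.le)) measure_closedBall_lt_top.ne
  have h100 : ∀ e : ℝ, (100 : ℝ≥0∞) ^ e ≠ ∞ := fun e =>
    ENNReal.rpow_ne_top_of_ne_zero (by simp) (by simp)
  have h101 : ∀ e : ℝ, (101 : ℝ≥0∞) ^ e ≠ ∞ := fun e =>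
    ENNReal.rpow_ne_top_of_ne_zero (by simp) (by simp)
  refine ⟨2 ^ (1 / q) * (C₁ * 101 ^ (n / r - s + n / q) * W +
    C₂ * W * (C₃ * 100 ^ (n - (n - α - n / r) * q)) ^ (1 / q)), ?_, ?_⟩
  · refine ENNReal.mul_ne_top (ENNReal.rpow_ne_top_of_nonneg (by positivity) (by simp))
      (ENNReal.add_ne_top.2 ⟨ENNReal.mul_ne_top (ENNReal.mul_ne_top hC₁ (h101 _)) hWt, ?_⟩)
    refine ENNReal.mul_ne_top (ENNReal.mul_ne_top hC₂ hWt)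
      (ENNReal.rpow_ne_top_of_nonneg (by positivity) (ENNReal.mul_ne_top hC₃ (h100 _)))
  intro b hb A x₀ d a ha
  have hd := ha.radius_pos
  set D := ENNReal.ofReal d with hD
  have hD0 : D ≠ 0 := by simpa [hD] using hd
  have hDt : D ≠ ∞ := ENNReal.ofReal_ne_top
  set L := lipNorm β b with hL
  have hnt : (n : ℝ) / r + n / t = n := by
    have h1 := h.conj.inv_add_inv_eq_one
    rw [div_eq_mul_inv, div_eq_mul_inv, ← mul_add, h1, mul_one]
  have hrel := h.rel
  have hs := h.s_eq
  set N := (∫⁻ y, ‖a y‖ₑ ^ t) ^ (1 / t) with hN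
  have hNle : N ≤ W * A * D ^ (n / t - n / p : ℝ) := ha.lintegral_rpow_le ht h.t_lt_two.le
  set S := closedBall x₀ (100 * d) with hS
  -- The local bound is stated for open balls, so the closed ball of radius 100d is enlarged
  -- slightly.
  set B := ball x₀ (101 * d) with hB
  have hSB : S ⊆ B := closedBall_subset_ball (by linarith)
  have hsupB : Function.support a ⊆ B :=
    ha.support_subset.trans (closedBall_subset_ball (by linarith))
  have near : (∫⁻ x in S, ‖commutator Ω α b a x‖ₑ ^ q) ^ (1 / q) ≤
      L * (C₁ * 101 ^ (n / r - s + n / q) * W) * A := by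
    have e1 : ∀ x, absOp Ω s a x = ∫⁻ y in B, ‖Ω x (x - y)‖ₑ * ‖x - y‖ₑ ^ (-s) * ‖a y‖ₑ := by
      intro x
      refine (setLIntegral_eq_of_support_subset fun y hy => ?_).symm
      refine hsupB fun h0 => hy ?_
      simp [h0]
    calc (∫⁻ x in S, ‖commutator Ω α b a x‖ₑ ^ q) ^ (1 / q)
        ≤ (∫⁻ x in B, (L * absOp Ω s a x) ^ q) ^ (1 / q) := by
          refine ENNReal.rpow_le_rpow ((lintegral_mono_set hSB).trans
            (lintegral_mono fun x => ?_)) (by positivity)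
          exact ENNReal.rpow_le_rpow (enorm_commutator_le hs hb a x) hq.le
      _ = L * (∫⁻ x in B, absOp Ω s a x ^ q) ^ (1 / q) := by
          simp only [ENNReal.mul_rpow_of_nonneg _ _ hq.le]
          rw [lintegral_const_mul' _ _ (ENNReal.rpow_ne_top_of_nonneg hq.le hb.ne),
            ENNReal.mul_rpow_of_nonneg _ _ (by positivity), ← ENNReal.rpow_mul,
            mul_one_div_cancel hq.ne', ENNReal.rpow_one]
      _ ≤ L * (C₁ * ENNReal.ofReal (101 * d) ^ (n / r - s + n / q) * N) := by
          gcongr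
          simp only [e1]
          refine (H₁ x₀ (101 * d) (by positivity) _ ha.memLp.1.enorm.restrict).trans ?_
          gcongr
          exact ENNReal.rpow_le_rpow (setLIntegral_le_lintegral _ _) (by positivity)
      _ ≤ L * (C₁ * (101 ^ (n / r - s + n / q) * D ^ (n / r - s + n / q)) *
            (W * A * D ^ (n / t - n / p : ℝ))) := by
          rw [ENNReal.ofReal_mul (by norm_num), ENNReal.mul_rpow_of_ne_zero (by simp) hD0,
            show ENNReal.ofReal 101 = 101 by simp]
          gcongr
      _ = L * (C₁ * 101 ^ (n / r - s + n / q) * W) * A *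
            (D ^ (n / r - s + n / q) * D ^ (n / t - n / p : ℝ)) := by ring
      _ = _ := by
          rw [← ENNReal.rpow_add _ _ hD0 hDt]
          -- By n/r + n/t = n and n - s = α + β this is the relation between p and q.
          have : n / r - s + n / q + (n / t - n / p : ℝ) = 0 := by rw [hs]; linarith
          rw [this, ENNReal.rpow_zero, mul_one]
  have far : (∫⁻ x in Sᶜ, ‖commutator Ω α b a x‖ₑ ^ q) ^ (1 / q) ≤
      L * (C₂ * W * (C₃ * 100 ^ (n - (n - α - n / r) * q)) ^ (1 / q)) * A := by
    set Z := C₂ * L * D ^ β * (W * A * D ^ (n / t - n / p : ℝ)) with hZ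
    have pt : ∀ x ∈ Sᶜ, ‖commutator Ω α b a x‖ₑ ^ q ≤
        Z ^ q * ‖x - x₀‖ₑ ^ (-((n - α - n / r) * q)) := by
      intro x hx
      have hx' : 100 * d < ‖x - x₀‖ := by
        simpa [hS, dist_eq_norm] using hx
      have h2 := H₂ b hb x₀ d a hd ha.integrable ha.support_subset ha.integral_eq_zero x hx'
      calc ‖commutator Ω α b a x‖ₑ ^ q ≤ (Z * ‖x - x₀‖ₑ ^ (α - n + n / r)) ^ q := by
            refine ENNReal.rpow_le_rpow (h2.trans ?_) hq.le
            rw [hZ, mul_right_comm]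
            gcongr
        _ = _ := by
            rw [ENNReal.mul_rpow_of_nonneg _ _ hq.le, ← ENNReal.rpow_mul]
            congr 2; ring
    calc (∫⁻ x in Sᶜ, ‖commutator Ω α b a x‖ₑ ^ q) ^ (1 / q)
        ≤ (∫⁻ x in Sᶜ, Z ^ q * ‖x - x₀‖ₑ ^ (-((n - α - n / r) * q))) ^ (1 / q) :=
          ENNReal.rpow_le_rpow (setLIntegral_mono' measurableSet_closedBall.compl pt)
            (by positivity)
      _ = Z * (∫⁻ x in Sᶜ, ‖x - x₀‖ₑ ^ (-((n - α - n / r) * q))) ^ (1 / q) := by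
          rw [lintegral_const_mul _ (by fun_prop),
            ENNReal.mul_rpow_of_nonneg _ _ (by positivity), ← ENNReal.rpow_mul,
            mul_one_div_cancel hq.ne', ENNReal.rpow_one]
      _ ≤ Z * (C₃ * ENNReal.ofReal (100 * d) ^ (n - (n - α - n / r) * q)) ^ (1 / q) := by
          rw [hS, lintegral_norm_sub_rpow_compl]
          gcongr
          exact H₃ (100 * d) (by positivity)
      _ = Z * ((C₃ * 100 ^ (n - (n - α - n / r) * q)) ^ (1 / q) *
            D ^ (n / q - (n - α - n / r) : ℝ)) := by
          rw [ENNReal.ofReal_mul (by norm_num), ENNReal.mul_rpow_of_ne_zero (by simp) hD0,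
            ← mul_assoc, ENNReal.mul_rpow_of_nonneg _ _ (by positivity), ← ENNReal.rpow_mul]
          congr 3
          · simp
          · field_simp
      _ = L * (C₂ * W * (C₃ * 100 ^ (n - (n - α - n / r) * q)) ^ (1 / q)) * A *
          (D ^ β * D ^ (n / t - n / p : ℝ) * D ^ (n / q - (n - α - n / r) : ℝ)) := by
          rw [hZ]; ring
      _ = _ := by
          rw [← ENNReal.rpow_add _ _ hD0 hDt, ← ENNReal.rpow_add _ _ hD0 hDt]
          have : β + (n / t - n / p : ℝ) + (n / q - (n - α - n / r)) = 0 := by linarith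
          rw [this, ENNReal.rpow_zero, mul_one]
  rw [eLpNorm_ofReal _ hq, ← lintegral_add_compl _ (measurableSet_closedBall (x := x₀)
    (ε := 100 * d))]
  refine (rpow_add_le_two_rpow (by positivity) _ _).trans ?_
  calc _ ≤ 2 ^ (1 / q) * (L * (C₁ * 101 ^ (n / r - s + n / q) * W) * A +
        L * (C₂ * W * (C₃ * 100 ^ (n - (n - α - n / r) * q)) ^ (1 / q)) * A) := by
        gcongr
    _ = _ := by ring

/-! ### Summation of series in `L^q` -/

theorem rpow_tsum_le_tsum_rpow (g : ℕ → ℝ≥0∞) {p : ℝ} (hp0 : 0 < p) (hp1 : p ≤ 1) :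
    (∑' j, g j) ^ p ≤ ∑' j, g j ^ p := by
  have hfin : ∀ N : ℕ, (∑ j ∈ Finset.range N, g j) ^ p ≤ ∑' j, g j ^ p := by
    intro N
    refine le_trans ?_ (ENNReal.sum_le_tsum (Finset.range N))
    induction N with
    | zero => simp [hp0]
    | succ N ih =>
      rw [Finset.sum_range_succ, Finset.sum_range_succ]
      exact (ENNReal.rpow_add_le_add_rpow _ _ hp0.le hp1).trans (by gcongr)
  have hlim := (ENNReal.continuous_rpow_const (y := p)).continuousAt.tendsto.comp
    (ENNReal.tendsto_nat_tsum g)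
  exact le_of_tendsto' hlim hfin

theorem lintegral_Lp_tsum_le {X : Type*} [MeasurableSpace X] {μ : Measure X}
    {g : ℕ → X → ℝ≥0∞} (hg : ∀ j, AEMeasurable (g j) μ) {m : ℝ} (hm : 1 ≤ m) :
    (∫⁻ x, (∑' j, g j x) ^ m ∂μ) ^ (1 / m) ≤ ∑' j, (∫⁻ x, g j x ^ m ∂μ) ^ (1 / m) := by
  have hm0 : 0 < m := by linarith
  have hfin : ∀ N : ℕ, (∫⁻ x, (∑ j ∈ Finset.range N, g j x) ^ m ∂μ) ^ (1 / m) ≤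
      ∑' j, (∫⁻ x, g j x ^ m ∂μ) ^ (1 / m) := by
    intro N
    refine le_trans ?_ (ENNReal.sum_le_tsum (Finset.range N))
    induction N with
    | zero => simp [hm0]
    | succ N ih =>
      simp only [Finset.sum_range_succ]
      refine (ENNReal.lintegral_Lp_add_le (f := fun x => ∑ j ∈ Finset.range N, g j x)
        (Finset.aemeasurable_fun_sum _ fun j _ => hg j) (hg N) hm).trans ?_
      gcongr
  have hlim : Tendsto (fun N => ∫⁻ x, (∑ j ∈ Finset.range N, g j x) ^ m ∂μ) atTop
      (𝓝 (∫⁻ x, (∑' j, g j x) ^ m ∂μ)) := by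
    refine lintegral_tendsto_of_tendsto_of_monotone
      (fun N => (Finset.aemeasurable_fun_sum _ fun j _ => hg j).pow_const m) ?_ ?_
    · refine Eventually.of_forall fun x N N' h => ?_
      refine ENNReal.rpow_le_rpow ?_ hm0.le
      exact Finset.sum_le_sum_of_subset (Finset.range_mono h)
    · refine Eventually.of_forall fun x => ?_
      exact (ENNReal.continuous_rpow_const (y := m)).continuousAt.tendsto.comp
        (ENNReal.tendsto_nat_tsum _)
  exact le_of_tendsto' ((ENNReal.continuous_rpow_const (y := 1 / m)).continuousAt.tendsto.comp
    hlim) hfin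

/-- Subadditivity of the p-th power pointwise, then Minkowski in L^{q/p}, where q/p ≥ 1. This works
also when q < 1. -/
theorem lintegral_tsum_rpow_le {X : Type*} [MeasurableSpace X] {μ : Measure X}
    {g : ℕ → X → ℝ≥0∞} (hg : ∀ j, AEMeasurable (g j) μ) {p q : ℝ} (hp0 : 0 < p) (hp1 : p ≤ 1)
    (hpq : p ≤ q) :
    ((∫⁻ x, (∑' j, g j x) ^ q ∂μ) ^ (1 / q)) ^ p ≤
      ∑' j, ((∫⁻ x, g j x ^ q ∂μ) ^ (1 / q)) ^ p := by
  have hq : 0 < q := hp0.trans_le hpq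
  have h := lintegral_Lp_tsum_le (μ := μ) (g := fun j x => g j x ^ p)
    (fun j => (hg j).pow_const p) (m := q / p) (by rw [one_le_div hp0]; exact hpq)
  have e1 : ∀ a : ℝ≥0∞, (a ^ p) ^ (q / p) = a ^ q := fun a => by
    rw [← ENNReal.rpow_mul]; congr 1; field_simp
  have e2 : ∀ a : ℝ≥0∞, a ^ (1 / (q / p)) = (a ^ (1 / q)) ^ p := fun a => by
    rw [← ENNReal.rpow_mul]; congr 1; field_simp
  simp only [e1, e2] at h
  refine le_trans ?_ h
  gcongr with x
  rw [← e1]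
  exact ENNReal.rpow_le_rpow (rpow_tsum_le_tsum_rpow _ hp0 hp1) (by positivity)

/-- Only pointwise domination of S is asked for, so the same inequality serves sums of series and
differences of two such sums. -/
theorem eLpNorm_rpow_le_tsum {X : Type*} [MeasurableSpace X] {μ : Measure X}
    {u : ℕ → X → ℂ} (hu : ∀ j, AEStronglyMeasurable (u j) μ) {S : X → ℂ} {p q : ℝ} (hp0 : 0 < p)
    (hp1 : p ≤ 1) (hpq : p ≤ q) (hS : ∀ᵐ x ∂μ, ‖S x‖ₑ ≤ ∑' j, ‖u j x‖ₑ) :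
    eLpNorm S (ENNReal.ofReal q) μ ^ p ≤ ∑' j, eLpNorm (u j) (ENNReal.ofReal q) μ ^ p := by
  have hq : 0 < q := hp0.trans_le hpq
  simp only [eLpNorm_ofReal _ hq]
  refine le_trans ?_ (lintegral_tsum_rpow_le (fun j => (hu j).enorm) hp0 hp1 hpq)
  refine ENNReal.rpow_le_rpow (ENNReal.rpow_le_rpow (lintegral_mono_ae ?_) (by positivity)) hp0.le
  filter_upwards [hS] with x hx
  exact ENNReal.rpow_le_rpow hx hq.le

theorem ae_tsum_lt_top {X : Type*} [MeasurableSpace X] {μ : Measure X}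
    {g : ℕ → X → ℝ≥0∞} (hg : ∀ j, AEMeasurable (g j) μ) {p q : ℝ} (hp0 : 0 < p) (hp1 : p ≤ 1)
    (hpq : p ≤ q) (h : ∑' j, ((∫⁻ x, g j x ^ q ∂μ) ^ (1 / q)) ^ p < ∞) :
    ∀ᵐ x ∂μ, ∑' j, g j x < ∞ := by
  have hq : 0 < q := hp0.trans_le hpq
  have h1 := (lintegral_tsum_rpow_le hg hp0 hp1 hpq).trans_lt h
  rw [ENNReal.rpow_lt_top_iff_of_pos hp0, ENNReal.rpow_lt_top_iff_of_pos (by positivity)] at h1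
  filter_upwards [ae_lt_top' ((AEMeasurable.tsum hg).pow_const q) h1.ne] with x hx
  exact (ENNReal.rpow_lt_top_iff_of_pos hq).1 hx

/-! ### Mollification -/

/-- A smooth probability density supported in the unit ball. -/
noncomputable def unitBump (n : ℕ) : Rn n → ℝ :=
  (⟨1 / 2, 1, by norm_num, by norm_num⟩ : ContDiffBump (0 : Rn n)).normed volume

theorem unitBump_nonneg {n : ℕ} (x : Rn n) : 0 ≤ unitBump n x := ContDiffBump.nonneg_normed _ x

theorem contDiff_unitBump (n : ℕ) : ContDiff ℝ ((⊤ : ℕ∞) : WithTop ℕ∞) (unitBump n) :=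
  ContDiffBump.contDiff_normed _

theorem integral_unitBump (n : ℕ) : ∫ x, unitBump n x = 1 := ContDiffBump.integral_normed _

theorem hasCompactSupport_unitBump (n : ℕ) : HasCompactSupport (unitBump n) :=
  ContDiffBump.hasCompactSupport_normed _

theorem unitBump_eq_zero {n : ℕ} {x : Rn n} (hx : 1 ≤ ‖x‖) : unitBump n x = 0 := by
  by_contra h
  have : x ∈ Function.support (unitBump n) := h
  rw [unitBump, ContDiffBump.support_normed_eq] at this
  simp only [mem_ball, dist_zero_right] at this
  linarith

/-- The standard mollifier at scale `ε`. -/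
noncomputable def mollifier (n : ℕ) (ε : ℝ) (x : Rn n) : ℝ := (ε ^ n)⁻¹ * unitBump n (ε⁻¹ • x)

theorem mollifier_nonneg {n : ℕ} {ε : ℝ} (hε : 0 < ε) (x : Rn n) : 0 ≤ mollifier n ε x :=
  mul_nonneg (by positivity) (unitBump_nonneg _)

theorem contDiff_mollifier (n : ℕ) (ε : ℝ) :
    ContDiff ℝ ((⊤ : ℕ∞) : WithTop ℕ∞) (mollifier n ε) :=
  contDiff_const.mul ((contDiff_unitBump n).comp (contDiff_const_smul _))

theorem continuous_mollifier (n : ℕ) (ε : ℝ) : Continuous (mollifier n ε) :=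
  (contDiff_mollifier n ε).continuous

theorem mollifier_eq_zero {n : ℕ} {ε : ℝ} (hε : 0 < ε) {x : Rn n} (hx : ε ≤ ‖x‖) :
    mollifier n ε x = 0 := by
  rw [mollifier, unitBump_eq_zero, mul_zero]
  rw [norm_smul, norm_inv, Real.norm_of_nonneg hε.le, inv_mul_eq_div, le_div_iff₀ hε]
  linarith

theorem support_mollifier_subset {n : ℕ} {ε : ℝ} (hε : 0 < ε) :
    Function.support (mollifier n ε) ⊆ closedBall 0 ε := by
  intro x hx
  rw [mem_closedBall, dist_zero_right]
  by_contra h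
  exact hx (mollifier_eq_zero hε (le_of_not_ge h))

theorem hasCompactSupport_mollifier {n : ℕ} {ε : ℝ} (hε : 0 < ε) :
    HasCompactSupport (mollifier n ε) :=
  HasCompactSupport.intro (isCompact_closedBall 0 ε) fun x hx => by
    by_contra h
    exact hx (support_mollifier_subset hε h)

theorem integral_mollifier {n : ℕ} {ε : ℝ} (hε : 0 < ε) : ∫ x, mollifier n ε x = 1 := by
  simp only [mollifier]
  rw [integral_const_mul, Measure.integral_comp_inv_smul_of_nonneg _ _ hε.le, integral_unitBump,
    finrank_euclideanSpace_fin, smul_eq_mul, mul_one, inv_mul_cancel₀ (by positivity)]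

theorem integrable_mollifier {n : ℕ} {ε : ℝ} (hε : 0 < ε) : Integrable (mollifier n ε) :=
  (continuous_mollifier n ε).integrable_of_hasCompactSupport (hasCompactSupport_mollifier hε)

theorem lintegral_mollifier {n : ℕ} {ε : ℝ} (hε : 0 < ε) :
    ∫⁻ x, ENNReal.ofReal (mollifier n ε x) = 1 := by
  rw [← ofReal_integral_eq_lintegral_ofReal (integrable_mollifier hε)
    (Eventually.of_forall (mollifier_nonneg hε)), integral_mollifier hε, ENNReal.ofReal_one]

theorem exists_mollifier_sub_le (n : ℕ) : ∃ K : ℝ, 0 ≤ K ∧ ∀ ε : ℝ, 0 < ε → ∀ x y : Rn n,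
    |mollifier n ε x - mollifier n ε y| ≤ K * (ε ^ n)⁻¹ * ε⁻¹ * ‖x - y‖ := by
  obtain ⟨K, hK⟩ := (contDiff_unitBump n).lipschitzWith_of_hasCompactSupport
    (hasCompactSupport_unitBump n) (by simp)
  refine ⟨K, K.2, fun ε hε x y => ?_⟩
  have h := hK.dist_le_mul (ε⁻¹ • x) (ε⁻¹ • y)
  rw [Real.dist_eq, dist_eq_norm, ← smul_sub, norm_smul, norm_inv, Real.norm_of_nonneg hε.le] at h
  rw [mollifier, mollifier, ← mul_sub, abs_mul, abs_of_pos (by positivity : 0 < (ε ^ n)⁻¹)]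
  calc _ ≤ (ε ^ n)⁻¹ * (K * (ε⁻¹ * ‖x - y‖)) := by gcongr
    _ = _ := by ring

/-- The mollification of `f` at scale `ε`. -/
noncomputable def mollify {n : ℕ} (ε : ℝ) (f : Rn n → ℂ) : Rn n → ℂ :=
  convolution (mollifier n ε) f (ContinuousLinearMap.lsmul ℝ ℝ) volume

theorem mollify_apply {n : ℕ} (ε : ℝ) (f : Rn n → ℂ) (y : Rn n) :
    mollify ε f y = ∫ z, mollifier n ε z • f (y - z) := rfl

theorem mollify_apply_swap {n : ℕ} (ε : ℝ) (f : Rn n → ℂ) (y : Rn n) :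
    mollify ε f y = ∫ z, mollifier n ε (y - z) • f z := by
  rw [mollify_apply, ← integral_sub_left_eq_self _ volume y]
  simp

theorem continuous_mollify {n : ℕ} {ε : ℝ} (hε : 0 < ε) {f : Rn n → ℂ}
    (hf : LocallyIntegrable f) : Continuous (mollify ε f) :=
  (hasCompactSupport_mollifier hε).continuous_convolution_left _ (continuous_mollifier n ε) hf

theorem integrable_mollifier_smul {n : ℕ} {ε : ℝ} (hε : 0 < ε) {f : Rn n → ℂ}
    (hf : LocallyIntegrable f) (y : Rn n) :
    Integrable fun z => mollifier n ε z • f (y - z) :=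
  (hasCompactSupport_mollifier hε).convolutionExists_left
    (ContinuousLinearMap.lsmul ℝ ℝ) (continuous_mollifier n ε) hf y

theorem enorm_integral_mollifier_rpow_le {n : ℕ} {ε ℓ : ℝ} (hε : 0 < ε) (hℓ : 1 ≤ ℓ)
    {g : Rn n → ℂ} (hg : AEStronglyMeasurable g volume) :
    ‖∫ z, mollifier n ε z • g z‖ₑ ^ ℓ ≤
      ∫⁻ z, ‖g z‖ₑ ^ ℓ * ENNReal.ofReal (mollifier n ε z) := by
  have hm : Measurable fun z => ENNReal.ofReal (mollifier n ε z) :=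
    (continuous_mollifier n ε).measurable.ennreal_ofReal
  have h := rpow_lintegral_mul_le (μ := (volume : Measure (Rn n))) hg.enorm hm.aemeasurable
    one_pos hℓ
  simp only [ENNReal.rpow_one, div_one, lintegral_mollifier hε, ENNReal.one_rpow, mul_one] at h
  refine le_trans (ENNReal.rpow_le_rpow ?_ (by linarith)) h
  refine (enorm_integral_le_lintegral_enorm _).trans (le_of_eq (lintegral_congr fun z => ?_))
  rw [enorm_smul, mul_comm, Real.enorm_eq_ofReal (mollifier_nonneg hε z)]

theorem aestronglyMeasurable_comp_sub_left {n : ℕ} {f : Rn n → ℂ}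
    (hf : AEStronglyMeasurable f volume) (y : Rn n) :
    AEStronglyMeasurable (fun z => f (y - z)) volume :=
  hf.comp_measurePreserving (Measure.measurePreserving_sub_left volume y)

theorem aestronglyMeasurable_comp_sub_prod {n : ℕ} {f : Rn n → ℂ}
    (hf : AEStronglyMeasurable f volume) :
    AEStronglyMeasurable (fun w : Rn n × Rn n => f (w.1 - w.2)) (volume.prod volume) :=
  hf.comp_quasiMeasurePreserving (quasiMeasurePreserving_sub_of_right_invariant volume volume)

theorem lintegral_mollify_rpow_le {n : ℕ} {ε ℓ : ℝ} (hε : 0 < ε) (hℓ : 1 ≤ ℓ)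
    {f : Rn n → ℂ} (hf : AEStronglyMeasurable f volume) :
    ∫⁻ y, ‖mollify ε f y‖ₑ ^ ℓ ≤ ∫⁻ y, ‖f y‖ₑ ^ ℓ := by
  have hm : Measurable fun z => ENNReal.ofReal (mollifier n ε z) :=
    (continuous_mollifier n ε).measurable.ennreal_ofReal
  have hm2 : AEMeasurable (fun w : Rn n × Rn n => ‖f (w.1 - w.2)‖ₑ ^ ℓ *
      ENNReal.ofReal (mollifier n ε w.2)) (volume.prod volume) :=
    ((aestronglyMeasurable_comp_sub_prod hf).enorm.pow_const ℓ).mul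
      (hm.comp measurable_snd).aemeasurable
  calc ∫⁻ y, ‖mollify ε f y‖ₑ ^ ℓ
      ≤ ∫⁻ y, ∫⁻ z, ‖f (y - z)‖ₑ ^ ℓ * ENNReal.ofReal (mollifier n ε z) :=
        lintegral_mono fun y => enorm_integral_mollifier_rpow_le hε hℓ
          (aestronglyMeasurable_comp_sub_left hf y)
    _ = ∫⁻ z, ∫⁻ y, ‖f (y - z)‖ₑ ^ ℓ * ENNReal.ofReal (mollifier n ε z) :=
        lintegral_lintegral_swap hm2
    _ = ∫⁻ z, (∫⁻ y, ‖f y‖ₑ ^ ℓ) * ENNReal.ofReal (mollifier n ε z) := by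
        refine lintegral_congr fun z => ?_
        rw [lintegral_mul_const' _ _ ENNReal.ofReal_ne_top,
          lintegral_sub_right_eq_self (fun y => ‖f y‖ₑ ^ ℓ) z]
    _ = ∫⁻ y, ‖f y‖ₑ ^ ℓ := by
        rw [lintegral_const_mul _ hm, lintegral_mollifier hε, mul_one]

theorem lintegral_mollify_sub_rpow_le {n : ℕ} {ε ℓ : ℝ} (hε : 0 < ε) (hℓ : 1 ≤ ℓ)
    {f : Rn n → ℂ} (hf : LocallyIntegrable f) {η : ℝ≥0∞}
    (hη : ∀ z : Rn n, ‖z‖ ≤ ε → ∫⁻ y, ‖f (y - z) - f y‖ₑ ^ ℓ ≤ η) :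
    ∫⁻ y, ‖mollify ε f y - f y‖ₑ ^ ℓ ≤ η := by
  have hfm := hf.aestronglyMeasurable
  have hm : Measurable fun z => ENNReal.ofReal (mollifier n ε z) :=
    (continuous_mollifier n ε).measurable.ennreal_ofReal
  have hm2 : AEMeasurable (fun w : Rn n × Rn n => ‖f (w.1 - w.2) - f w.1‖ₑ ^ ℓ *
      ENNReal.ofReal (mollifier n ε w.2)) (volume.prod volume) :=
    (((aestronglyMeasurable_comp_sub_prod hfm).sub hfm.comp_fst).enorm.pow_const ℓ).mul
      (hm.comp measurable_snd).aemeasurable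
  have e : ∀ y, mollify ε f y - f y = ∫ z, mollifier n ε z • (f (y - z) - f y) := by
    intro y
    simp only [smul_sub]
    rw [integral_sub (integrable_mollifier_smul hε hf y) ((integrable_mollifier hε).smul_const _),
      integral_smul_const, integral_mollifier hε, one_smul, mollify_apply]
  calc ∫⁻ y, ‖mollify ε f y - f y‖ₑ ^ ℓ
      ≤ ∫⁻ y, ∫⁻ z, ‖f (y - z) - f y‖ₑ ^ ℓ * ENNReal.ofReal (mollifier n ε z) := by
        refine lintegral_mono fun y => ?_
        rw [e]
        exact enorm_integral_mollifier_rpow_le hε hℓ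
          ((aestronglyMeasurable_comp_sub_left hfm y).sub aestronglyMeasurable_const)
    _ = ∫⁻ z, ∫⁻ y, ‖f (y - z) - f y‖ₑ ^ ℓ * ENNReal.ofReal (mollifier n ε z) :=
        lintegral_lintegral_swap hm2
    _ ≤ ∫⁻ z, η * ENNReal.ofReal (mollifier n ε z) := by
        refine lintegral_mono fun z => ?_
        rw [lintegral_mul_const' _ _ ENNReal.ofReal_ne_top]
        by_cases hz : ‖z‖ ≤ ε
        · gcongr; exact hη z hz
        · simp [mollifier_eq_zero hε (le_of_not_ge hz)]
    _ = η := by rw [lintegral_const_mul _ hm, lintegral_mollifier hε, mul_one]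

/-- Translations act continuously on L^ℓ for finite ℓ ≥ 1; the action of `DomAddAct` expresses this.
-/
theorem tendsto_lintegral_translate_sub {n : ℕ} {ℓ : ℝ} (hℓ : 1 ≤ ℓ) {f : Rn n → ℂ}
    (hf : MemLp f (ENNReal.ofReal ℓ) volume) :
    Tendsto (fun z : Rn n => ∫⁻ y, ‖f (y - z) - f y‖ₑ ^ ℓ) (𝓝 0) (𝓝 0) := by
  have hℓ0 : 0 < ℓ := by linarith
  have : Fact (1 ≤ ENNReal.ofReal ℓ) := ⟨by simpa using ENNReal.ofReal_le_ofReal hℓ⟩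
  have : Fact (ENNReal.ofReal ℓ ≠ ∞) := ⟨ENNReal.ofReal_ne_top⟩
  set F : Lp ℂ (ENNReal.ofReal ℓ) (volume : Measure (Rn n)) := hf.toLp f with hF
  have hcont : Continuous fun z : Rn n => DomAddAct.mk (-z) +ᵥ F := by
    have h1 : Continuous fun z : Rn n => DomAddAct.mk (-z) :=
      DomAddAct.continuous_mk.comp continuous_neg
    exact h1.vadd continuous_const
  have h0 : Tendsto (fun z : Rn n => edist (DomAddAct.mk (-z) +ᵥ F) F) (𝓝 0) (𝓝 0) := by
    have := (hcont.edist (continuous_const (y := F))).tendsto (0 : Rn n)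
    simpa using this
  have h1 : ∀ z : Rn n, ∫⁻ y, ‖f (y - z) - f y‖ₑ ^ ℓ
      = edist (DomAddAct.mk (-z) +ᵥ F) F ^ ℓ := by
    intro z
    rw [hF, DomAddAct.mk_vadd_toLp, Lp.edist_toLp_toLp, eLpNorm_ofReal _ hℓ0, ← ENNReal.rpow_mul,
      one_div_mul_cancel hℓ0.ne', ENNReal.rpow_one]
    refine lintegral_congr fun y => ?_
    simp [sub_eq_neg_add]
  simp only [h1]
  have := (ENNReal.continuous_rpow_const (y := ℓ)).continuousAt.tendsto.comp h0
  simpa [hℓ0, Function.comp_def] using this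

theorem tendsto_lintegral_mollify_sub {n : ℕ} {ℓ : ℝ} (hℓ : 1 ≤ ℓ) {f : Rn n → ℂ}
    (hf : MemLp f (ENNReal.ofReal ℓ) volume) {ε : ℕ → ℝ} (hε : ∀ k, 0 < ε k)
    (hε0 : Tendsto ε atTop (𝓝 0)) :
    Tendsto (fun k => ∫⁻ y, ‖mollify (ε k) f y - f y‖ₑ ^ ℓ) atTop (𝓝 0) := by
  have hloc : LocallyIntegrable f := hf.locallyIntegrable
    (by simpa using ENNReal.ofReal_le_ofReal hℓ)
  refine ENNReal.tendsto_nhds_zero.2 fun η hη => ?_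
  have h1 := ENNReal.tendsto_nhds_zero.1 (tendsto_lintegral_translate_sub hℓ hf) η hη
  obtain ⟨δ, hδ, h2⟩ := Metric.eventually_nhds_iff.1 h1
  filter_upwards [hε0.eventually (gt_mem_nhds hδ)] with k hk
  refine lintegral_mollify_sub_rpow_le (hε k) hℓ hloc fun z hz => h2 ?_
  rw [dist_zero_right]
  exact hz.trans_lt hk

theorem IsAtomOn.support_mollify_subset {n : ℕ} {p : ℝ} {A : ℝ≥0∞} {x₀ : Rn n} {d : ℝ}
    {a : Rn n → ℂ} (ha : IsAtomOn p A x₀ d a) {ε : ℝ} (hε : 0 < ε) :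
    Function.support (mollify ε a) ⊆ closedBall x₀ (2 * max d ε) := by
  refine (support_convolution_subset _).trans ?_
  rintro _ ⟨z, hz, w, hw, rfl⟩
  have hz' := support_mollifier_subset hε hz
  have hw' := ha.support_subset hw
  rw [mem_closedBall, dist_eq_norm] at hz' hw' ⊢
  rw [sub_zero] at hz'
  have : z + w - x₀ = z + (w - x₀) := by abel
  simp only [this]
  linarith [norm_add_le z (w - x₀), le_max_left d ε, le_max_right d ε]

/-- The vanishing mean allows φ_ε(y - x₀) to be subtracted from φ_ε(y - z). The mollifier has
Lipschitz constant of order ε^{-n-1}, which gains a factor d/ε over the trivial bound. -/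
theorem exists_enorm_mollify_atom_le (n : ℕ) : ∃ K : ℝ≥0∞, K ≠ ∞ ∧
    ∀ (p : ℝ) (A : ℝ≥0∞) (x₀ : Rn n) (d : ℝ) (a : Rn n → ℂ), IsAtomOn p A x₀ d a →
      ∀ ε : ℝ, 0 < ε → ∀ y, ‖mollify ε a y‖ₑ ≤
        K * A * ENNReal.ofReal ε ^ (-(n : ℝ) - 1) * ENNReal.ofReal d ^ (1 + n - n / p : ℝ) := by
  obtain ⟨K, hK0, hK⟩ := exists_mollifier_sub_le n
  set W : ℝ≥0∞ := volume (closedBall (0 : Rn n) 1) ^ (1 / 1 - 1 / 2 : ℝ) with hW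
  have hWt : W ≠ ∞ := ENNReal.rpow_ne_top_of_nonneg (by norm_num) measure_closedBall_lt_top.ne
  refine ⟨ENNReal.ofReal K * W, ENNReal.mul_ne_top ENNReal.ofReal_ne_top hWt, ?_⟩
  intro p A x₀ d a ha ε hε y
  have hd := ha.radius_pos
  have hloc : LocallyIntegrable a := ha.integrable.locallyIntegrable
  have hi : Integrable fun z => mollifier n ε (y - z) • a z := by
    have := (integrable_mollifier_smul hε hloc y).comp_sub_left y
    simpa using this
  have e1 : mollify ε a y =
      ∫ z, (mollifier n ε (y - z) - mollifier n ε (y - x₀)) • a z := by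
    have hi2 : Integrable fun z => mollifier n ε (y - x₀) • a z :=
      ha.integrable.smul (mollifier n ε (y - x₀))
    simp only [sub_smul]
    rw [integral_sub hi hi2, integral_smul, ha.integral_eq_zero, smul_zero,
      sub_zero, mollify_apply_swap]
  have hE0 : ENNReal.ofReal ε ≠ 0 := by simpa using hε
  have hD0 : ENNReal.ofReal d ≠ 0 := by simpa using hd
  have h1 : ∫⁻ z, ‖a z‖ₑ ≤ W * A * ENNReal.ofReal d ^ (n - n / p : ℝ) := by
    have h0 := ha.lintegral_rpow_le one_pos (by norm_num : (1 : ℝ) ≤ 2)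
    rw [div_one (n : ℝ), one_div_one, ENNReal.rpow_one] at h0
    simpa only [ENNReal.rpow_one, hW, div_one] using h0
  rw [e1]
  calc _ ≤ ∫⁻ z, ‖(mollifier n ε (y - z) - mollifier n ε (y - x₀)) • a z‖ₑ :=
        enorm_integral_le_lintegral_enorm _
    _ ≤ ∫⁻ z, ENNReal.ofReal (K * (ε ^ n)⁻¹ * ε⁻¹ * d) * ‖a z‖ₑ := by
        refine lintegral_mono fun z => ?_
        by_cases hz : a z = 0
        · simp [hz]
        have hz' := ha.support_subset hz
        rw [mem_closedBall, dist_eq_norm] at hz'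
        rw [enorm_smul]
        gcongr
        rw [← ofReal_norm, Real.norm_eq_abs]
        refine ENNReal.ofReal_le_ofReal ((hK ε hε _ _).trans ?_)
        gcongr
        rw [sub_sub_sub_cancel_left, norm_sub_rev]
        exact hz'
    _ = ENNReal.ofReal (K * (ε ^ n)⁻¹ * ε⁻¹ * d) * ∫⁻ z, ‖a z‖ₑ :=
        lintegral_const_mul' _ _ ENNReal.ofReal_ne_top
    _ ≤ ENNReal.ofReal (K * (ε ^ n)⁻¹ * ε⁻¹ * d) *
          (W * A * ENNReal.ofReal d ^ (n - n / p : ℝ)) := by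
        gcongr
    _ = ENNReal.ofReal K * W * A * ENNReal.ofReal ε ^ (-(n : ℝ) - 1) *
          (ENNReal.ofReal d ^ (1 : ℝ) * ENNReal.ofReal d ^ (n - n / p : ℝ)) := by
        have e2 : ENNReal.ofReal (K * (ε ^ n)⁻¹ * ε⁻¹ * d) =
            ENNReal.ofReal K * ENNReal.ofReal ε ^ (-(n : ℝ) - 1) * ENNReal.ofReal d := by
          rw [ENNReal.ofReal_mul (by positivity), mul_assoc K, ENNReal.ofReal_mul hK0]
          congr 2
          rw [ENNReal.ofReal_rpow_of_pos hε, Real.rpow_sub hε, Real.rpow_neg hε.le,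
            Real.rpow_natCast, Real.rpow_one, div_eq_mul_inv]
        rw [e2, ENNReal.rpow_one]
        ring
    _ = _ := by
        rw [← ENNReal.rpow_add _ _ hD0 ENNReal.ofReal_ne_top]
        congr 2; ring

/-- If ε ≤ d, mollification at most doubles the support and does not increase the L² norm. If ε > d,
the pointwise bound carries d to the power 1 + n - n/p; this power is positive since n/p < n + 1, so
d may be replaced by ε, and what remains is the size of an atom at scale ε. -/
theorem exists_isAtomOn_mollify {n : ℕ} {p : ℝ}
    (hsm : (n : ℝ) / p < n + 1) :
    ∃ C : ℝ≥0∞, C ≠ ∞ ∧ ∀ (A : ℝ≥0∞) (x₀ : Rn n) (d : ℝ) (a : Rn n → ℂ), IsAtomOn p A x₀ d a →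
      ∀ ε : ℝ, 0 < ε → IsAtomOn p (C * A) x₀ (2 * max d ε) (mollify ε a) := by
  obtain ⟨K, hK, H⟩ := exists_enorm_mollify_atom_le n
  set V : ℝ≥0∞ := volume (closedBall (0 : Rn n) 1) ^ (1 / 2 : ℝ) with hV
  have hVt : V ≠ ∞ := ENNReal.rpow_ne_top_of_nonneg (by norm_num) measure_closedBall_lt_top.ne
  have h2t : ∀ e : ℝ, (2 : ℝ≥0∞) ^ e ≠ ∞ := fun e =>
    ENNReal.rpow_ne_top_of_ne_zero (by simp) (by simp)
  refine ⟨2 ^ (n / p - n / 2 : ℝ) + K * V * 2 ^ (n / p : ℝ), ENNReal.add_ne_top.2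
    ⟨h2t _, ENNReal.mul_ne_top (ENNReal.mul_ne_top hK hVt) (h2t _)⟩, ?_⟩
  intro A x₀ d a ha ε hε
  have hd := ha.radius_pos
  have hloc : LocallyIntegrable a := ha.integrable.locallyIntegrable
  have hcont := continuous_mollify hε hloc
  have hsupp := ha.support_mollify_subset hε
  have hnorm : eLpNorm (mollify ε a) 2 volume ≤ eLpNorm a 2 volume := by
    rw [eLpNorm_two, eLpNorm_two]
    exact ENNReal.rpow_le_rpow (lintegral_mollify_rpow_le hε (by norm_num) ha.memLp.1)
      (by norm_num)
  refine ⟨by positivity, ⟨hcont.aestronglyMeasurable, hnorm.trans_lt ha.memLp.2⟩, hsupp, ?_, ?_⟩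
  · have hmax : 0 < max d ε := lt_max_of_lt_left hd
    rcases le_or_gt ε d with hεd | hdε
    · rw [max_eq_left hεd, ENNReal.ofReal_mul (by norm_num)]
      have hD0 : ENNReal.ofReal d ≠ 0 := by simpa using hd
      rw [ENNReal.mul_rpow_of_ne_zero (by simp) hD0, show ENNReal.ofReal 2 = 2 by simp]
      calc _ ≤ A * ENNReal.ofReal d ^ ((n : ℝ) / 2 - n / p) := hnorm.trans ha.norm_le
        _ = (2 ^ (n / p - n / 2 : ℝ) * 2 ^ ((n : ℝ) / 2 - n / p)) * A *
            ENNReal.ofReal d ^ ((n : ℝ) / 2 - n / p) := by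
            rw [← ENNReal.rpow_add _ _ (by simp) (by simp)]
            simp
        _ ≤ (2 ^ (n / p - n / 2 : ℝ) + K * V * 2 ^ (n / p : ℝ)) *
            2 ^ ((n : ℝ) / 2 - n / p) * A * ENNReal.ofReal d ^ ((n : ℝ) / 2 - n / p) := by
            gcongr
            exact le_self_add
        _ = _ := by ring
    · rw [max_eq_right hdε.le] at hsupp ⊢
      set E := ENNReal.ofReal ε with hE
      have hE0 : E ≠ 0 := by simpa [hE] using hε
      have hEt : E ≠ ∞ := ENNReal.ofReal_ne_top
      have hpt : ∀ y, ‖mollify ε a y‖ₑ ≤ K * A * E ^ (-(n / p) : ℝ) := by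
        intro y
        refine (H p A x₀ d a ha ε hε y).trans ?_
        calc _ ≤ K * A * E ^ (-(n : ℝ) - 1) * E ^ (1 + n - n / p : ℝ) := by
              gcongr
              · linarith
              · exact ENNReal.ofReal_le_ofReal hdε.le
          _ = _ := by
              rw [mul_assoc, ← ENNReal.rpow_add _ _ hE0 hEt]
              congr 2; ring
      have h2E : ENNReal.ofReal (2 * ε) = 2 * E := by
        rw [ENNReal.ofReal_mul (by norm_num), show ENNReal.ofReal 2 = 2 by simp]
      rw [eLpNorm_two]
      calc (∫⁻ y, ‖mollify ε a y‖ₑ ^ (2 : ℝ)) ^ (1 / 2 : ℝ)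
          = (∫⁻ y in closedBall x₀ (2 * ε), ‖mollify ε a y‖ₑ ^ (2 : ℝ)) ^ (1 / 2 : ℝ) := by
            congr 1
            refine (setLIntegral_eq_of_support_subset fun y hy => hsupp fun h0 => hy ?_).symm
            simp [h0]
        _ ≤ (∫⁻ y in closedBall x₀ (2 * ε), (K * A * E ^ (-(n / p) : ℝ)) ^ (2 : ℝ)) ^
              (1 / 2 : ℝ) := by
            gcongr with y
            exact hpt y
        _ = K * A * E ^ (-(n / p) : ℝ) * (V * (2 * E) ^ (n / 2 : ℝ)) := by
            rw [setLIntegral_const, ENNReal.mul_rpow_of_nonneg _ _ (by norm_num),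
              ← ENNReal.rpow_mul, volume_closedBall_rpow x₀ (by positivity), h2E]
            norm_num [hV, div_eq_mul_inv]
        _ = K * V * 2 ^ (n / p : ℝ) * A * (2 * E) ^ ((n : ℝ) / 2 - n / p) := by
            have e3 : (2 * E) ^ ((n : ℝ) / 2 - n / p) =
                (2 * E) ^ (n / 2 : ℝ) * (2 ^ (-(n / p) : ℝ) * E ^ (-(n / p) : ℝ)) := by
              rw [← ENNReal.mul_rpow_of_ne_zero (by simp) hE0, ← ENNReal.rpow_add _ _ (by simp [hE0])
                (ENNReal.mul_ne_top (by simp) hEt), sub_eq_add_neg]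
            have e4 : (2 : ℝ≥0∞) ^ (n / p : ℝ) * 2 ^ (-(n / p) : ℝ) = 1 := by
              rw [← ENNReal.rpow_add _ _ (by simp) (by simp), add_neg_cancel, ENNReal.rpow_zero]
            rw [e3]
            calc _ = K * V * 1 * A * ((2 * E) ^ (n / 2 : ℝ) * E ^ (-(n / p) : ℝ)) := by ring
              _ = _ := by rw [← e4]; ring
        _ ≤ _ := by
            rw [h2E]
            gcongr
            exact le_add_self
  · have := integral_convolution (ContinuousLinearMap.lsmul ℝ ℝ) (integrable_mollifier (n := n) hε)
      ha.integrable
    rw [ha.integral_eq_zero, map_zero] at this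
    exact this

/-- The mollification as a pairing with a Schwartz function. -/
theorem exists_schwartz_mollifier {n : ℕ} {ε : ℝ} (hε : 0 < ε) (y : Rn n) :
    ∃ φ : 𝓢(Rn n, ℂ), ∀ f : Rn n → ℂ, ∫ x, f x * φ x = mollify ε f y := by
  have hc : HasCompactSupport fun z : Rn n => ((mollifier n ε (y - z) : ℝ) : ℂ) := by
    refine HasCompactSupport.intro (isCompact_closedBall y ε) fun z hz => ?_
    rw [mollifier_eq_zero hε]
    · simp
    · rw [mem_closedBall, not_le, dist_comm, dist_eq_norm] at hz
      exact hz.le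
  have hs : ContDiff ℝ ((⊤ : ℕ∞) : WithTop ℕ∞)
      fun z : Rn n => ((mollifier n ε (y - z) : ℝ) : ℂ) :=
    Complex.ofRealCLM.contDiff.comp
      ((contDiff_mollifier n ε).comp (contDiff_const.sub contDiff_id))
  refine ⟨hc.toSchwartzMap hs, fun f => ?_⟩
  rw [mollify_apply_swap]
  refine integral_congr_ae (Eventually.of_forall fun z => ?_)
  simp [mul_comm]

/-! ### The commutator on `L^ℓ` -/

/-- The exponents `ℓ` for which the commutator is locally bounded from `L^ℓ` to `L^q`. -/
structure Admissible (n : ℕ) (t s ℓ : ℝ) : Prop where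
  one_lt : 1 < ℓ
  le : t ≤ ℓ
  lt : n < s * ℓ.conjExponent

theorem ae_of_forall_ball {n : ℕ} {P : Rn n → Prop}
    (h : ∀ R : ℝ, 0 < R → ∀ᵐ x ∂volume.restrict (ball (0 : Rn n) R), P x) : ∀ᵐ x, P x := by
  have := (ae_restrict_iUnion_iff (μ := (volume : Measure (Rn n)))
    (fun k : ℕ => ball (0 : Rn n) (k + 1)) P).2 fun k => h _ (by positivity)
  rwa [iUnion_ball_nat_succ, Measure.restrict_univ] at this

theorem Exponents.exists_absOp_bound {n : ℕ} {α β p q r t Q s ℓ : ℝ}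
    (h : Exponents n α β p q r t Q s) {Ω : Rn n → Rn n → ℂ} (hΩ : IsKernel r Ω)
    (hℓ : Admissible n t s ℓ) {R : ℝ} (hR : 0 < R) :
    ∃ C : ℝ≥0∞, C ≠ ∞ ∧ ∀ f : Rn n → ℂ, AEStronglyMeasurable f volume →
      (∫⁻ x in ball 0 R, absOp Ω s f x ^ q) ^ (1 / q) ≤
        C * eLpNorm f (ENNReal.ofReal ℓ) volume := by
  obtain ⟨C, hC, H⟩ := exists_absOp_local_bound h.one_le_n h.conj h.q_pos h.q_le h.t_le h.s_lt
    (Real.HolderConjugate.conjExponent hℓ.one_lt).symm hℓ.le hℓ.lt hΩ hR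
  refine ⟨C, hC, fun f hf => ?_⟩
  rw [eLpNorm_ofReal _ (zero_lt_one.trans hℓ.one_lt)]
  exact H f hf

theorem Exponents.ae_absOp_lt_top {n : ℕ} {α β p q r t Q s ℓ : ℝ}
    (h : Exponents n α β p q r t Q s) {Ω : Rn n → Rn n → ℂ} (hΩ : IsKernel r Ω)
    (hℓ : Admissible n t s ℓ) {f : Rn n → ℂ} (hf : MemLp f (ENNReal.ofReal ℓ) volume) :
    ∀ᵐ x, absOp Ω s f x < ∞ := by
  refine ae_of_forall_ball fun R hR => ?_
  obtain ⟨C, hC, H⟩ := h.exists_absOp_bound hΩ hℓ hR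
  have h1 := (H f hf.1).trans_lt (ENNReal.mul_lt_top hC.lt_top hf.2)
  rw [ENNReal.rpow_lt_top_iff_of_pos (by have := h.q_pos; positivity)] at h1
  filter_upwards [ae_lt_top' ((aemeasurable_absOp hΩ s hf.1).restrict.pow_const q) h1.ne]
    with x hx
  exact (ENNReal.rpow_lt_top_iff_of_pos h.q_pos).1 hx

theorem aestronglyMeasurable_commutatorIntegrand_prod {n : ℕ} {r β : ℝ} {Ω : Rn n → Rn n → ℂ}
    (hΩ : IsKernel r Ω) (α : ℝ) (hβ : 0 < β) {b : Rn n → ℂ} (hb : lipNorm β b < ∞)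
    {f : Rn n → ℂ} (hf : AEStronglyMeasurable f volume) :
    AEStronglyMeasurable (fun w : Rn n × Rn n => commutatorIntegrand Ω α b f w.1 w.2)
      (volume.prod volume) := by
  have hb' := (continuous_of_lipNorm hβ hb).measurable
  have h1 : Measurable fun w : Rn n × Rn n => Ω w.1 (w.1 - w.2) :=
    hΩ.measurable.comp (measurable_fst.prodMk (measurable_fst.sub measurable_snd))
  have h2 : Measurable fun w : Rn n × Rn n => Ω w.1 (w.1 - w.2) /
      ((‖w.1 - w.2‖ ^ ((n : ℝ) - α) : ℝ) : ℂ) * (b w.1 - b w.2) :=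
    (h1.div (Complex.measurable_ofReal.comp (by fun_prop))).mul
      ((hb'.comp measurable_fst).sub (hb'.comp measurable_snd))
  exact h2.aestronglyMeasurable.mul hf.comp_snd

theorem aestronglyMeasurable_commutatorIntegrand {n : ℕ} {r β : ℝ} {Ω : Rn n → Rn n → ℂ}
    (hΩ : IsKernel r Ω) (α : ℝ) (hβ : 0 < β) {b : Rn n → ℂ} (hb : lipNorm β b < ∞)
    {f : Rn n → ℂ} (hf : AEStronglyMeasurable f volume) (x : Rn n) :
    AEStronglyMeasurable (commutatorIntegrand Ω α b f x) volume := by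
  have hb' := (continuous_of_lipNorm hβ hb).measurable
  have h1 : Measurable fun y : Rn n => Ω x (x - y) :=
    (hΩ.measurable_right x).comp (measurable_const.sub measurable_id)
  have h2 : Measurable fun y : Rn n => Ω x (x - y) /
      ((‖x - y‖ ^ ((n : ℝ) - α) : ℝ) : ℂ) * (b x - b y) :=
    (h1.div (Complex.measurable_ofReal.comp (by fun_prop))).mul (measurable_const.sub hb')
  exact h2.aestronglyMeasurable.mul hf

theorem aestronglyMeasurable_commutator {n : ℕ} {r β : ℝ} {Ω : Rn n → Rn n → ℂ}
    (hΩ : IsKernel r Ω) (α : ℝ) (hβ : 0 < β) {b : Rn n → ℂ} (hb : lipNorm β b < ∞)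
    {f : Rn n → ℂ} (hf : AEStronglyMeasurable f volume) :
    AEStronglyMeasurable (commutator Ω α b f) volume :=
  (aestronglyMeasurable_commutatorIntegrand_prod hΩ α hβ hb hf).integral_prod_right'

theorem integrable_commutatorIntegrand {n : ℕ} {r α β s : ℝ} {Ω : Rn n → Rn n → ℂ}
    (hΩ : IsKernel r Ω) (hs : s = n - α - β) (hβ : 0 < β) {b : Rn n → ℂ} (hb : lipNorm β b < ∞)
    {f : Rn n → ℂ} (hf : AEStronglyMeasurable f volume) {x : Rn n} (hx : absOp Ω s f x < ∞) :
    Integrable (commutatorIntegrand Ω α b f x) := by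
  refine ⟨aestronglyMeasurable_commutatorIntegrand hΩ α hβ hb hf x, ?_⟩
  refine (lintegral_mono fun y => enorm_commutatorIntegrand_le hs b f x y).trans_lt ?_
  rw [lintegral_const_mul' _ _ hb.ne]
  exact ENNReal.mul_lt_top hb hx

theorem Exponents.ae_integrable_commutatorIntegrand {n : ℕ} {α β p q r t Q s ℓ : ℝ}
    (h : Exponents n α β p q r t Q s) {Ω : Rn n → Rn n → ℂ} (hΩ : IsKernel r Ω)
    (hℓ : Admissible n t s ℓ) {b : Rn n → ℂ} (hb : lipNorm β b < ∞) {f : Rn n → ℂ}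
    (hf : MemLp f (ENNReal.ofReal ℓ) volume) :
    ∀ᵐ x, Integrable (commutatorIntegrand Ω α b f x) := by
  filter_upwards [h.ae_absOp_lt_top hΩ hℓ hf] with x hx
  exact integrable_commutatorIntegrand hΩ h.s_eq h.β_pos hb hf.1 hx

theorem commutator_sub {n : ℕ} {Ω : Rn n → Rn n → ℂ} {α : ℝ} {b f g : Rn n → ℂ} {x : Rn n}
    (hf : Integrable (commutatorIntegrand Ω α b f x))
    (hg : Integrable (commutatorIntegrand Ω α b g x)) :
    commutator Ω α b (f - g) x = commutator Ω α b f x - commutator Ω α b g x := by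
  rw [commutator, commutator, commutator, ← integral_sub hf hg]
  simp only [commutatorIntegrand, Pi.sub_apply, mul_sub]

theorem Exponents.exists_eLpNorm_commutator_sub_le {n : ℕ} {α β p q r t Q s ℓ : ℝ}
    (h : Exponents n α β p q r t Q s) {Ω : Rn n → Rn n → ℂ} (hΩ : IsKernel r Ω)
    (hℓ : Admissible n t s ℓ) {R : ℝ} (hR : 0 < R) {b : Rn n → ℂ} (hb : lipNorm β b < ∞) :
    ∃ C : ℝ≥0∞, C ≠ ∞ ∧ ∀ f g : Rn n → ℂ, MemLp f (ENNReal.ofReal ℓ) volume →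
      MemLp g (ENNReal.ofReal ℓ) volume →
      eLpNorm (commutator Ω α b f - commutator Ω α b g) (ENNReal.ofReal q)
        (volume.restrict (ball 0 R)) ≤ C * eLpNorm (f - g) (ENNReal.ofReal ℓ) volume := by
  obtain ⟨C, hC, H⟩ := h.exists_absOp_bound hΩ hℓ hR
  refine ⟨lipNorm β b * C, ENNReal.mul_ne_top hb.ne hC, fun f g hf hg => ?_⟩
  have hq := h.q_pos
  rw [eLpNorm_ofReal _ hq]
  calc _ ≤ (∫⁻ x in ball 0 R, (lipNorm β b * absOp Ω s (f - g) x) ^ q) ^ (1 / q) := by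
        refine ENNReal.rpow_le_rpow (lintegral_mono_ae (ae_restrict_of_ae ?_)) (by positivity)
        filter_upwards [h.ae_integrable_commutatorIntegrand hΩ hℓ hb hf,
          h.ae_integrable_commutatorIntegrand hΩ hℓ hb hg] with x h1 h2
        refine ENNReal.rpow_le_rpow ?_ hq.le
        rw [Pi.sub_apply, ← commutator_sub h1 h2]
        exact enorm_commutator_le h.s_eq hb _ _
    _ = lipNorm β b * (∫⁻ x in ball 0 R, absOp Ω s (f - g) x ^ q) ^ (1 / q) := by
        simp only [ENNReal.mul_rpow_of_nonneg _ _ hq.le]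
        rw [lintegral_const_mul' _ _ (ENNReal.rpow_ne_top_of_nonneg hq.le hb.ne),
          ENNReal.mul_rpow_of_nonneg _ _ (by positivity), ← ENNReal.rpow_mul,
          mul_one_div_cancel hq.ne', ENNReal.rpow_one]
    _ ≤ lipNorm β b * (C * eLpNorm (f - g) (ENNReal.ofReal ℓ) volume) := by
        gcongr
        exact H _ (hf.1.sub hg.1)
    _ = _ := (mul_assoc _ _ _).symm

theorem memLp_mollify {n : ℕ} {ε ℓ : ℝ} (hε : 0 < ε) (hℓ : 1 ≤ ℓ) {f : Rn n → ℂ}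
    (hf : MemLp f (ENNReal.ofReal ℓ) volume) : MemLp (mollify ε f) (ENNReal.ofReal ℓ) volume := by
  have hℓ0 : 0 < ℓ := zero_lt_one.trans_le hℓ
  refine ⟨(continuous_mollify hε (hf.locallyIntegrable
    (by simpa using ENNReal.ofReal_le_ofReal hℓ))).aestronglyMeasurable, ?_⟩
  refine lt_of_le_of_lt ?_ hf.2
  rw [eLpNorm_ofReal _ hℓ0, eLpNorm_ofReal _ hℓ0]
  exact ENNReal.rpow_le_rpow (lintegral_mollify_rpow_le hε hℓ hf.1) (by positivity)

theorem Exponents.tendsto_commutator_mollify {n : ℕ} {α β p q r t Q s ℓ : ℝ}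
    (h : Exponents n α β p q r t Q s) {Ω : Rn n → Rn n → ℂ} (hΩ : IsKernel r Ω)
    (hℓ : Admissible n t s ℓ) {R : ℝ} (hR : 0 < R) {b : Rn n → ℂ} (hb : lipNorm β b < ∞)
    {f : Rn n → ℂ} (hf : MemLp f (ENNReal.ofReal ℓ) volume) {ε : ℕ → ℝ} (hε : ∀ k, 0 < ε k)
    (hε0 : Tendsto ε atTop (𝓝 0)) :
    Tendsto (fun k => eLpNorm (commutator Ω α b (mollify (ε k) f) - commutator Ω α b f)
      (ENNReal.ofReal q) (volume.restrict (ball 0 R))) atTop (𝓝 0) := by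
  obtain ⟨C, hC, H⟩ := h.exists_eLpNorm_commutator_sub_le hΩ hℓ hR hb
  have hℓ1 := hℓ.one_lt.le
  have hℓ0 : 0 < ℓ := zero_lt_one.trans hℓ.one_lt
  have h1 : Tendsto (fun k => C * eLpNorm (mollify (ε k) f - f) (ENNReal.ofReal ℓ) volume)
      atTop (𝓝 (C * 0)) := by
    refine ENNReal.Tendsto.const_mul ?_ (Or.inr hC)
    simp only [eLpNorm_ofReal _ hℓ0]
    have h2 := (tendsto_lintegral_mollify_sub hℓ1 hf hε hε0).ennrpow_const (1 / ℓ)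
    rwa [ENNReal.zero_rpow_of_pos (by positivity)] at h2
  rw [mul_zero] at h1
  exact tendsto_of_tendsto_of_tendsto_of_le_of_le tendsto_const_nhds h1 (fun _ => zero_le)
    fun k => H _ _ (memLp_mollify (hε k) hℓ1 hf) hf

/-- Each term `absOp` (g j) is bounded in L^q on a ball uniformly in j, so p-summability of c makes
∑ |c j| `absOp` (g j) finite almost everywhere. At such points sum and integral may be exchanged. No
integrability of f is assumed; it comes out of the series. -/
theorem Exponents.ae_hasSum_commutator {n : ℕ} {α β p q r t Q s ℓ : ℝ}
    (h : Exponents n α β p q r t Q s) {Ω : Rn n → Rn n → ℂ} (hΩ : IsKernel r Ω)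
    (hℓ : Admissible n t s ℓ) {b : Rn n → ℂ} (hb : lipNorm β b < ∞) {c : ℕ → ℂ}
    (hc : ∑' j, ‖c j‖ₑ ^ p < ∞) {g : ℕ → Rn n → ℂ} {f : Rn n → ℂ} {M : ℝ≥0∞} (hM : M ≠ ∞)
    (hg : ∀ j, AEStronglyMeasurable (g j) volume)
    (hgM : ∀ j, eLpNorm (g j) (ENNReal.ofReal ℓ) volume ≤ M)
    (hf : ∀ y, HasSum (fun j => c j * g j y) (f y)) :
    ∀ᵐ x, HasSum (fun j => c j * commutator Ω α b (g j) x) (commutator Ω α b f x) := by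
  have hq := h.q_pos
  have hp := h.p_pos
  have hfin : ∀ᵐ x, ∑' j, ‖c j‖ₑ * absOp Ω s (g j) x < ∞ := by
    refine ae_of_forall_ball fun R hR => ?_
    obtain ⟨C, hC, H⟩ := h.exists_absOp_bound hΩ hℓ hR
    refine ae_tsum_lt_top (fun j => (aemeasurable_absOp hΩ s (hg j)).restrict.const_mul _)
      h.p_pos h.p_lt.le h.p_le_q ?_
    calc _ ≤ ∑' j, ‖c j‖ₑ ^ p * (C * M) ^ p := by
          refine ENNReal.tsum_le_tsum fun j => ?_
          rw [← ENNReal.mul_rpow_of_nonneg _ _ hp.le]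
          refine ENNReal.rpow_le_rpow ?_ hp.le
          simp only [ENNReal.mul_rpow_of_nonneg _ _ hq.le]
          rw [lintegral_const_mul' _ _ (ENNReal.rpow_ne_top_of_nonneg hq.le enorm_ne_top),
            ENNReal.mul_rpow_of_nonneg _ _ (by positivity), ← ENNReal.rpow_mul,
            mul_one_div_cancel hq.ne', ENNReal.rpow_one]
          gcongr
          exact (H _ (hg j)).trans (by gcongr; exact hgM j)
      _ = (∑' j, ‖c j‖ₑ ^ p) * (C * M) ^ p := ENNReal.tsum_mul_right
      _ < ∞ := ENNReal.mul_lt_top hc (ENNReal.rpow_lt_top_of_nonneg hp.le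
          (ENNReal.mul_ne_top hC hM))
  have hfint : ∀ᵐ x, ∀ j, absOp Ω s (g j) x < ∞ :=
    ae_all_iff.2 fun j => h.ae_absOp_lt_top hΩ hℓ ⟨hg j, (hgM j).trans_lt hM.lt_top⟩
  filter_upwards [hfin, hfint] with x hx hx'
  have hI : ∀ j, Integrable fun y => c j * commutatorIntegrand Ω α b (g j) x y := fun j =>
    (integrable_commutatorIntegrand hΩ h.s_eq h.β_pos hb (hg j) (hx' j)).const_mul _
  have hS : Summable fun j => ∫ y, ‖c j * commutatorIntegrand Ω α b (g j) x y‖ := by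
    have h1 : ∑' j, ∫⁻ y, ‖c j * commutatorIntegrand Ω α b (g j) x y‖ₑ ≠ ∞ := by
      refine ne_top_of_le_ne_top (ENNReal.mul_ne_top hb.ne hx.ne) ?_
      rw [← ENNReal.tsum_mul_left]
      refine ENNReal.tsum_le_tsum fun j => ?_
      simp only [enorm_mul]
      rw [lintegral_const_mul' _ _ enorm_ne_top, mul_left_comm]
      gcongr
      rw [absOp, ← lintegral_const_mul' _ _ hb.ne]
      exact lintegral_mono fun y => enorm_commutatorIntegrand_le h.s_eq b _ x y
    refine (ENNReal.summable_toReal h1).congr fun j => ?_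
    rw [integral_norm_eq_lintegral_enorm (hI j).1]
  have key := hasSum_integral_of_summable_integral_norm hI hS
  have e1 : ∀ y, ∑' j, c j * commutatorIntegrand Ω α b (g j) x y =
      commutatorIntegrand Ω α b f x y := by
    intro y
    have := ((hf y).mul_left
      (Ω x (x - y) / ((‖x - y‖ ^ ((n : ℝ) - α) : ℝ) : ℂ) * (b x - b y))).tsum_eq
    simp only [commutatorIntegrand]
    rw [← this]
    exact tsum_congr fun j => by ring
  simp only [e1, integral_const_mul] at key
  exact key

/-! ### Atomic decompositions of functions -/

/-- Dominated convergence for the counting measure. -/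
theorem tendsto_tsum_zero_of_dominated {F : ℕ → ℕ → ℝ≥0∞} {B : ℕ → ℝ≥0∞} (hB : ∑' j, B j ≠ ∞)
    (hF : ∀ k j, F k j ≤ B j) (h : ∀ j, Tendsto (fun k => F k j) atTop (𝓝 0)) :
    Tendsto (fun k => ∑' j, F k j) atTop (𝓝 0) := by
  have := tendsto_lintegral_of_dominated_convergence (μ := Measure.count) (F := F) (f := 0) B
    (fun k => measurable_of_countable _) (fun k => Eventually.of_forall (hF k))
    (by rwa [lintegral_count]) (Eventually.of_forall h)
  simpa [lintegral_count] using this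

theorem enorm_le_tsum_enorm_of_hasSum {u : ℕ → ℂ} {S : ℂ} (h : HasSum u S) : ‖S‖ₑ ≤ ∑' j, ‖u j‖ₑ := by
  by_cases ht : ∑' j, ‖u j‖ₑ = ∞
  · simp [ht]
  have hs : Summable fun j => ‖u j‖ := by
    refine (ENNReal.summable_toReal ht).congr fun j => ?_
    simp
  have h1 := norm_tsum_le_tsum_norm hs
  rw [h.tsum_eq] at h1
  rw [← ofReal_norm]
  refine (ENNReal.ofReal_le_ofReal h1).trans (le_of_eq ?_)
  rw [ENNReal.ofReal_tsum_of_nonneg (fun _ => norm_nonneg _) hs]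
  simp

theorem eLpNorm_const_mul_rpow_le {X : Type*} [MeasurableSpace X] {μ : Measure X} {q : ℝ≥0∞}
    {p : ℝ} (hp : 0 ≤ p) (c : ℂ) (u : X → ℂ) {D : ℝ≥0∞} (hD : eLpNorm u q μ ≤ D) :
    eLpNorm (fun x => c * u x) q μ ^ p ≤ ‖c‖ₑ ^ p * D ^ p := by
  rw [← ENNReal.mul_rpow_of_nonneg _ _ hp]
  refine ENNReal.rpow_le_rpow ?_ hp
  refine (eLpNorm_const_smul_le (c := c) (f := u)).trans ?_
  gcongr

theorem ae_summable_of_eLpNorm_le {X : Type*} [MeasurableSpace X] {μ : Measure X} {p q : ℝ}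
    (hp0 : 0 < p) (hp1 : p ≤ 1) (hpq : p ≤ q) {c : ℕ → ℂ} (hc : ∑' j, ‖c j‖ₑ ^ p < ∞)
    {u : ℕ → X → ℂ} (hu : ∀ j, AEStronglyMeasurable (u j) μ) {D : ℝ≥0∞} (hD : D ≠ ∞)
    (hD' : ∀ j, eLpNorm (u j) (ENNReal.ofReal q) μ ≤ D) :
    ∀ᵐ x ∂μ, Summable fun j => c j * u j x := by
  have hq : 0 < q := hp0.trans_le hpq
  have h1 : ∀ᵐ x ∂μ, ∑' j, ‖c j * u j x‖ₑ < ∞ := by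
    refine ae_tsum_lt_top (fun j => ((hu j).const_mul (c j)).enorm) hp0 hp1 hpq ?_
    simp only [← eLpNorm_ofReal _ hq]
    refine lt_of_le_of_lt (ENNReal.tsum_le_tsum fun j =>
      eLpNorm_const_mul_rpow_le hp0.le (c j) (u j) (hD' j)) ?_
    rw [ENNReal.tsum_mul_right]
    exact ENNReal.mul_lt_top hc (ENNReal.rpow_lt_top_of_nonneg hp0.le hD)
  filter_upwards [h1] with x hx
  refine Summable.of_norm ((ENNReal.summable_toReal hx.ne).congr fun j => ?_)
  simp

/-- A mollified atom lives at scale at least ε, and its L^ℓ norm is a negative power of its scale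
because p < 1 < ℓ. Hence the bound depends on ε but not on the original radius. -/
theorem exists_eLpNorm_mollify_atom_le {n : ℕ} (hn : 1 ≤ n) {p ℓ ε : ℝ} {A : ℝ≥0∞} (hp0 : 0 < p)
    (hp1 : p < 1) (hsm : (n : ℝ) / p < n + 1) (hA : A ≠ ∞) (hℓ : 1 < ℓ) (hℓ2 : ℓ ≤ 2)
    (hε : 0 < ε) :
    ∃ M : ℝ≥0∞, M ≠ ∞ ∧ ∀ (x₀ : Rn n) (d : ℝ) (a : Rn n → ℂ), IsAtomOn p A x₀ d a →
      eLpNorm (mollify ε a) (ENNReal.ofReal ℓ) volume ≤ M := by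
  obtain ⟨C, hC, H⟩ := exists_isAtomOn_mollify hsm
  have hℓ0 : 0 < ℓ := zero_lt_one.trans hℓ
  have hE0 : ENNReal.ofReal ε ≠ 0 := by simpa using hε
  refine ⟨volume (closedBall (0 : Rn n) 1) ^ (1 / ℓ - 1 / 2) * (C * A) *
    ENNReal.ofReal ε ^ (n / ℓ - n / p : ℝ), ENNReal.mul_ne_top (ENNReal.mul_ne_top ?_
      (ENNReal.mul_ne_top hC hA)) (ENNReal.rpow_ne_top_of_ne_zero hE0 ENNReal.ofReal_ne_top), ?_⟩
  · exact ENNReal.rpow_ne_top_of_nonneg (sub_nonneg.2 (one_div_le_one_div_of_le hℓ0 hℓ2))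
      measure_closedBall_lt_top.ne
  intro x₀ d a ha
  rw [eLpNorm_ofReal _ hℓ0]
  refine ((H A x₀ d a ha ε hε).lintegral_rpow_le hℓ0 hℓ2).trans ?_
  gcongr 1
  have hnp : (n : ℝ) / ℓ ≤ n / p := by gcongr; linarith
  rw [← neg_sub, ENNReal.rpow_neg, ENNReal.rpow_neg]
  refine ENNReal.inv_le_inv.2 (ENNReal.rpow_le_rpow (ENNReal.ofReal_le_ofReal ?_) ?_)
  · linarith [le_max_right d ε]
  · linarith

theorem atomConst_ne_top (n : ℕ) (e : ℝ) : volume (closedBall (0 : Rn n) 1) ^ e ≠ ∞ :=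
  ENNReal.rpow_ne_top_of_ne_zero (measure_closedBall_pos _ _ one_pos).ne'
    measure_closedBall_lt_top.ne

theorem IsAtomOn.memLp_of_le_two {n : ℕ} {p ℓ : ℝ} {A : ℝ≥0∞} {x₀ : Rn n} {d : ℝ} {a : Rn n → ℂ}
    (ha : IsAtomOn p A x₀ d a) (hA : A ≠ ∞) (hℓ : 0 < ℓ) (hℓ2 : ℓ ≤ 2) :
    MemLp a (ENNReal.ofReal ℓ) volume := by
  refine ⟨ha.memLp.1, ?_⟩
  rw [eLpNorm_ofReal _ hℓ]
  refine (ha.lintegral_rpow_le hℓ hℓ2).trans_lt (ENNReal.mul_lt_top (ENNReal.mul_lt_top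
    (atomConst_ne_top n _).lt_top hA.lt_top) ?_)
  exact (ENNReal.rpow_ne_top_of_ne_zero (by simpa using ha.radius_pos)
    ENNReal.ofReal_ne_top).lt_top

/-- The value of a mollification at y is a pairing with a Schwartz function, so distributional
convergence becomes convergence at every point. -/
theorem IsAtomicDecomposition.hasSum_mollify {n : ℕ} {p : ℝ} {F : 𝓢'(Rn n, ℂ)} {c : ℕ → ℂ}
    {a : ℕ → Rn n → ℂ} (hF : IsAtomicDecomposition p F c a) {f : Rn n → ℂ}
    (hFf : ∀ φ : 𝓢(Rn n, ℂ), F φ = ∫ x, f x * φ x) {ε : ℝ} (hε : 0 < ε) (y : Rn n) :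
    HasSum (fun j => c j * mollify ε (a j) y) (mollify ε f y) := by
  obtain ⟨φ, hφ⟩ := exists_schwartz_mollifier hε y
  have := hF.hasSum φ
  rw [hFf] at this
  simpa only [hφ] using this

/-- Let X be the sum of c j T(a j) and f_ε the mollification of f. The series of mollified atoms
sums to T f_ε. On each ball T f_ε → T f in L^q because f_ε → f in L^ℓ. Also T f_ε → X: the p-th
power of the distance is at most ∑ |c j|^p ‖T(φ_ε * a j) - T(a j)‖_q^p, whose terms tend to 0 and
are dominated through the atom bound, uniform in ε. Therefore T f = X. -/
theorem Exponents.ae_hasSum_of_isAtomicDecomposition {n : ℕ} {α β p q r t Q s ℓ₀ ℓ : ℝ}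
    (h : Exponents n α β p q r t Q s) {Ω : Rn n → Rn n → ℂ} (hΩ : IsKernel r Ω)
    (hDini : DiniCondition r β Ω) (hℓ₀ : Admissible n t s ℓ₀) (hℓ₀2 : ℓ₀ ≤ 2)
    {b : Rn n → ℂ} (hb : lipNorm β b < ∞) {F : 𝓢'(Rn n, ℂ)} {c : ℕ → ℂ}
    {a : ℕ → Rn n → ℂ} (hF : IsAtomicDecomposition p F c a) (hℓ : Admissible n t s ℓ)
    {f : Rn n → ℂ} (hf : MemLp f (ENNReal.ofReal ℓ) volume)
    (hFf : ∀ φ : 𝓢(Rn n, ℂ), F φ = ∫ x, f x * φ x) :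
    ∀ᵐ x, HasSum (fun j => c j * commutator Ω α b (a j) x) (commutator Ω α b f x) := by
  have hp := h.p_pos
  have hq := h.q_pos
  have hℓ₀0 : 0 < ℓ₀ := zero_lt_one.trans hℓ₀.one_lt
  set A : ℝ≥0∞ := volume (closedBall (0 : Rn n) 1) ^ (1 / 2 - 1 / p) with hAdef
  have hA : A ≠ ∞ := atomConst_ne_top n _
  choose x₀ d hat using fun j => (hF.isAtom j).exists_isAtomOn hp h.p_lt
  obtain ⟨C₁, hC₁, H₁⟩ := h.exists_atom_bound hΩ hDini
  obtain ⟨C₂, hC₂, H₂⟩ := exists_isAtomOn_mollify h.smooth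
  set T : (Rn n → ℂ) → Rn n → ℂ := commutator Ω α b with hT
  set ε : ℕ → ℝ := fun k => 1 / ((k : ℝ) + 1) with hεdef
  have hε : ∀ k, 0 < ε k := fun k => by simp only [hεdef]; positivity
  have hε0 : Tendsto ε atTop (𝓝 0) := tendsto_one_div_add_atTop_nhds_zero_nat
  have hloc : ∀ j, LocallyIntegrable (a j) := fun j => (hat j).integrable.locallyIntegrable
  have ham : ∀ j, AEStronglyMeasurable (a j) volume := fun j => (hat j).memLp.1
  have hmm : ∀ k j, AEStronglyMeasurable (mollify (ε k) (a j)) volume := fun k j =>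
    (continuous_mollify (hε k) (hloc j)).aestronglyMeasurable
  have hTm : ∀ {g : Rn n → ℂ}, AEStronglyMeasurable g volume → AEStronglyMeasurable (T g) volume :=
    fun hg => aestronglyMeasurable_commutator hΩ α h.β_pos hb hg
  set D : ℝ≥0∞ := C₁ * lipNorm β b * A + C₁ * lipNorm β b * (C₂ * A) with hDdef
  have hD : D ≠ ∞ := ENNReal.add_ne_top.2 ⟨ENNReal.mul_ne_top (ENNReal.mul_ne_top hC₁ hb.ne) hA,
    ENNReal.mul_ne_top (ENNReal.mul_ne_top hC₁ hb.ne) (ENNReal.mul_ne_top hC₂ hA)⟩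
  have hTa : ∀ j, eLpNorm (T (a j)) (ENNReal.ofReal q) volume ≤ D := fun j =>
    (H₁ b hb A _ _ _ (hat j)).trans le_self_add
  have hTma : ∀ k j, eLpNorm (T (mollify (ε k) (a j))) (ENNReal.ofReal q) volume ≤ D := fun k j =>
    (H₁ b hb _ _ _ _ (H₂ A _ _ _ (hat j) _ (hε k))).trans le_add_self
  have hsum : ∀ᵐ x, Summable fun j => c j * T (a j) x :=
    ae_summable_of_eLpNorm_le hp h.p_lt.le h.p_le_q hF.cost_lt_top (fun j => hTm (ham j)) hD hTa
  set X : Rn n → ℂ := fun x => ∑' j, c j * T (a j) x with hX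
  have hXm : AEStronglyMeasurable X volume := by
    refine aestronglyMeasurable_of_tendsto_ae atTop
      (f := fun N x => ∑ j ∈ Finset.range N, c j * T (a j) x) (fun N => ?_) ?_
    · exact Finset.aestronglyMeasurable_fun_sum _ fun j _ => (hTm (ham j)).const_mul _
    · filter_upwards [hsum] with x hx
      exact hx.hasSum.tendsto_sum_nat
  -- The exponent ℓ₀ ≤ 2 is used for the atoms, while f lies in L^ℓ: the exchange of sum and
  -- integral requires nothing of f in L^{ℓ₀}.
  have hXk : ∀ k, ∀ᵐ x, HasSum (fun j => c j * T (mollify (ε k) (a j)) x)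
      (T (mollify (ε k) f) x) := by
    intro k
    obtain ⟨M, hM, H⟩ := exists_eLpNorm_mollify_atom_le h.one_le_n hp h.p_lt h.smooth hA
      hℓ₀.one_lt hℓ₀2 (hε k)
    exact h.ae_hasSum_commutator hΩ hℓ₀ hb hF.cost_lt_top hM (hmm k)
      (fun j => H _ _ _ (hat j)) (hF.hasSum_mollify hFf (hε k))
  have heq : T f =ᵐ[volume] X := by
    refine ae_of_forall_ball fun R hR => ?_
    set μ : Measure (Rn n) := volume.restrict (ball 0 R) with hμ
    -- The constant of the quasi-triangle inequality, since q may be smaller than 1.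
    set K : ℝ≥0∞ := (ENNReal.ofReal q).LpAddConst with hKdef
    have hK : K ≠ ∞ := ENNReal.LpAddConst_lt_top _ |>.ne
    have hle : ∀ g : Rn n → ℂ, eLpNorm g (ENNReal.ofReal q) μ ≤
        eLpNorm g (ENNReal.ofReal q) volume := fun g =>
      eLpNorm_mono_measure _ Measure.restrict_le_self
    have hdiff : Tendsto (fun k => eLpNorm (T (mollify (ε k) f) - X) (ENNReal.ofReal q) μ)
        atTop (𝓝 0) := by
      have h1 : Tendsto (fun k => ∑' j, eLpNorm
          (fun x => c j * (T (mollify (ε k) (a j)) - T (a j)) x) (ENNReal.ofReal q) μ ^ p)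
          atTop (𝓝 0) := by
        refine tendsto_tsum_zero_of_dominated (B := fun j => ‖c j‖ₑ ^ p * (K * (D + D)) ^ p)
          ?_ ?_ ?_
        · rw [ENNReal.tsum_mul_right]
          exact ENNReal.mul_ne_top hF.cost_lt_top.ne (ENNReal.rpow_ne_top_of_nonneg hp.le
            (ENNReal.mul_ne_top hK (ENNReal.add_ne_top.2 ⟨hD, hD⟩)))
        · intro k j
          refine eLpNorm_const_mul_rpow_le hp.le _ _ ?_
          refine (eLpNorm_sub_le' (hTm (hmm k j)).restrict (hTm (ham j)).restrict _).trans ?_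
          gcongr
          · exact (hle _).trans (hTma k j)
          · exact (hle _).trans (hTa j)
        · intro j
          have h2 := h.tendsto_commutator_mollify hΩ hℓ₀ hR hb
            ((hat j).memLp_of_le_two hA hℓ₀0 hℓ₀2) hε hε0
          have h3 := (ENNReal.Tendsto.const_mul (a := ‖c j‖ₑ ^ p) (h2.ennrpow_const p)
            (Or.inr (ENNReal.rpow_ne_top_of_nonneg hp.le enorm_ne_top)))
          rw [ENNReal.zero_rpow_of_pos hp, mul_zero] at h3
          exact tendsto_of_tendsto_of_tendsto_of_le_of_le tendsto_const_nhds h3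
            (fun _ => zero_le) fun k => eLpNorm_const_mul_rpow_le hp.le _ _ le_rfl
      have h4 : Tendsto (fun k => eLpNorm (T (mollify (ε k) f) - X) (ENNReal.ofReal q) μ ^ p)
          atTop (𝓝 0) := by
        refine tendsto_of_tendsto_of_tendsto_of_le_of_le tendsto_const_nhds h1
          (fun _ => zero_le) fun k => ?_
        refine eLpNorm_rpow_le_tsum (fun j => ?_) hp h.p_lt.le h.p_le_q ?_
        · exact (((hTm (hmm k j)).sub (hTm (ham j))).restrict).const_mul _
        · refine ae_restrict_of_ae ?_
          filter_upwards [hsum, hXk k] with x hx1 hx2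
          refine enorm_le_tsum_enorm_of_hasSum ?_
          simpa only [Pi.sub_apply, mul_sub] using hx2.sub hx1.hasSum
      have h5 := h4.ennrpow_const (1 / p)
      simpa only [← ENNReal.rpow_mul, mul_one_div_cancel hp.ne', ENNReal.rpow_one,
        ENNReal.zero_rpow_of_pos (one_div_pos.2 hp)] using h5
    have hTf := h.tendsto_commutator_mollify hΩ hℓ hR hb hf hε hε0
    have hlim := ENNReal.Tendsto.const_mul (a := K) (hTf.add hdiff) (Or.inr hK)
    rw [add_zero, mul_zero] at hlim
    have hfin : eLpNorm (T f - X) (ENNReal.ofReal q) μ ≤ 0 := by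
      refine ge_of_tendsto' hlim fun k => ?_
      have e1 : T f - X = (T (mollify (ε k) f) - X) - (T (mollify (ε k) f) - T f) := by
        abel
      have hmf : AEStronglyMeasurable (T (mollify (ε k) f)) volume :=
        hTm (memLp_mollify (hε k) hℓ.one_lt.le hf).1
      rw [e1, add_comm]
      exact eLpNorm_sub_le' (hmf.sub hXm).restrict (hmf.sub (hTm hf.1)).restrict _
    have h6 := (eLpNorm_eq_zero_iff ((hTm hf.1).sub hXm).restrict (by simpa using hq)).1
      (le_antisymm hfin zero_le)
    filter_upwards [h6] with x hx
    exact sub_eq_zero.1 hx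
  filter_upwards [hsum, heq] with x hx1 hx2
  rw [hx2]
  exact hx1.hasSum

/-! ### The commutator on the Hardy space -/

/-- Membership in `Hardy` forgets the sequences; here they are kept explicit because the values of
the series must be compared. -/
theorem IsAtomicDecomposition.add {n : ℕ} {p : ℝ} {F G : 𝓢'(Rn n, ℂ)} {c c' : ℕ → ℂ}
    {a a' : ℕ → Rn n → ℂ} (h : IsAtomicDecomposition p F c a)
    (h' : IsAtomicDecomposition p G c' a') :
    IsAtomicDecomposition p (F + G) (Sum.elim c c' ∘ Equiv.natSumNatEquivNat.symm)
      (Sum.elim a a' ∘ Equiv.natSumNatEquivNat.symm) := by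
  refine ⟨fun j => ?_, ?_, fun φ => ?_⟩
  · rcases hj : Equiv.natSumNatEquivNat.symm j with k | k
    · simpa [hj] using h.isAtom k
    · simpa [hj] using h'.isAtom k
  · have : ∑' j, ‖(Sum.elim c c' ∘ Equiv.natSumNatEquivNat.symm) j‖ₑ ^ p =
        ∑' i, ‖Sum.elim c c' i‖ₑ ^ p :=
      Equiv.natSumNatEquivNat.symm.tsum_eq (fun i => ‖Sum.elim c c' i‖ₑ ^ p)
    rw [this, Summable.tsum_sum ENNReal.summable ENNReal.summable]
    simpa using ⟨h.cost_lt_top, h'.cost_lt_top⟩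
  · refine (Equiv.natSumNatEquivNat.symm.hasSum_iff
      (f := fun i => Sum.elim c c' i * ∫ x, Sum.elim a a' i x * φ x)).2 ?_
    exact HasSum.sum (h.hasSum φ) (h'.hasSum φ)

theorem IsAtomicDecomposition.smul {n : ℕ} {p : ℝ} (hp : 0 < p) {F : 𝓢'(Rn n, ℂ)} {c : ℕ → ℂ}
    {a : ℕ → Rn n → ℂ} (h : IsAtomicDecomposition p F c a) (τ : ℂ) :
    IsAtomicDecomposition p (τ • F) (fun j => τ * c j) a := by
  refine ⟨h.isAtom, ?_, fun φ => ?_⟩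
  · simp only [enorm_mul, ENNReal.mul_rpow_of_nonneg _ _ hp.le, ENNReal.tsum_mul_left]
    exact ENNReal.mul_lt_top (ENNReal.rpow_lt_top_of_nonneg hp.le enorm_ne_top) h.cost_lt_top
  · simpa [mul_assoc] using (h.hasSum φ).mul_left τ

theorem IsAtomicDecomposition.hardyNorm_le {n : ℕ} {p : ℝ} {F : 𝓢'(Rn n, ℂ)} {c : ℕ → ℂ}
    {a : ℕ → Rn n → ℂ} (h : IsAtomicDecomposition p F c a) :
    hardyNorm p F ≤ (∑' j, ‖c j‖ₑ ^ p) ^ (1 / p) :=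
  iInf_le_of_le c (iInf_le_of_le a (iInf_le_of_le h le_rfl))

/-- `g` is the sum of the series `∑ j, c j • [b, T_{Ω,α}] (a j)` for every atomic decomposition
`∑ j, c j • a j` of `F`. -/
def IsSeriesValue {n : ℕ} (p : ℝ) (T : (Rn n → ℂ) → Rn n → ℂ) (F : 𝓢'(Rn n, ℂ))
    (g : Rn n → ℂ) : Prop :=
  ∀ c a, IsAtomicDecomposition p F c a → ∀ᵐ x, HasSum (fun j => c j * T (a j) x) (g x)

theorem hasSum_elim_comp {n : ℕ} {T : (Rn n → ℂ) → Rn n → ℂ} {c c' : ℕ → ℂ}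
    {a a' : ℕ → Rn n → ℂ} {x : Rn n} {S S' : ℂ} (h : HasSum (fun j => c j * T (a j) x) S)
    (h' : HasSum (fun j => c' j * T (a' j) x) S') :
    HasSum (fun j => (Sum.elim c c' ∘ Equiv.natSumNatEquivNat.symm) j *
      T ((Sum.elim a a' ∘ Equiv.natSumNatEquivNat.symm) j) x) (S + S') :=
  (Equiv.natSumNatEquivNat.symm.hasSum_iff
    (f := fun i => Sum.elim c c' i * T (Sum.elim a a' i) x)).2 (HasSum.sum h h')

/-- Two decompositions of F combine to a decomposition of F - F = 0, so a series that sums to zero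
for every decomposition of 0 has the same sum for all decompositions of F. Linearity follows in the
same way, by combining and scaling decompositions. -/
theorem exists_linearMap_of_isSeriesValue {n : ℕ} {p : ℝ} (hp : 0 < p) {q : ℝ≥0∞}
    {T : (Rn n → ℂ) → Rn n → ℂ}
    (hT : ∀ F c a, IsAtomicDecomposition p F c a →
      ∃ g : Lp ℂ q (volume : Measure (Rn n)), ∀ᵐ x, HasSum (fun j => c j * T (a j) x) (g x))
    (h0 : ∀ c a, IsAtomicDecomposition p (0 : 𝓢'(Rn n, ℂ)) c a →
      ∀ᵐ x, HasSum (fun j => c j * T (a j) x) 0) :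
    ∃ S : Hardy n p hp →ₗ[ℂ] Lp ℂ q (volume : Measure (Rn n)),
      ∀ F : Hardy n p hp, IsSeriesValue p T (F : 𝓢'(Rn n, ℂ)) (S F) := by
  have hex : ∀ F : Hardy n p hp, ∃ g : Lp ℂ q (volume : Measure (Rn n)),
      IsSeriesValue p T (F : 𝓢'(Rn n, ℂ)) g := by
    rintro ⟨F, c, a, h⟩
    obtain ⟨g, hg⟩ := hT F c a h
    refine ⟨g, fun c' a' h' => ?_⟩
    obtain ⟨g', hg'⟩ := hT F c' a' h'
    have hz := h.add (h'.smul hp (-1))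
    have e0 : F + (-1 : ℂ) • F = 0 := by
      ext φ
      simp
    change IsAtomicDecomposition p (F + (-1 : ℂ) • F) _ _ at hz
    rw [e0] at hz
    filter_upwards [hg, hg', h0 _ _ hz] with x h1 h2 h3
    have h4 : HasSum (fun j => -1 * c' j * T (a' j) x) (-1 * g' x) := by
      simpa only [mul_assoc] using h2.mul_left (-1)
    have h5 := (hasSum_elim_comp h1 h4).unique h3
    have h6 : g x = g' x := by linear_combination h5
    rwa [h6]
  choose S hS using hex
  have hdec : ∀ F : Hardy n p hp, ∃ c a, IsAtomicDecomposition p (F : 𝓢'(Rn n, ℂ)) c a :=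
    fun F => F.2
  refine ⟨⟨⟨S, fun F G => ?_⟩, fun τ F => ?_⟩, hS⟩
  · obtain ⟨c, a, h⟩ := hdec F
    obtain ⟨c', a', h'⟩ := hdec G
    refine Lp.ext ?_
    filter_upwards [hS F _ _ h, hS G _ _ h', hS (F + G) _ _ (h.add h'),
      Lp.coeFn_add (S F) (S G)] with x h1 h2 h3 h4
    rw [h4]
    exact h3.unique (hasSum_elim_comp h1 h2)
  · obtain ⟨c, a, h⟩ := hdec F
    refine Lp.ext ?_
    filter_upwards [hS F _ _ h, hS (τ • F) _ _ (h.smul hp τ),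
      Lp.coeFn_smul τ (S F)] with x h1 h2 h3
    simp only [RingHom.id_apply]
    rw [h3]
    refine h2.unique ?_
    simpa only [mul_assoc, Pi.smul_apply, smul_eq_mul] using h1.mul_left τ

/-- The operator is the sum of the series of images of atoms. Its bound holds with the cost of every
decomposition, and then with the infimum because the sum is the same for all of them. -/
theorem Exponents.exists_linearMap {n : ℕ} {α β p q r t Q s ℓ₀ : ℝ}
    (h : Exponents n α β p q r t Q s) {Ω : Rn n → Rn n → ℂ} (hΩ : IsKernel r Ω)
    (hDini : DiniCondition r β Ω) (hℓ₀ : Admissible n t s ℓ₀) (hℓ₀2 : ℓ₀ ≤ 2) :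
    ∃ C : ℝ≥0∞, C ≠ ∞ ∧ ∀ b : Rn n → ℂ, lipNorm β b < ∞ →
      ∃ S : Hardy n p h.p_pos →ₗ[ℂ] Lp ℂ (ENNReal.ofReal q) (volume : Measure (Rn n)),
      (∀ F : Hardy n p h.p_pos, IsSeriesValue p (commutator Ω α b) (F : 𝓢'(Rn n, ℂ)) (S F)) ∧
      ∀ F : Hardy n p h.p_pos, eLpNorm (S F) (ENNReal.ofReal q) volume ≤
        C * lipNorm β b * hardyNorm p (F : 𝓢'(Rn n, ℂ)) := by
  have hp := h.p_pos
  set A : ℝ≥0∞ := volume (closedBall (0 : Rn n) 1) ^ (1 / 2 - 1 / p) with hAdef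
  have hA : A ≠ ∞ := atomConst_ne_top n _
  obtain ⟨C, hC, H⟩ := h.exists_atom_bound hΩ hDini
  refine ⟨C * A, ENNReal.mul_ne_top hC hA, fun b hb => ?_⟩
  set D : ℝ≥0∞ := C * lipNorm β b * A with hDdef
  have hD : D ≠ ∞ := ENNReal.mul_ne_top (ENNReal.mul_ne_top hC hb.ne) hA
  have hTa : ∀ a : Rn n → ℂ, IsAtom p 2 a →
      eLpNorm (commutator Ω α b a) (ENNReal.ofReal q) volume ≤ D := by
    intro a ha
    obtain ⟨x₀, d, hat⟩ := ha.exists_isAtomOn hp h.p_lt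
    exact H b hb A x₀ d a hat
  have hTm : ∀ a : Rn n → ℂ, IsAtom p 2 a →
      AEStronglyMeasurable (commutator Ω α b a) volume := fun a ha =>
    aestronglyMeasurable_commutator hΩ α h.β_pos hb ha.1.1
  have hbound : ∀ (F : 𝓢'(Rn n, ℂ)) c a, IsAtomicDecomposition p F c a → ∀ g : Rn n → ℂ,
      (∀ᵐ x, HasSum (fun j => c j * commutator Ω α b (a j) x) (g x)) →
      eLpNorm g (ENNReal.ofReal q) volume ≤ D * (∑' j, ‖c j‖ₑ ^ p) ^ (1 / p) := by
    intro F c a hF g hg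
    have h1 : eLpNorm g (ENNReal.ofReal q) volume ^ p ≤ (∑' j, ‖c j‖ₑ ^ p) * D ^ p := by
      rw [← ENNReal.tsum_mul_right]
      refine (eLpNorm_rpow_le_tsum (u := fun j x => c j * commutator Ω α b (a j) x)
        (fun j => (hTm _ (hF.isAtom j)).const_mul _) hp h.p_lt.le h.p_le_q ?_).trans
        (ENNReal.tsum_le_tsum fun j => eLpNorm_const_mul_rpow_le hp.le _ _ (hTa _ (hF.isAtom j)))
      filter_upwards [hg] with x hx
      exact enorm_le_tsum_enorm_of_hasSum hx
    have h2 := ENNReal.rpow_le_rpow h1 (one_div_pos.2 hp).le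
    rwa [ENNReal.mul_rpow_of_nonneg _ _ (one_div_pos.2 hp).le, ← ENNReal.rpow_mul,
      ← ENNReal.rpow_mul, mul_one_div_cancel hp.ne', ENNReal.rpow_one, ENNReal.rpow_one,
      mul_comm] at h2
  obtain ⟨S, hS⟩ := exists_linearMap_of_isSeriesValue (q := ENNReal.ofReal q) hp
    (T := commutator Ω α b) (fun F c a hF => by
      have hsum : ∀ᵐ x, Summable fun j => c j * commutator Ω α b (a j) x :=
        ae_summable_of_eLpNorm_le hp h.p_lt.le h.p_le_q hF.cost_lt_top
          (fun j => hTm _ (hF.isAtom j)) hD fun j => hTa _ (hF.isAtom j)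
      set X : Rn n → ℂ := fun x => ∑' j, c j * commutator Ω α b (a j) x with hX
      have hXs : ∀ᵐ x, HasSum (fun j => c j * commutator Ω α b (a j) x) (X x) := by
        filter_upwards [hsum] with x hx
        exact hx.hasSum
      have hXm : AEStronglyMeasurable X volume := by
        refine aestronglyMeasurable_of_tendsto_ae atTop
          (f := fun N x => ∑ j ∈ Finset.range N, c j * commutator Ω α b (a j) x)
          (fun N => ?_) ?_
        · exact Finset.aestronglyMeasurable_fun_sum _ fun j _ =>
            (hTm _ (hF.isAtom j)).const_mul _
        · filter_upwards [hXs] with x hx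
          exact hx.tendsto_sum_nat
      have hXL : MemLp X (ENNReal.ofReal q) volume :=
        ⟨hXm, (hbound F c a hF X hXs).trans_lt (ENNReal.mul_lt_top hD.lt_top
          (ENNReal.rpow_lt_top_of_nonneg (one_div_pos.2 hp).le hF.cost_lt_top.ne))⟩
      refine ⟨hXL.toLp X, ?_⟩
      filter_upwards [hXs, hXL.coeFn_toLp] with x h1 h2
      rwa [h2])
    (fun c a hF => by
      -- The zero distribution is given by the function f = 0, whose commutator vanishes.
      have := h.ae_hasSum_of_isAtomicDecomposition hΩ hDini hℓ₀ hℓ₀2 hb hF hℓ₀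
        (f := 0) MemLp.zero (fun φ => by simp)
      simpa [commutator, commutatorIntegrand] using this)
  refine ⟨S, hS, fun F => ?_⟩
  have hle : ∀ c a, IsAtomicDecomposition p (F : 𝓢'(Rn n, ℂ)) c a →
      eLpNorm (S F) (ENNReal.ofReal q) volume ≤ D * (∑' j, ‖c j‖ₑ ^ p) ^ (1 / p) :=
    fun c a hF => hbound F c a hF _ (hS F c a hF)
  rw [mul_right_comm C A]
  -- The infimum is reached after dividing by D; for D = 0, for instance when b is constant, one
  -- decomposition suffices.
  rcases eq_or_ne D 0 with hD0 | hD0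
  · obtain ⟨c, a, hF⟩ := F.2
    have := hle c a hF
    rw [hD0, zero_mul] at this
    exact this.trans zero_le
  · refine (ENNReal.div_le_iff_le_mul (Or.inl hD0) (Or.inl hD)).1 ?_ |>.trans_eq (mul_comm _ _)
    refine le_iInf fun c => le_iInf fun a => le_iInf fun hF => ?_
    refine (ENNReal.div_le_iff_le_mul (Or.inl hD0) (Or.inl hD)).2 ?_
    rw [mul_comm]
    exact hle c a hF

/-! ### Uniqueness of the extension -/

/-- A finite sum of atoms is in L², hence a tempered distribution. Keeping the same atoms with
truncated coefficients makes the remainder a decomposition too. -/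
theorem IsAtomicDecomposition.exists_partialSum {n : ℕ} {p : ℝ} (hp0 : 0 < p)
    {F : 𝓢'(Rn n, ℂ)} {c : ℕ → ℂ} {a : ℕ → Rn n → ℂ} (h : IsAtomicDecomposition p F c a) (N : ℕ) :
    ∃ G : 𝓢'(Rn n, ℂ), IsAtomicDecomposition p G (fun j => if j < N then c j else 0) a ∧
      ∀ φ : 𝓢(Rn n, ℂ), G φ = ∫ x, (∑ j ∈ Finset.range N, c j * a j x) * φ x := by
  have h2 : ∀ j, MemLp (a j) 2 volume := fun j => by simpa using (h.isAtom j).1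
  have hf : MemLp (fun x => ∑ j ∈ Finset.range N, c j * a j x) 2 volume :=
    memLp_finsetSum _ fun j _ => (h2 j).const_mul _
  have hG : ∀ φ : 𝓢(Rn n, ℂ), Lp.toTemperedDistribution (hf.toLp _) φ =
      ∫ x, (∑ j ∈ Finset.range N, c j * a j x) * φ x := by
    intro φ
    rw [Lp.toTemperedDistribution_apply]
    refine integral_congr_ae ?_
    filter_upwards [hf.coeFn_toLp] with x hx
    rw [hx, smul_eq_mul, mul_comm]
  refine ⟨Lp.toTemperedDistribution (hf.toLp _), ⟨h.isAtom, ?_, fun φ => ?_⟩, hG⟩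
  · refine lt_of_le_of_lt (ENNReal.tsum_le_tsum fun j => ?_) h.cost_lt_top
    split_ifs
    · exact le_rfl
    · simp [hp0]
  · have hi : ∀ j, Integrable fun x => a j x * φ x := fun j =>
      (h2 j).integrable_mul (φ.memLp 2 volume)
    have e : ∫ x, (∑ j ∈ Finset.range N, c j * a j x) * φ x =
        ∑ j ∈ Finset.range N, (if j < N then c j else 0) * ∫ x, a j x * φ x := by
      simp only [Finset.sum_mul, mul_assoc]
      rw [integral_finsetSum _ fun j _ => (hi j).const_mul (c j)]
      refine Finset.sum_congr rfl fun j hj => ?_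
      rw [if_pos (Finset.mem_range.1 hj), integral_const_mul]
    rw [hG, e]
    refine hasSum_sum_of_ne_finset_zero fun j hj => ?_
    rw [if_neg (by simpa using hj), zero_mul]

theorem IsAtomicDecomposition.sub_partialSum {n : ℕ} {p : ℝ} (hp0 : 0 < p)
    {F G : 𝓢'(Rn n, ℂ)} {c : ℕ → ℂ} {a : ℕ → Rn n → ℂ} (h : IsAtomicDecomposition p F c a) {N : ℕ}
    (hG : IsAtomicDecomposition p G (fun j => if j < N then c j else 0) a) :
    IsAtomicDecomposition p (F - G) (fun j => if j < N then 0 else c j) a := by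
  refine ⟨h.isAtom, ?_, fun φ => ?_⟩
  · refine lt_of_le_of_lt (ENNReal.tsum_le_tsum fun j => ?_) h.cost_lt_top
    split_ifs
    · simp [hp0]
    · exact le_rfl
  · have e : (F - G) φ = F φ - G φ := rfl
    rw [e]
    have e' : (fun j => (if j < N then 0 else c j) * ∫ x, a j x * φ x) = fun j =>
        c j * (∫ x, a j x * φ x) - (if j < N then c j else 0) * ∫ x, a j x * φ x := by
      funext j
      split_ifs <;> ring
    rw [e']
    exact (h.hasSum φ).sub (hG.hasSum φ)

theorem tendsto_tsum_tail_rpow {p : ℝ} (hp : 0 < p) {c : ℕ → ℂ} (hc : ∑' j, ‖c j‖ₑ ^ p < ∞) :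
    Tendsto (fun N : ℕ => ∑' j, ‖if j < N then 0 else c j‖ₑ ^ p) atTop (𝓝 0) := by
  refine tendsto_tsum_zero_of_dominated hc.ne (fun N j => ?_) fun j => ?_
  · split_ifs
    · simp [hp]
    · exact le_rfl
  · refine tendsto_const_nhds.congr' ?_
    filter_upwards [eventually_gt_atTop j] with N hN
    rw [if_pos hN]
    simp [hp]

/-- Both operators are given by the integral on finite sums of atoms, which lie in L^ℓ because ℓ ≤ 2
and the supports are bounded. On the remainder both are controlled by the tail of ∑ |c j|^p, which
tends to 0. -/
theorem IsCommutatorExtension.unique {n : ℕ} {p : ℝ} {hp0 : 0 < p} (hp1 : p < 1)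
    {q r α β ℓ : ℝ} (hq : 0 < q) (hℓ0 : 0 < ℓ) (hℓ2 : ℓ ≤ 2) (hrℓ : r / (r - 1) < ℓ)
    (hℓ : ℓ < n / (α + β)) {Ω : Rn n → Rn n → ℂ} {b : Rn n → ℂ}
    {S S' : Hardy n p hp0 →ₗ[ℂ] Lp ℂ (ENNReal.ofReal q) (volume : Measure (Rn n))}
    (h : IsCommutatorExtension hp0 q r α β Ω b S) (h' : IsCommutatorExtension hp0 q r α β Ω b S') :
    S = S' := by
  refine LinearMap.ext fun F => ?_
  obtain ⟨c, a, hF⟩ := F.2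
  obtain ⟨M, hM⟩ := h.bounded
  obtain ⟨M', hM'⟩ := h'.bounded
  set K := (ENNReal.ofReal q).LpAddConst with hKdef
  have hK : K ≠ ∞ := (ENNReal.LpAddConst_lt_top _).ne
  have hle : ∀ N : ℕ, eLpNorm (S F - S' F : Lp ℂ (ENNReal.ofReal q) (volume : Measure (Rn n)))
      (ENNReal.ofReal q) volume ≤
      K * (M + M') * (∑' j, ‖if j < N then 0 else c j‖ₑ ^ p) ^ (1 / p) := by
    intro N
    obtain ⟨G, hGdec, hG⟩ := hF.exists_partialSum hp0 N
    set G' : Hardy n p hp0 := ⟨G, _, _, hGdec⟩ with hG'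
    have hf : MemLp (fun x => ∑ j ∈ Finset.range N, c j * a j x) (ENNReal.ofReal ℓ) volume := by
      refine memLp_finsetSum _ fun j _ => MemLp.const_mul ?_ _
      obtain ⟨x₀, d, hat⟩ := (hF.isAtom j).exists_isAtomOn hp0 hp1
      exact hat.memLp_of_le_two (atomConst_ne_top n _) hℓ0 hℓ2
    have e1 : S G' = S' G' := Lp.ext
      ((h.agrees G' ℓ _ hrℓ hℓ hf hG).2.trans (h'.agrees G' ℓ _ hrℓ hℓ hf hG).2.symm)
    have e2 : S F - S' F = S (F - G') - S' (F - G') := by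
      rw [map_sub, map_sub, e1, sub_sub_sub_cancel_right]
    have hH : hardyNorm p ((F - G' : Hardy n p hp0) : 𝓢'(Rn n, ℂ)) ≤
        (∑' j, ‖if j < N then 0 else c j‖ₑ ^ p) ^ (1 / p) :=
      (hF.sub_partialSum hp0 hGdec).hardyNorm_le
    rw [e2, eLpNorm_congr_ae (Lp.coeFn_sub _ _)]
    refine (eLpNorm_sub_le' (Lp.aestronglyMeasurable _) (Lp.aestronglyMeasurable _) _).trans ?_
    rw [mul_assoc, add_mul]
    gcongr
    · exact (hM _).trans (by gcongr)
    · exact (hM' _).trans (by gcongr)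
  have hlim := ENNReal.Tendsto.const_mul (a := K * (M + M'))
    ((tendsto_tsum_tail_rpow hp0 hF.cost_lt_top).ennrpow_const (1 / p))
    (Or.inr (ENNReal.mul_ne_top hK (by simp)))
  rw [ENNReal.zero_rpow_of_pos (one_div_pos.2 hp0), mul_zero] at hlim
  have hzero := le_antisymm (ge_of_tendsto' hlim hle) zero_le
  rw [eLpNorm_eq_zero_iff (Lp.aestronglyMeasurable _) (by simpa using hq)] at hzero
  refine sub_eq_zero.1 (Lp.ext (hzero.trans (Lp.coeFn_zero _ _ _).symm))

/-! ### The exponents -/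

/-- The upper bound ℓ < n/(α + β) is equivalent to s ℓ' > n, the integrability of the kernel at
infinity. -/
theorem admissible_of_lt {n : ℕ} {α β r s ℓ : ℝ} (hr : 1 < r) (hαβ : 0 < α + β)
    (hs : s = n - α - β) (h1 : r / (r - 1) < ℓ) (h2 : ℓ < n / (α + β)) :
    Admissible n (r / (r - 1)) s ℓ := by
  have hr1 : 0 < r - 1 := by linarith
  have hℓ : 1 < ℓ := lt_trans (by rw [lt_div_iff₀ hr1]; linarith) h1
  refine ⟨hℓ, h1.le, ?_⟩
  rw [lt_div_iff₀ hαβ] at h2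
  rw [Real.conjExponent, ← mul_div_assoc, lt_div_iff₀ (by linarith), hs]
  nlinarith

/-- The first lower bound on r yields the decay condition, and also r > 2, hence t < 2. The second
says that r' < n/(α + β), so the range of ℓ is not empty. The choice Q = max(q, r') is the least one
that `exists_local_bound` accepts. -/
theorem exponents_of_hypotheses {n : ℕ} (hn : 2 ≤ n) {α β p q r : ℝ} (hβ0 : 0 < β) (hβ1 : β ≤ 1)
    (hα0 : 0 ≤ α) (hα : α < n - β) (hp0 : 0 < p) (hp : (n : ℝ) / (n + β) < p) (hp1 : p < 1)
    (hq : 1 / q = 1 / p - (α + β) / n)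
    (hr : max ((n : ℝ) / (β + n - n / p)) ((n : ℝ) / (n - α - β)) < r) :
    Exponents n α β p q r (r / (r - 1)) (max q (r / (r - 1))) (n - α - β) ∧ 1 < r ∧
      r / (r - 1) < n / (α + β) := by
  have hn2 : (2 : ℝ) ≤ n := by exact_mod_cast hn
  have hn0 : (0 : ℝ) < n := by linarith
  have hs : 0 < (n : ℝ) - α - β := by linarith
  have hnp : (n : ℝ) / p < n + β := by
    rw [div_lt_iff₀ (by positivity)] at hp
    rw [div_lt_iff₀ hp0]
    linarith
  have hnp1 : (n : ℝ) < n / p := by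
    rw [lt_div_iff₀ hp0]
    nlinarith
  have he : 0 < β + n - n / p := by linarith
  obtain ⟨hr1, hr2⟩ := max_lt_iff.1 hr
  rw [div_lt_iff₀ he] at hr1
  rw [div_lt_iff₀ hs] at hr2
  have hr0 : 0 < r := by
    by_contra hneg
    nlinarith
  -- Here n < r (β + n - n/p), and the bracket is less than β ≤ 1 because p < 1, so r > n ≥ 2.
  have hr3 : (2 : ℝ) < r := by nlinarith
  have hr4 : 0 < r - 1 := by linarith
  have hrel : (n : ℝ) / q = n / p - α - β := by
    have : (n : ℝ) * (1 / q) = n * (1 / p - (α + β) / n) := by rw [hq]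
    rw [mul_one_div, mul_sub, mul_one_div, mul_div_cancel₀ _ hn0.ne'] at this
    linarith
  have hnq : 0 < (n : ℝ) / q := by linarith
  have hq0 : 0 < q := by
    by_contra hneg
    exact absurd hnq (not_lt.2 (div_nonpos_of_nonneg_of_nonpos hn0.le (not_lt.1 hneg)))
  have hconj := Real.HolderConjugate.conjExponent (p := r) (by linarith)
  have hnt : (n : ℝ) / (r / (r - 1)) = n - n / r := by
    field_simp
  have hnr : 0 < (n : ℝ) / r := by positivity
  refine ⟨⟨by omega, hconj, hβ0, hβ1, hp0, hp1, hq0, ?_, le_max_left _ _, le_max_right _ _, ?_,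
    rfl, ?_, hrel, ?_, by linarith⟩, by linarith, ?_⟩
  · have : (n : ℝ) / q ≤ n / p := by linarith
    exact (div_le_div_iff_of_pos_left hn0 hq0 hp0).1 this
  · rw [div_lt_iff₀ hr4]
    linarith
  -- If Q = q, then n/q = n/p - α - β already exceeds s because p < 1; if Q = r', the right side
  -- equals n.
  · rcases max_choice q (r / (r - 1)) with hmax | hmax <;> rw [hmax] <;> linarith
  · rw [← div_lt_iff₀ hq0, hrel]
    have : (n : ℝ) / r < β + n - n / p := by
      rw [div_lt_iff₀ hr0]
      linarith
    linarith
  · rw [div_lt_div_iff₀ hr4 (by linarith)]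
    nlinarith

end VariableKernel

/-! ### The boundedness theorem -/

theorem theorem1p2 (n : ℕ) (hn : 2 ≤ n) (α β p q r : ℝ)
    (hβ0 : 0 < β) (hβ1 : β ≤ 1) (hα0 : 0 ≤ α) (hα : α < n - β)
    (hp0 : 0 < p) (hp : (n : ℝ) / (n + β) < p) (hp1 : p < 1)
    (hq : 1 / q = 1 / p - (α + β) / n)
    (hr : max ((n : ℝ) / (β + n - n / p)) ((n : ℝ) / (n - α - β)) < r)
    (Ω : Rn n → Rn n → ℂ) (hΩ : IsKernel r Ω) (hDini : DiniCondition r β Ω) :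
    ∃ C : ℝ≥0, 0 < C ∧ ∀ b : Rn n → ℂ, lipNorm β b < ∞ →
      (∃! S, IsCommutatorExtension hp0 q r α β Ω b S) ∧
      ∀ S, IsCommutatorExtension hp0 q r α β Ω b S → ∀ F : Hardy n p hp0,
        eLpNorm (S F) (ENNReal.ofReal q) volume
          ≤ C * lipNorm β b * hardyNorm p (F : 𝓢'(Rn n, ℂ)) := by
  obtain ⟨h, hr1, hlt⟩ := exponents_of_hypotheses hn hβ0 hβ1 hα0 hα hp0 hp hp1 hq hr
  have hαβ : 0 < α + β := by linarith
  -- An exponent at most 2 is needed because atoms are only known to be in L²; the interval (r',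
  -- min(2, n/(α + β))) is not empty.
  obtain ⟨ℓ₀, hℓ₀, hℓ₀'⟩ := exists_between (lt_min h.t_lt_two hlt)
  have hadm : ∀ ℓ : ℝ, r / (r - 1) < ℓ → ℓ < n / (α + β) →
      Admissible n (r / (r - 1)) (n - α - β) ℓ := fun ℓ h1 h2 => admissible_of_lt hr1 hαβ rfl h1 h2
  have hℓ₀2 : ℓ₀ < 2 := hℓ₀'.trans_le (min_le_left _ _)
  have hℓ₀n : ℓ₀ < n / (α + β) := hℓ₀'.trans_le (min_le_right _ _)
  have had := hadm ℓ₀ hℓ₀ hℓ₀n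
  obtain ⟨C, hC, H⟩ := h.exists_linearMap hΩ hDini had hℓ₀2.le
  -- Adding 1 only ensures that the constant is positive.
  refine ⟨C.toNNReal + 1, by positivity, fun b hb => ?_⟩
  obtain ⟨S, hS, hSle⟩ := H b hb
  have hCle : C ≤ ((C.toNNReal + 1 : ℝ≥0) : ℝ≥0∞) := by
    rw [ENNReal.coe_add, ENNReal.coe_toNNReal hC]
    exact le_self_add
  have hext : IsCommutatorExtension hp0 q r α β Ω b S := by
    refine ⟨⟨(C * lipNorm β b).toNNReal, fun F => ?_⟩, fun F ℓ f h1 h2 hf hFf => ?_⟩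
    · rw [ENNReal.coe_toNNReal (ENNReal.mul_ne_top hC hb.ne)]
      exact hSle F
    · refine ⟨h.ae_integrable_commutatorIntegrand hΩ (hadm ℓ h1 h2) hb hf, ?_⟩
      obtain ⟨c, a, hF⟩ := F.2
      filter_upwards [hS F c a hF, h.ae_hasSum_of_isAtomicDecomposition hΩ hDini had hℓ₀2.le hb hF
        (hadm ℓ h1 h2) hf hFf] with x hx1 hx2
      exact hx1.unique hx2
  have huniq : ∀ S', IsCommutatorExtension hp0 q r α β Ω b S' → S' = S := fun S' h' =>
    h'.unique hp1 h.q_pos (zero_lt_one.trans had.one_lt) hℓ₀2.le hℓ₀ hℓ₀n hext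
  refine ⟨⟨S, hext, huniq⟩, fun S' h' F => ?_⟩
  rw [huniq S' h']
  exact (hSle F).trans (by gcongr)
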